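/- **Setting.** Let $d\ge 1$, let $\mathcal X=\{x\in\mathbb R^d:\|x\|_2\le 1\}$, and let $\rho$ be a Borel probability measure on $\mathcal X\times[-1,1]$ whose marginal $\rho_{\mathcal X}$ on $\mathcal X$ is non-degenerate (every nonempty relatively open subset of $\mathcal X$ has positive measure). Let $g_\rho(x)=\int y\,d\rho(y|x)$ be the regression function and $\|\cdot\|_\rho$ the norm of $\mathcal L^2_{\rho_{\mathcal X}}$. Let $\sigma:\mathbb R\to\mathbb R$ be twice differentiable with $\|\sigma'\|_\infty\le C_\sigma$, $\|\sigma''\|_\infty\le C_\sigma$ for some $C_\sigma>0$ and $|\sigma(u)|\le 1+|u|$ for all $u$. Put $\kappa=(4+2C_\sigma^2)^{1/2}$, let $\gamma\in[0,1]$, and let $\mu_0$ be the uniform distribution on the unit sphere of $\mathbb R^d$. *Network and algorithm.* For even $M$ and $\Theta=(a_r,b_r,c_r)_{r=1}^M$, $a_r,c_r\in\mathbb R$, $b_r\in\mathbb R^d$, let $g_\Theta(x)=M^{-1/2}\sum_{r=1}^M a_r\,\sigma(b_r^\top x+\gamma c_r)$. The initialization $\Theta^{(0)}$ is symmetric: $a^{(0)}_r=1$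 for $r\le M/2$ and $a_r^{(0)}=-1$ for $r>M/2$, $b^{(0)}_r=b^{(0)}_{r+M/2}$ for $r\le M/2$ with $b^{(0)}_1,\dots,b^{(0)}_{M/2}$ i.i.d. from $\mu_0$, and $c^{(0)}_r=0$. Given i.i.d. samples $z_t=(x_t,y_t)\sim\rho$, set $\Theta^{(1)}=\Theta^{(0)}$ and $$\Theta^{(t+1)}=\Theta^{(t)}-\eta_t\big(g_{\Theta^{(t)}}(x_t)-y_t\big)\nabla_\Theta g_\Theta(x_t)\big|_{\Theta=\Theta^{(t)}}-\eta_t\lambda\big(\Theta^{(t)}-\Theta^{(0)}\big),\qquad \eta_t=\eta t^{-\theta}.$$ *Kernel.* Let $$k_\infty(x,x')=\mathbb E_{b\sim\mu_0}[\sigma(b^\top x)\sigma(b^\top x')]+(x^\top x'+\gamma^2)\,\mathbb E_{b\sim\mu_0}[\sigma'(b^\top x)\sigma'(b^\top x')]$$ and let $L_\infty f=\int f(x)\,k_\infty(x,\cdot)\,d\rho_{\mathcal X}(x)$ on $\mathcal L^2_{\rho_{\mathcal X}}$, with orthonormal eigensystem $(\mu_i,\varphi_i)_{i\ge1}$, the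 eigenvalues being counted with multiplicity and sorted in non-ascending order, and with $L_\infty^r h=\sum_i\mu_i^r\langle \varphi_i,h\rangle_\rho\,\varphi_i$. Assume * (source condition) $g_\rho\in L_\infty^r(\mathcal L^2_{\rho_{\mathcal X}})$ for some $\tfrac12<r\le1$; * (eigenvalue decay) there are $\beta>1$ and $b,c>0$ with $b\,i^{-\beta}\le\mu_i\le c\,i^{-\beta}$ for all $i\ge1$. **Theorem.** Let $\tfrac12<\theta<1$ and $\eta>0$, and put $H(\theta)=\frac{2\eta}{1-\theta}2^{1-\theta}\big(1-(\tfrac34)^{1-\theta}\big)$. There is a constant $\tilde C>0$, which may depend on $\sigma,C_\sigma,\gamma,\rho,r,\beta,b,c,\theta,\eta$ but not on $T$, $\lambda$, $M$ or $\delta$, such that the following holds. Let $\lambda>0$ and $T\in\mathbb N_+$ be such that $$\eta<\Big(\lambda+\frac{208(1+\kappa)^4}{(1-2^{\theta-1})(2\theta-1)}\Big(\log\frac{8}{1-\theta}+\frac1{1-\theta}\Big)\Big)^{-1},$$ let $M$ be even with $M\ge\big\lceil\max\{T^{6-5\theta},\,T^{2\theta},\,T^\theta/\lambda^2\}\big\rceil$,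 and let $\delta\in(0,1)$. Then, with probability at least $1-\delta$ over the random choice of $\Theta^{(0)}$: (a) if $\theta<\frac{2\beta-1}{3\beta-1}$, $$\mathbb E_{z_1,\dots,z_T}\big[\|g_{\Theta^{(T+1)}}-g_\rho\|_\rho^2\big]\le\tilde C\Big(T^{-2r(1-\theta)}+\exp\big\{-H(\theta)\,T^{1-\frac{3\beta-1}{2\beta-1}\theta}\big\}+T^{-\theta}+\lambda^{2r}\Big)\log\frac2\delta;$$ (b) if $\theta\ge\frac{2\beta-1}{3\beta-1}$, $$\mathbb E_{z_1,\dots,z_T}\big[\|g_{\Theta^{(T+1)}}-g_\rho\|_\rho^2\big]\le\tilde C\Big(T^{-2r(1-\theta)}+\exp\big\{-H(\theta)\,\lambda\, T^{1-\theta}\big\}+T^{-\theta}+\lambda^{2r}\Big)\log\frac2\delta.$$ -/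

import Mathlib

open MeasureTheory Set
open scoped ENNReal

noncomputable section

namespace NTKSGD

/-- The input space `ℝ^d` with its Euclidean norm. -/
abbrev Inp (d : ℕ) : Type := EuclideanSpace ℝ (Fin d)

/-! ### The two-layer network -/

/-- Parameters `Θ = (a, B, c)` of a network of width `M`. -/
structure Params (d M : ℕ) where
  a : Fin M → ℝ
  B : Fin M → Inp d
  c : Fin M → ℝ

/-- `g_Θ(x) = M^{-1/2} ∑_r a_r σ(b_rᵀ x + γ c_r)`. -/
def network {d M : ℕ} (σ : ℝ → ℝ) (γ : ℝ) (Θ : Params d M) (x : Inp d) : ℝ :=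
  (1 / Real.sqrt M) * ∑ r, Θ.a r * σ (inner ℝ (Θ.B r) x + γ * Θ.c r)

/-- The uniform distribution on the unit sphere of `ℝ^d`: the normalized surface measure,
seen as a measure on `ℝ^d`. -/
def sphereUniform (d : ℕ) : Measure (Inp d) :=
  (((volume : Measure (Inp d)).toSphere univ)⁻¹ • (volume : Measure (Inp d)).toSphere).map
    Subtype.val

/-- Symmetric initialization of a network of even width `M = m + m` with output scale `1`:
`a_r = 1` on the first half and `-1` on the second, the `m` input weights `w` are used on both
halves, the biases are `0`. -/
def symInit {d m : ℕ} (w : Fin m → Inp d) : Params d (m + m) where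
  a := Fin.append (fun _ => 1) (fun _ => -1)
  B := Fin.append w w
  c := fun _ => 0

/-- The law of the `m` independent input weights, uniform on the sphere. -/
def initLaw (d m : ℕ) : Measure (Fin m → Inp d) :=
  Measure.pi (fun _ => sphereUniform d)

/-! ### Stochastic gradient descent -/

/-- One step `Θ ↦ Θ - s (g_Θ(x) - y) ∇_Θ g_Θ(x) - s λ (Θ - Θ₀)` with step size `s` at the
sample `z = (x, y)`, written out in the coordinates `a`, `B`, `c`. -/
def sgdStep {d M : ℕ} (σ : ℝ → ℝ) (γ lam s : ℝ) (Θ₀ Θ : Params d M) (z : Inp d × ℝ) :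
    Params d M where
  a := fun r => Θ.a r
    - s * (network σ γ Θ z.1 - z.2)
        * ((1 / Real.sqrt M) * σ (inner ℝ (Θ.B r) z.1 + γ * Θ.c r))
    - s * lam * (Θ.a r - Θ₀.a r)
  B := fun r => Θ.B r
    - (s * (network σ γ Θ z.1 - z.2)
        * ((1 / Real.sqrt M) * (Θ.a r * deriv σ (inner ℝ (Θ.B r) z.1 + γ * Θ.c r)))) • z.1
    - (s * lam) • (Θ.B r - Θ₀.B r)
  c := fun r => Θ.c r
    - s * (network σ γ Θ z.1 - z.2)
        * ((1 / Real.sqrt M) * (Θ.a r * γ * deriv σ (inner ℝ (Θ.B r) z.1 + γ * Θ.c r)))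
    - s * lam * (Θ.c r - Θ₀.c r)

/-- The iterate `Θ^{(T+1)}` as a function of the samples `z_1, …, z_T` (here `z 0, …, z (T-1)`);
`Θ^{(1)} = Θ₀`, and step number `t` has step size `η t^{-θ}`. -/
def sgd {d M : ℕ} (σ : ℝ → ℝ) (γ lam η θ : ℝ) (Θ₀ : Params d M) :
    (T : ℕ) → (Fin T → Inp d × ℝ) → Params d M
  | 0, _ => Θ₀
  | T + 1, z =>
      sgdStep σ γ lam (η * ((T : ℝ) + 1) ^ (-θ)) Θ₀
        (sgd σ γ lam η θ Θ₀ T (Fin.init z)) (z (Fin.last T))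

/-! ### The learning problem -/

/-- The regression function `g_ρ(x) = ∫ y dρ(y|x)`. -/
def regressionFn {d : ℕ} (ρ : Measure (Inp d × ℝ)) [IsFiniteMeasure ρ] (x : Inp d) : ℝ :=
  ∫ y, y ∂(ρ.condKernel x)

/-- `‖f - g‖²` in `L²(ν)`, as an extended nonnegative number. -/
def sqDist {d : ℕ} (ν : Measure (Inp d)) (f g : Inp d → ℝ) : ℝ≥0∞ :=
  ∫⁻ x, ENNReal.ofReal ((f x - g x) ^ 2) ∂ν

/-- `E_{z_1,…,z_T} ‖g_{Θ^{(T+1)}} - g_ρ‖²_ρ` for i.i.d. samples from `ρ`, with the initial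
parameters `Θ₀` held fixed. -/
def expectedExcessRisk {d M : ℕ} (σ : ℝ → ℝ) (γ lam η θ : ℝ) (ρ : Measure (Inp d × ℝ))
    [IsFiniteMeasure ρ] (Θ₀ : Params d M) (T : ℕ) : ℝ≥0∞ :=
  ∫⁻ z, sqDist ρ.fst (network σ γ (sgd σ γ lam η θ Θ₀ T z)) (regressionFn ρ)
    ∂(Measure.pi (fun _ : Fin T => ρ))

/-! ### The neural tangent kernel and its integral operator -/

/-- `k_∞(x, x') = E_b[σ(bᵀx) σ(bᵀx')] + (xᵀx' + γ²) E_b[σ'(bᵀx) σ'(bᵀx')]`, `b` uniform on the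
sphere (output scale `1`). -/
def ntk {d : ℕ} (σ : ℝ → ℝ) (γ : ℝ) (x x' : Inp d) : ℝ :=
  (∫ b, σ (inner ℝ b x) * σ (inner ℝ b x') ∂(sphereUniform d))
    + (inner ℝ x x' + γ ^ 2)
      * ∫ b, deriv σ (inner ℝ b x) * deriv σ (inner ℝ b x') ∂(sphereUniform d)

/-- The integral operator `(L f)(x') = ∫ f(x) k(x, x') dν(x)`. -/
def integralOp {d : ℕ} (k : Inp d → Inp d → ℝ) (ν : Measure (Inp d)) (f : Inp d → ℝ)
    (x' : Inp d) : ℝ :=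
  ∫ x, f x * k x x' ∂ν

/-- `(μ_i, φ_i)` is an orthonormal eigensystem in `L²(ν)` of the integral operator of `k`, the
eigenvalues nonnegative, repeated according to multiplicity and sorted in non-ascending order.
The last field says that nothing but the kernel of the operator is missed. -/
structure IsEigensystem {d : ℕ} (k : Inp d → Inp d → ℝ) (ν : Measure (Inp d))
    (μ : ℕ → ℝ) (φ : ℕ → Lp ℝ 2 ν) : Prop where
  nonneg : ∀ i, 0 ≤ μ i
  antitone : Antitone μ
  orthonormal : Orthonormal ℝ φ
  eigen : ∀ i, integralOp k ν (φ i) =ᵐ[ν] fun x => μ i * φ i x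
  complete : ∀ f : Lp ℝ 2 ν, (∀ i, inner ℝ (φ i) f = 0) → integralOp k ν f =ᵐ[ν] 0

/-- `g` lies in the range of `L^r`, where `L^r h = ∑_i μ_i^r ⟨φ_i, h⟩ φ_i` for the eigensystem
`(μ_i, φ_i)` of `L`. -/
def InPowerRange {d : ℕ} {ν : Measure (Inp d)} (μ : ℕ → ℝ) (φ : ℕ → Lp ℝ 2 ν) (r : ℝ)
    (g : Inp d → ℝ) : Prop :=
  ∃ G h : Lp ℝ 2 ν, G =ᵐ[ν] g ∧ HasSum (fun i => (μ i ^ r * inner ℝ (φ i) h) • φ i) G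

/-! ### Assumptions -/

/-- `σ` is twice differentiable, `|σ'| ≤ C`, `|σ''| ≤ C` and `|σ(u)| ≤ 1 + |u|`. -/
structure IsSmoothActivation (σ : ℝ → ℝ) (C : ℝ) : Prop where
  pos : 0 < C
  diff : Differentiable ℝ σ
  diff_deriv : Differentiable ℝ (deriv σ)
  deriv_le : ∀ u, |deriv σ u| ≤ C
  deriv2_le : ∀ u, |deriv (deriv σ) u| ≤ C
  growth : ∀ u, |σ u| ≤ 1 + |u|

/-- The marginal on the inputs is supported on the closed unit ball and non-degenerate (it
charges every nonempty relatively open subset of the ball), the outputs lie in `[-1, 1]`. -/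
structure IsBoundedData {d : ℕ} (ρ : Measure (Inp d × ℝ)) : Prop where
  input : ∀ᵐ x ∂ρ.fst, ‖x‖ ≤ 1
  nondegenerate : ∀ U : Set (Inp d), IsOpen U → (U ∩ Metric.closedBall 0 1).Nonempty →
    0 < ρ.fst (U ∩ Metric.closedBall 0 1)
  output : ∀ᵐ z ∂ρ, z.2 ∈ Icc (-1 : ℝ) 1

/-! ### The quantities in the bounds -/

/-- `κ = (4 + 2 C²)^{1/2}`. -/
def kappa (C : ℝ) : ℝ := Real.sqrt (4 + 2 * C ^ 2)

/-- The strict upper bound for the step size constant `η`. -/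
def etaBound (κ lam θ : ℝ) : ℝ :=
  (lam + 208 * (1 + κ) ^ 4 / ((1 - (2 : ℝ) ^ (θ - 1)) * (2 * θ - 1))
    * (Real.log (8 / (1 - θ)) + 1 / (1 - θ)))⁻¹

/-- `M₀(T, λ) = ⌈max {T^{6-5θ}, T^{2θ}, T^θ / λ²}⌉`. -/
def widthBound (T : ℕ) (lam θ : ℝ) : ℕ :=
  ⌈max (max ((T : ℝ) ^ (6 - 5 * θ)) ((T : ℝ) ^ (2 * θ))) ((T : ℝ) ^ θ / lam ^ 2)⌉₊

/-- `H(θ) = (2η / (1-θ)) 2^{1-θ} (1 - (3/4)^{1-θ})`. -/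
def Hfun (η θ : ℝ) : ℝ :=
  2 * η / (1 - θ) * (2 : ℝ) ^ (1 - θ) * (1 - (3 / 4 : ℝ) ^ (1 - θ))

end NTKSGD

end

/-! By the symmetric initialization the network starts as the zero function. Write `W` for the
displacement of the parameters and `Φ(x)` for the gradient at initialization. The network is then
`⟨W, Φ(x)⟩` up to an error of order `‖W‖² / √M`, so its training can be compared with linear SGD for
the features `Φ` on the same samples. Almost surely `‖W‖²` grows by at most `4 s` in a step of size
`s` and stays `O(T^{1-θ})`. Summing the local errors, the two trained functions differ by
`O(T^{2(1-θ)} / √M) = O(T^{-θ/2})` (`sgd_near_linSgd`, `abs_network_sgd_sub_le`), which costs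
`T^{-θ}` in the risk.

For the linear model let `S` map parameters to functions and let `A = S S*`. Peeling off the last
sample repeatedly gives a bias–variance bound (`lintegral_linSgd_sq_le`). The bias is that of
deterministic gradient descent. The variance is `∑ s_t² K ∫ ‖P_t S Φ(x)‖²`, where `P_t` is the
product of the steps after `t` and `K` bounds the second moments uniformly in the number of steps
(`IsSource.exists_moment_bound`).

Bias: the regression function is within `τ^r` of `L u` with `‖u‖ ≲ τ^{r-1}`, and gradient descent
treats elements of the range of `A` well. The choice `τ = max(λ, T^{θ-1}/η)` yields `T^{-2r(1-θ)} +
λ^{2r}` (`IsSource.bias_le`).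

Variance: `∫ ‖P S Φ‖²` is the squared Hilbert–Schmidt norm of `P A`. Smoothing bounds `P A` on the
top eigenvectors of `L`, and the eigenvalue decay controls the rest. After steps of total length `ℓ`
the result is `(1 + ℓ)^{-(2 - 1/β)}` plus the kernel deviation (`IsSource.exists_trace_bound`). As
`2 - 1/β > 1`, the later half of the steps contributes `T^{-θ}`. The earlier half contributes
`T^{-(2-1/β)(1-θ)} ≤ T^{-θ}` below the threshold on `θ`. Above it, the contraction by `λ` gives the
exponential term.

The only random event concerns the initialization: `A` is close to `L` in Hilbert–Schmidt norm, with
squared deviation `O(log(2/δ) / M)`. This is a Hoeffding bound in `L²`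
(`IsCenteredField.measure_fieldSq_le`). The width makes the deviation at most of order `T^{-θ}
min(1, λ²) log(2/δ)`. -/

namespace NTKSGD

/-! ### Regularized gradient steps for a positive operator -/

section GradientSteps

variable {E : Type*} [NormedAddCommGroup E] [InnerProductSpace ℝ E]

/-- `A` is symmetric and `A² ≤ K A`. -/
structure IsPosBounded (A : E →L[ℝ] E) (K : ℝ) : Prop where
  symm : ∀ x y, inner ℝ (A x) y = inner ℝ x (A y)
  sq_le : ∀ x, ‖A x‖ ^ 2 ≤ K * inner ℝ (A x) x
  pos : 0 < K

/-- The step `x ↦ x - s (A + lam) x`. -/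
noncomputable def ridgeStep (A : E →L[ℝ] E) (lam s : ℝ) : E →L[ℝ] E :=
  (1 - s * lam) • ContinuousLinearMap.id ℝ E - s • A

/-- The composition of the steps with numbers `t, …, t + k - 1`. -/
noncomputable def ridgeProd (A : E →L[ℝ] E) (lam : ℝ) (s : ℕ → ℝ) (t : ℕ) : ℕ → (E →L[ℝ] E)
  | 0 => ContinuousLinearMap.id ℝ E
  | k + 1 => (ridgeStep A lam (s (t + k))).comp (ridgeProd A lam s t k)

/-- Gradient descent from `0` towards `g`. -/
noncomputable def ridgePath (A : E →L[ℝ] E) (lam : ℝ) (s : ℕ → ℝ) (g : E) : ℕ → E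
  | 0 => 0
  | t + 1 => ridgeStep A lam (s t) (ridgePath A lam s g t) + s t • A g

variable {A : E →L[ℝ] E} {K lam : ℝ} {s : ℕ → ℝ}

theorem ridgeStep_apply (A : E →L[ℝ] E) (lam s : ℝ) (x : E) :
    ridgeStep A lam s x = (1 - s * lam) • x - s • A x := by
  simp [ridgeStep]

theorem IsPosBounded.inner_nonneg (hA : IsPosBounded A K) (x : E) : 0 ≤ inner ℝ (A x) x := by
  have h1 := hA.sq_le x
  have h2 := hA.pos
  by_contra h
  push Not at h
  nlinarith [sq_nonneg ‖A x‖, mul_neg_of_pos_of_neg h2 h]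

theorem IsPosBounded.norm_le (hA : IsPosBounded A K) (x : E) : ‖A x‖ ≤ K * ‖x‖ := by
  have h1 := hA.sq_le x
  have h2 := real_inner_le_norm (A x) x
  have h3 := hA.pos
  by_cases h : ‖A x‖ = 0
  · rw [h]; positivity
  · have h4 : 0 < ‖A x‖ := lt_of_le_of_ne (norm_nonneg _) (Ne.symm h)
    have : ‖A x‖ * ‖A x‖ ≤ ‖A x‖ * (K * ‖x‖) := by nlinarith
    exact le_of_mul_le_mul_left this h4

theorem IsPosBounded.inner_le (hA : IsPosBounded A K) (x : E) :
    inner ℝ (A x) x ≤ K * ‖x‖ ^ 2 := by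
  nlinarith [real_inner_le_norm (A x) x, hA.norm_le x, norm_nonneg x]

/-- The `N_i` stand for consecutive moments `⟨A^i x, x⟩` and `a` for `1 - e lam`. Absorbing `e² N2`
into `a e N1` leaves the gap `(1 - a)((1 + a) N0 - e N1) ≥ 0`. Working with moments avoids a
spectral calculus for `A`. -/
theorem sq_contract_aux {a e K N0 N1 N2 : ℝ} (ha1 : a ≤ 1) (he : 0 ≤ e)
    (heK : e * K ≤ a) (h1 : 0 ≤ N1) (h10 : N1 ≤ K * N0) (h21 : N2 ≤ K * N1) (h0 : 0 ≤ N0)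
    (hK : 0 ≤ K) :
    a ^ 2 * N0 - 2 * a * e * N1 + e ^ 2 * N2 ≤ N0 - e * N1 := by
  have ha : 0 ≤ a := le_trans (by positivity) heK
  have e1 : e ^ 2 * N2 ≤ a * e * N1 := by
    calc e ^ 2 * N2 ≤ e ^ 2 * (K * N1) := by gcongr
      _ = (e * K) * (e * N1) := by ring
      _ ≤ a * (e * N1) := by gcongr
      _ = a * e * N1 := by ring
  have e2 : e * N1 ≤ N0 := by
    calc e * N1 ≤ e * (K * N0) := by gcongr
      _ = (e * K) * N0 := by ring
      _ ≤ 1 * N0 := by gcongr; linarith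
      _ = N0 := one_mul _
  nlinarith [mul_nonneg (sub_nonneg.2 ha1) (sub_nonneg.2 e2), mul_nonneg ha h0,
    mul_nonneg (sub_nonneg.2 ha1) (mul_nonneg ha h0)]

theorem norm_ridgeStep_sq_le (hA : IsPosBounded A K) {e : ℝ} (he : 0 ≤ e) (hlam : 0 ≤ lam)
    (heK : e * (lam + K) ≤ 1) (x : E) :
    ‖ridgeStep A lam e x‖ ^ 2 ≤ ‖x‖ ^ 2 - e * inner ℝ (A x) x := by
  have h : ‖ridgeStep A lam e x‖ ^ 2 = (1 - e * lam) ^ 2 * ‖x‖ ^ 2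
      - 2 * (1 - e * lam) * e * inner ℝ (A x) x + e ^ 2 * ‖A x‖ ^ 2 := by
    rw [ridgeStep_apply, norm_sub_sq_real, norm_smul, norm_smul, inner_smul_left, inner_smul_right,
      real_inner_comm x (A x), mul_pow, mul_pow, Real.norm_eq_abs, Real.norm_eq_abs, sq_abs, sq_abs]
    simp only [conj_trivial]
    ring
  rw [h]
  exact sq_contract_aux (by nlinarith) he (by nlinarith) (hA.inner_nonneg x)
    (hA.inner_le x) (hA.sq_le x) (by positivity) hA.pos.le

theorem ridgeStep_comm (A : E →L[ℝ] E) (lam e : ℝ) (x : E) :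
    A (ridgeStep A lam e x) = ridgeStep A lam e (A x) := by
  simp [ridgeStep_apply]

/-- `sq_contract_aux` again, with the moments shifted by one power of `A`. -/
theorem inner_ridgeStep_le (hA : IsPosBounded A K) {e : ℝ} (he : 0 ≤ e) (hlam : 0 ≤ lam)
    (heK : e * (lam + K) ≤ 1) (x : E) :
    inner ℝ (A (ridgeStep A lam e x)) (ridgeStep A lam e x)
      ≤ inner ℝ (A x) x - e * ‖A x‖ ^ 2 := by
  have h : inner ℝ (A (ridgeStep A lam e x)) (ridgeStep A lam e x)
      = (1 - e * lam) ^ 2 * inner ℝ (A x) x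
      - 2 * (1 - e * lam) * e * ‖A x‖ ^ 2 + e ^ 2 * inner ℝ (A (A x)) (A x) := by
    rw [ridgeStep_comm, ridgeStep_apply, ridgeStep_apply]
    simp only [inner_sub_left, inner_sub_right, inner_smul_left, inner_smul_right, conj_trivial,
      hA.symm (A x) x, real_inner_self_eq_norm_sq]
    ring
  rw [h]
  exact sq_contract_aux (by nlinarith) he (by nlinarith) (by positivity)
    (hA.sq_le x) (hA.inner_le (A x)) (hA.inner_nonneg x) hA.pos.le

theorem norm_ridgeStep_le (hA : IsPosBounded A K) {e : ℝ} (he : 0 ≤ e)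
    (heK : e * (lam + K) ≤ 1) (x : E) :
    ‖ridgeStep A lam e x‖ ≤ (1 - e * lam) * ‖x‖ := by
  have ha : e * K ≤ 1 - e * lam := by nlinarith
  have ha0 : 0 ≤ 1 - e * lam := le_trans (mul_nonneg he hA.pos.le) ha
  have h : ‖ridgeStep A lam e x‖ ^ 2 = (1 - e * lam) ^ 2 * ‖x‖ ^ 2
      - 2 * (1 - e * lam) * e * inner ℝ (A x) x + e ^ 2 * ‖A x‖ ^ 2 := by
    rw [ridgeStep_apply, norm_sub_sq_real, norm_smul, norm_smul, inner_smul_left, inner_smul_right,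
      real_inner_comm x (A x), mul_pow, mul_pow, Real.norm_eq_abs, Real.norm_eq_abs, sq_abs, sq_abs]
    simp only [conj_trivial]
    ring
  refine le_of_sq_le_sq ?_ (by positivity)
  rw [h, mul_pow]
  have e1 : e ^ 2 * ‖A x‖ ^ 2 ≤ (1 - e * lam) * e * inner ℝ (A x) x := by
    calc e ^ 2 * ‖A x‖ ^ 2 ≤ e ^ 2 * (K * inner ℝ (A x) x) := by gcongr; exact hA.sq_le x
      _ = (e * K) * (e * inner ℝ (A x) x) := by ring
      _ ≤ (1 - e * lam) * (e * inner ℝ (A x) x) := by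
          gcongr; exact mul_nonneg he (hA.inner_nonneg x)
      _ = _ := by ring
  nlinarith [mul_nonneg ha0 (mul_nonneg he (hA.inner_nonneg x))]

theorem ridgeProd_comm (A : E →L[ℝ] E) (lam : ℝ) (s : ℕ → ℝ) (t k : ℕ) (x : E) :
    A (ridgeProd A lam s t k x) = ridgeProd A lam s t k (A x) := by
  induction k with
  | zero => simp [ridgeProd]
  | succ k ih => simp [ridgeProd, ridgeStep_comm, ih]

/-- The energy estimate behind the smoothing property of gradient descent. -/
theorem ridgeProd_energy (hA : IsPosBounded A K) (hlam : 0 ≤ lam) (hs : ∀ i, 0 ≤ s i)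
    (hsK : ∀ i, s i * (lam + K) ≤ 1) (t k : ℕ) (x : E) :
    ‖ridgeProd A lam s t k x‖ ^ 2
      + (∑ i ∈ Finset.range k, s (t + i)) *
          inner ℝ (A (ridgeProd A lam s t k x)) (ridgeProd A lam s t k x)
      + (∑ i ∈ Finset.range k, s (t + i)) ^ 2 / 2 * ‖A (ridgeProd A lam s t k x)‖ ^ 2
      ≤ ‖x‖ ^ 2 := by
  induction k with
  | zero => simp [ridgeProd]
  | succ k ih =>
    refine le_trans ?_ ih
    simp only [ridgeProd, ContinuousLinearMap.comp_apply, Finset.sum_range_succ]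
    set y := ridgeProd A lam s t k x
    set S := ∑ i ∈ Finset.range k, s (t + i)
    set e := s (t + k)
    have hS : 0 ≤ S := Finset.sum_nonneg fun i _ => hs _
    have he : 0 ≤ e := hs _
    have h1 := norm_ridgeStep_sq_le hA he hlam (hsK _) y
    have h2 := inner_ridgeStep_le hA he hlam (hsK _) y
    have h3 := norm_ridgeStep_sq_le hA he hlam (hsK _) (A y)
    rw [← ridgeStep_comm] at h3
    have h3' : ‖A (ridgeStep A lam e y)‖ ^ 2 ≤ ‖A y‖ ^ 2 := by
      have := mul_nonneg he (hA.inner_nonneg (A y)); linarith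
    have h4 : (S + e) * inner ℝ (A (ridgeStep A lam e y)) (ridgeStep A lam e y)
        ≤ (S + e) * (inner ℝ (A y) y - e * ‖A y‖ ^ 2) := by gcongr
    have h5 : (S + e) ^ 2 / 2 * ‖A (ridgeStep A lam e y)‖ ^ 2 ≤ (S + e) ^ 2 / 2 * ‖A y‖ ^ 2 := by
      gcongr
    -- The coefficient of `‖A y‖²` becomes `(S + e)²/2 - (S + e) e = (S² - e²)/2`, at most the old
    -- `S²/2`; the loss `e ⟨A y, y⟩` of the first term pays for the growth of `S` in the second.
    nlinarith [mul_nonneg (sq_nonneg e) (sq_nonneg ‖A y‖)]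

/-- The smoothing property, in place of the spectral bound `u e^{-S u} ≲ 1/S`: only the last term of
the energy is kept. -/
theorem norm_comp_ridgeProd_sq_le (hA : IsPosBounded A K) (hlam : 0 ≤ lam) (hs : ∀ i, 0 ≤ s i)
    (hsK : ∀ i, s i * (lam + K) ≤ 1) (t k : ℕ) (x : E) :
    (∑ i ∈ Finset.range k, s (t + i)) ^ 2 * ‖A (ridgeProd A lam s t k x)‖ ^ 2 ≤ 2 * ‖x‖ ^ 2 := by
  have h := ridgeProd_energy hA hlam hs hsK t k x
  have h1 : 0 ≤ ∑ i ∈ Finset.range k, s (t + i) := Finset.sum_nonneg fun i _ => hs _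
  have h2 := mul_nonneg h1 (hA.inner_nonneg (ridgeProd A lam s t k x))
  nlinarith [sq_nonneg ‖ridgeProd A lam s t k x‖]

theorem norm_ridgeProd_le_exp (hA : IsPosBounded A K) (hs : ∀ i, 0 ≤ s i)
    (hsK : ∀ i, s i * (lam + K) ≤ 1) (t k : ℕ) (x : E) :
    ‖ridgeProd A lam s t k x‖ ≤ Real.exp (-(lam * ∑ i ∈ Finset.range k, s (t + i))) * ‖x‖ := by
  induction k with
  | zero => simp [ridgeProd]
  | succ k ih =>
    simp only [ridgeProd, ContinuousLinearMap.comp_apply, Finset.sum_range_succ]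
    have ha0 : 0 ≤ 1 - s (t + k) * lam := by
      nlinarith [hsK (t + k), mul_nonneg (hs (t + k)) hA.pos.le]
    calc _ ≤ (1 - s (t + k) * lam) * ‖ridgeProd A lam s t k x‖ :=
          norm_ridgeStep_le hA (hs _) (hsK _) _
      _ ≤ Real.exp (-(s (t + k) * lam)) *
          (Real.exp (-(lam * ∑ i ∈ Finset.range k, s (t + i))) * ‖x‖) := by
          gcongr
          have := Real.add_one_le_exp (-(s (t + k) * lam)); linarith
      _ = _ := by rw [← mul_assoc, ← Real.exp_add]; ring_nf

theorem norm_ridgeProd_le (hA : IsPosBounded A K) (hlam : 0 ≤ lam) (hs : ∀ i, 0 ≤ s i)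
    (hsK : ∀ i, s i * (lam + K) ≤ 1) (t k : ℕ) (x : E) : ‖ridgeProd A lam s t k x‖ ≤ ‖x‖ := by
  refine (norm_ridgeProd_le_exp hA hs hsK t k x).trans ?_
  have h1 : 0 ≤ ∑ i ∈ Finset.range k, s (t + i) := Finset.sum_nonneg fun i _ => hs _
  have : Real.exp (-(lam * ∑ i ∈ Finset.range k, s (t + i))) ≤ 1 := by
    rw [Real.exp_le_one_iff]; nlinarith [mul_nonneg hlam h1]
  nlinarith [norm_nonneg x]

theorem ridgePath_add (A : E →L[ℝ] E) (lam : ℝ) (s : ℕ → ℝ) (g g' : E) (T : ℕ) :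
    ridgePath A lam s (g + g') T = ridgePath A lam s g T + ridgePath A lam s g' T := by
  induction T with
  | zero => simp [ridgePath]
  | succ T ih => simp only [ridgePath, ih, map_add, smul_add]; abel

/-- The error is contracted by `1 - s lam` and shifted by `-s lam g`, so the ball of radius `‖g‖` is
invariant. -/
theorem norm_ridgePath_sub_le (hA : IsPosBounded A K) (hlam : 0 ≤ lam) (hs : ∀ i, 0 ≤ s i)
    (hsK : ∀ i, s i * (lam + K) ≤ 1) (g : E) (T : ℕ) : ‖ridgePath A lam s g T - g‖ ≤ ‖g‖ := by
  induction T with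
  | zero => simp [ridgePath]
  | succ T ih =>
    have h : ridgePath A lam s g (T + 1) - g
        = ridgeStep A lam (s T) (ridgePath A lam s g T - g) - (s T * lam) • g := by
      simp only [ridgePath, ridgeStep_apply, map_sub]
      module
    have ha0 : 0 ≤ 1 - s T * lam := by
      nlinarith [hsK T, mul_nonneg (hs T) hA.pos.le]
    calc _ ≤ ‖ridgeStep A lam (s T) (ridgePath A lam s g T - g)‖ + ‖(s T * lam) • g‖ := by
          rw [h]; exact norm_sub_le _ _
      _ ≤ (1 - s T * lam) * ‖ridgePath A lam s g T - g‖ + s T * lam * ‖g‖ := by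
          gcongr
          · exact norm_ridgeStep_le hA (hs _) (hsK _) _
          · rw [norm_smul, Real.norm_of_nonneg (mul_nonneg (hs _) hlam)]
      _ ≤ (1 - s T * lam) * ‖g‖ + s T * lam * ‖g‖ := by gcongr
      _ = ‖g‖ := by ring

/-- For a target in the range of `A` the error has a part that smoothing makes small and a ridge
part carrying an explicit factor `lam`. -/
theorem ridgePath_range (A : E →L[ℝ] E) (lam : ℝ) (s : ℕ → ℝ) (u : E) (T : ℕ) :
    ridgePath A lam s (A u) T - A u
      = -(A (ridgeProd A lam s 0 T u)) - lam • ridgePath A lam s u T := by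
  induction T with
  | zero => simp [ridgePath, ridgeProd]
  | succ T ih =>
    have h : ridgePath A lam s (A u) (T + 1) - A u
        = ridgeStep A lam (s T) (ridgePath A lam s (A u) T - A u) - (s T * lam) • A u := by
      simp only [ridgePath, ridgeStep_apply, map_sub]
      module
    rw [h, ih]
    simp only [ridgePath, ridgeProd, ridgeStep_apply, map_sub, ContinuousLinearMap.comp_apply,
      map_neg, map_smul, zero_add]
    module

/-- The bias of gradient descent for a target that is close to the range of `A`. -/
theorem norm_ridgePath_sub_le_of_range (hA : IsPosBounded A K) (hlam : 0 ≤ lam)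
    (hs : ∀ i, 0 ≤ s i) (hsK : ∀ i, s i * (lam + K) ≤ 1) (g u : E) (T : ℕ)
    (hT : 0 < ∑ i ∈ Finset.range T, s i) :
    ‖ridgePath A lam s g T - g‖
      ≤ ‖g - A u‖ + (2 / (∑ i ∈ Finset.range T, s i) + 2 * lam) * ‖u‖ := by
  set S := ∑ i ∈ Finset.range T, s i
  -- The path is linear in its target, so the crude bound is needed only for the remainder `g - A
  -- u`.
  have h1 : ridgePath A lam s g T - g
      = (ridgePath A lam s (g - A u) T - (g - A u)) + (ridgePath A lam s (A u) T - A u) := by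
    have := ridgePath_add A lam s (g - A u) (A u) T
    rw [sub_add_cancel] at this
    rw [this]; abel
  have h2 := norm_ridgePath_sub_le hA hlam hs hsK (g - A u) T
  have h3 : ‖ridgePath A lam s u T‖ ≤ 2 * ‖u‖ := by
    have := norm_ridgePath_sub_le hA hlam hs hsK u T
    have h4 := norm_add_le (ridgePath A lam s u T - u) u
    rw [sub_add_cancel] at h4
    linarith
  have h4 : ‖A (ridgeProd A lam s 0 T u)‖ ≤ 2 / S * ‖u‖ := by
    have := norm_comp_ridgeProd_sq_le hA hlam hs hsK 0 T u
    simp only [zero_add] at this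
    rw [div_mul_eq_mul_div, le_div_iff₀ hT]
    refine le_of_sq_le_sq ?_ (by positivity)
    nlinarith [sq_nonneg ‖u‖]
  have h5 : ‖lam • ridgePath A lam s u T‖ ≤ 2 * lam * ‖u‖ := by
    rw [norm_smul, Real.norm_of_nonneg hlam]
    nlinarith
  rw [h1, ridgePath_range]
  refine (norm_add_le _ _).trans ?_
  have := norm_sub_le (-(A (ridgeProd A lam s 0 T u))) (lam • ridgePath A lam s u T)
  rw [norm_neg] at this
  nlinarith

end GradientSteps

/-! ### Sums of powers -/

/-- The right side is the integral of `u^{-q}` over `[x, x + a]`, and the integrand is smallest at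
the right end. The proof reduces this to `log p ≤ p - 1` and `1 + y ≤ e^y`. -/
theorem mul_rpow_neg_le_telescope {x a q : ℝ} (hx : 0 < x) (ha : 0 ≤ a) (hq : 1 < q) :
    a * (x + a) ^ (-q) ≤ (x ^ (1 - q) - (x + a) ^ (1 - q)) / (q - 1) := by
  have hxa : 0 < x + a := by linarith
  have hq1 : 0 < q - 1 := by linarith
  rw [le_div_iff₀ hq1]
  have e1 : x ^ (1 - q) = (x + a) ^ (1 - q) * (x / (x + a)) ^ (1 - q) := by
    rw [← Real.mul_rpow hxa.le (by positivity), mul_div_cancel₀ _ hxa.ne']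
  have e2 : (x + a) ^ (-q) = (x + a) ^ (1 - q) * (1 / (x + a)) := by
    rw [show -q = (1 - q) - 1 by ring, Real.rpow_sub_one hxa.ne']; ring
  have e3 : 1 + (q - 1) * (a / (x + a)) ≤ (x / (x + a)) ^ (1 - q) := by
    have hp : 0 < x / (x + a) := by positivity
    rw [Real.rpow_def_of_pos hp]
    have h1 := Real.log_le_sub_one_of_pos hp
    have h2 : x / (x + a) - 1 = -(a / (x + a)) := by field_simp; ring
    have h3 := Real.add_one_le_exp (Real.log (x / (x + a)) * (1 - q))
    nlinarith
  have h0 : 0 ≤ (x + a) ^ (1 - q) := by positivity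
  rw [e1, e2]
  have := mul_le_mul_of_nonneg_left e3 h0
  calc a * ((x + a) ^ (1 - q) * (1 / (x + a))) * (q - 1)
      = (x + a) ^ (1 - q) * (1 + (q - 1) * (a / (x + a))) - (x + a) ^ (1 - q) := by ring
    _ ≤ _ := by linarith

theorem sum_Ico_rpow_neg_le {q : ℝ} (hq : 1 < q) {n : ℕ} (hn : 0 < n) (N : ℕ) :
    ∑ i ∈ Finset.Ico n N, ((i : ℝ) + 1) ^ (-q) ≤ (n : ℝ) ^ (1 - q) / (q - 1) := by
  have hq1 : 0 < q - 1 := by linarith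
  rcases le_total N n with h | h
  · rw [Finset.Ico_eq_empty_of_le h, Finset.sum_empty]; positivity
  have key : ∑ i ∈ Finset.Ico n N, ((i : ℝ) + 1) ^ (-q)
      ≤ ((n : ℝ) ^ (1 - q) - (N : ℝ) ^ (1 - q)) / (q - 1) := by
    induction N, h using Nat.le_induction with
    | base => simp
    | succ N h ih =>
      rw [Finset.sum_Ico_succ_top h]
      have hN : (0 : ℝ) < N := by exact_mod_cast lt_of_lt_of_le hn h
      have := mul_rpow_neg_le_telescope hN zero_le_one hq
      rw [one_mul] at this
      push_cast
      calc _ ≤ ((n : ℝ) ^ (1 - q) - (N : ℝ) ^ (1 - q)) / (q - 1)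
            + ((N : ℝ) ^ (1 - q) - ((N : ℝ) + 1) ^ (1 - q)) / (q - 1) := add_le_add ih this
        _ = _ := by ring
  refine key.trans ?_
  gcongr
  have : (0 : ℝ) ≤ (N : ℝ) ^ (1 - q) := by positivity
  linarith

theorem sum_range_one_add_mul_rpow_neg_le {p a : ℝ} (hp : 1 < p) (ha : 0 < a) (N : ℕ) :
    ∑ j ∈ Finset.range N, (1 + a * j) ^ (-p) ≤ 1 + 1 / (a * (p - 1)) := by
  have hp1 : 0 < p - 1 := by linarith
  cases N with
  | zero => simp; positivity
  | succ N =>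
    have key : ∑ j ∈ Finset.range (N + 1), (1 + a * (j : ℝ)) ^ (-p)
        ≤ 1 + (1 - (1 + a * N) ^ (1 - p)) / (a * (p - 1)) := by
      induction N with
      | zero => simp
      | succ N ih =>
        rw [Finset.sum_range_succ]
        have := mul_rpow_neg_le_telescope (x := 1 + a * N) (by positivity) ha.le hp
        rw [show 1 + a * (N : ℝ) + a = 1 + a * ((N + 1 : ℕ) : ℝ) by push_cast; ring] at this
        have h2 : (1 + a * ((N + 1 : ℕ) : ℝ)) ^ (-p)
            ≤ ((1 + a * N) ^ (1 - p) - (1 + a * ((N + 1 : ℕ) : ℝ)) ^ (1 - p)) / (a * (p - 1)) := by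
          rw [le_div_iff₀ (by positivity)]
          rw [le_div_iff₀ hp1] at this
          linarith
        calc _ ≤ _ := add_le_add ih h2
          _ = _ := by ring
    refine key.trans ?_
    gcongr
    have : (0 : ℝ) ≤ (1 + a * (N : ℝ)) ^ (1 - p) := by positivity
    linarith

theorem sum_range_rpow_neg_le {θ : ℝ} (hθ : 0 < θ) (hθ1 : θ < 1) (T : ℕ) :
    ∑ i ∈ Finset.range T, ((i : ℝ) + 1) ^ (-θ) ≤ (T : ℝ) ^ (1 - θ) / (1 - θ) := by
  have h1 : 0 < 1 - θ := by linarith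
  induction T with
  | zero => simp [Real.zero_rpow h1.ne']
  | succ T ih =>
    rw [Finset.sum_range_succ]
    have hT : (0 : ℝ) < (T : ℝ) + 1 := by positivity
    suffices h : ((T : ℝ) + 1) ^ (-θ) * (1 - θ) ≤ ((T : ℝ) + 1) ^ (1 - θ) - (T : ℝ) ^ (1 - θ) by
      rw [← le_div_iff₀ h1] at h
      push_cast
      calc _ ≤ _ := add_le_add ih h
        _ = _ := by ring
    have e1 : (T : ℝ) ^ (1 - θ) = ((T : ℝ) + 1) ^ (1 - θ) * (1 + -(1 / ((T : ℝ) + 1))) ^ (1 - θ) := by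
      have h3 : (0 : ℝ) ≤ 1 + -(1 / ((T : ℝ) + 1)) := by
        rw [show 1 + -(1 / ((T : ℝ) + 1)) = T / (T + 1) by field_simp; ring]; positivity
      rw [← Real.mul_rpow hT.le h3]
      congr 1; field_simp; ring
    have e2 : ((T : ℝ) + 1) ^ (-θ) = ((T : ℝ) + 1) ^ (1 - θ) * (1 / ((T : ℝ) + 1)) := by
      rw [show -θ = (1 - θ) - 1 by ring, Real.rpow_sub_one hT.ne']; ring
    have e3 := rpow_one_add_le_one_add_mul_self (s := -(1 / ((T : ℝ) + 1))) (p := 1 - θ)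
      (by rw [neg_le_neg_iff, div_le_one hT]; linarith [(Nat.cast_nonneg T : (0:ℝ) ≤ T)])
      h1.le (by linarith)
    have h0 : 0 ≤ ((T : ℝ) + 1) ^ (1 - θ) := by positivity
    rw [e1, e2]
    nlinarith [mul_le_mul_of_nonneg_left e3 h0]

/-- The step size `η t^{-θ}` with `t` counted from `0`. -/
noncomputable def stepSize (η θ : ℝ) (i : ℕ) : ℝ := η * ((i : ℝ) + 1) ^ (-θ)

theorem stepSize_pos {η : ℝ} (hη : 0 < η) (θ : ℝ) (i : ℕ) : 0 < stepSize η θ i := by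
  unfold stepSize; positivity

theorem stepSize_le {η θ : ℝ} (hη : 0 < η) (hθ : 0 < θ) (i : ℕ) : stepSize η θ i ≤ η := by
  unfold stepSize
  have : ((i : ℝ) + 1) ^ (-θ) ≤ 1 :=
    Real.rpow_le_one_of_one_le_of_nonpos (by linarith [(Nat.cast_nonneg i : (0:ℝ) ≤ i)])
      (by linarith)
  nlinarith

theorem le_stepSize {η θ : ℝ} (hη : 0 < η) (hθ : 0 < θ) {i T : ℕ} (hi : i < T) :
    η * (T : ℝ) ^ (-θ) ≤ stepSize η θ i := by
  unfold stepSize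
  have h : (i : ℝ) + 1 ≤ T := by exact_mod_cast hi
  have : (T : ℝ) ^ (-θ) ≤ ((i : ℝ) + 1) ^ (-θ) :=
    Real.rpow_le_rpow_of_nonpos (by positivity) h (by linarith)
  gcongr

theorem mul_le_sum_stepSize {η θ : ℝ} (hη : 0 < η) (hθ : 0 < θ) {t k T : ℕ} (h : t + k ≤ T) :
    η * (T : ℝ) ^ (-θ) * k ≤ ∑ i ∈ Finset.range k, stepSize η θ (t + i) := by
  calc η * (T : ℝ) ^ (-θ) * k = ∑ i ∈ Finset.range k, η * (T : ℝ) ^ (-θ) := by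
        rw [Finset.sum_const, Finset.card_range, nsmul_eq_mul]; ring
    _ ≤ _ := Finset.sum_le_sum fun i hi => le_stepSize hη hθ (by
        have := Finset.mem_range.1 hi; omega)

theorem sum_stepSize_le {η θ : ℝ} (hη : 0 < η) (hθ : 0 < θ) (hθ1 : θ < 1) (T : ℕ) :
    ∑ i ∈ Finset.range T, stepSize η θ i ≤ η * ((T : ℝ) ^ (1 - θ) / (1 - θ)) := by
  simp only [stepSize, ← Finset.mul_sum]
  gcongr
  exact sum_range_rpow_neg_le hθ hθ1 T

theorem exists_sum_stepSize_sq_le {θ : ℝ} (η : ℝ) (hθ : 1 / 2 < θ) :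
    ∃ C : ℝ, 0 < C ∧ ∀ T : ℕ, ∑ i ∈ Finset.range T, stepSize η θ i ^ 2 ≤ C := by
  have hsum : Summable fun i : ℕ => stepSize η θ i ^ 2 := by
    have h1 : Summable fun n : ℕ => (n : ℝ) ^ (-(2 * θ)) := by
      rw [Real.summable_nat_rpow]; linarith
    have h2 := ((summable_nat_add_iff 1).2 h1).mul_left (η ^ 2)
    refine h2.congr fun i => ?_
    unfold stepSize
    rw [mul_pow, ← Real.rpow_natCast (((i : ℝ) + 1) ^ (-θ)), ← Real.rpow_mul (by positivity)]
    push_cast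
    congr 2; ring
  refine ⟨∑' i, stepSize η θ i ^ 2 + 1, by positivity, fun T => ?_⟩
  have := hsum.sum_le_tsum (Finset.range T) fun i _ => sq_nonneg _
  linarith

/-- Summing the variances of the single steps, where the first half of the steps obeys the
bound `D`. -/
theorem exists_sum_stepSize_sq_mul_le {η θ p : ℝ} (hη : 0 < η) (hθ : 1 / 2 < θ) (hθ1 : θ < 1)
    (hp : 1 < p) :
    ∃ C : ℝ, 0 < C ∧ ∀ (T : ℕ) (v : ℕ → ℝ) (ε D : ℝ), 0 < T → 0 ≤ ε → 0 ≤ D →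
      (∀ t < T, v t ≤ ε + (1 + η * (T : ℝ) ^ (-θ) * ((T - 1 - t : ℕ) : ℝ)) ^ (-p)) →
      (∀ t < T, 2 * (t + 1) ≤ T → v t ≤ ε + D) →
      ∑ t ∈ Finset.range T, stepSize η θ t ^ 2 * v t ≤ C * (ε + (T : ℝ) ^ (-θ) + D) := by
  obtain ⟨C2, hC2, hsum⟩ := exists_sum_stepSize_sq_le η hθ
  have hp1 : 0 < p - 1 := by linarith
  refine ⟨C2 + 4 * η ^ 2 * (1 + 1 / (η * (p - 1))), by positivity, ?_⟩
  intro T v ε D hT hε hD hv hv'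
  set a := η * (T : ℝ) ^ (-θ) with ha
  have hT1 : (1 : ℝ) ≤ T := by exact_mod_cast hT
  have hT0 : (0 : ℝ) < T := by linarith
  have ha0 : 0 < a := by positivity
  have hTθ : (T : ℝ) ^ (-θ) ≤ 1 := Real.rpow_le_one_of_one_le_of_nonpos hT1 (by linarith)
  have hterm : ∀ t ∈ Finset.range T, stepSize η θ t ^ 2 * v t ≤ stepSize η θ t ^ 2 * (ε + D)
      + 4 * a ^ 2 * (1 + a * ((T - 1 - t : ℕ) : ℝ)) ^ (-p) := by
    intro t ht
    have ht := Finset.mem_range.1 ht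
    have hq : 0 ≤ (1 + a * ((T - 1 - t : ℕ) : ℝ)) ^ (-p) := by positivity
    -- Early steps may be large but have the bound `D`, and their squares are summable. Late steps
    -- are at most `2 a`, comparable to the last one.
    by_cases h : 2 * (t + 1) ≤ T
    · have := mul_le_mul_of_nonneg_left (hv' t ht h) (sq_nonneg (stepSize η θ t))
      have : 0 ≤ 4 * a ^ 2 * (1 + a * ((T - 1 - t : ℕ) : ℝ)) ^ (-p) := by positivity
      linarith
    · have hs : stepSize η θ t ≤ 2 * a := by
        have h' : (T : ℝ) / 2 ≤ (t : ℝ) + 1 := by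
          have : (T : ℝ) ≤ 2 * ((t : ℝ) + 1) := by exact_mod_cast (not_le.1 h).le
          linarith
        have h1 : ((t : ℝ) + 1) ^ (-θ) ≤ ((T : ℝ) / 2) ^ (-θ) :=
          Real.rpow_le_rpow_of_nonpos (by positivity) h' (by linarith)
        have h2 : ((T : ℝ) / 2) ^ (-θ) = (T : ℝ) ^ (-θ) * 2 ^ θ := by
          rw [Real.div_rpow hT0.le (by norm_num), Real.rpow_neg (by norm_num : (0:ℝ) ≤ 2)]
          field_simp
        have h3 : (2 : ℝ) ^ θ ≤ 2 := by
          calc (2 : ℝ) ^ θ ≤ 2 ^ (1 : ℝ) := Real.rpow_le_rpow_of_exponent_le (by norm_num) hθ1.le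
            _ = 2 := Real.rpow_one _
        unfold stepSize
        calc η * ((t : ℝ) + 1) ^ (-θ) ≤ η * ((T : ℝ) ^ (-θ) * 2) := by
              gcongr; rw [h2] at h1; exact h1.trans (by gcongr)
          _ = 2 * a := by rw [ha]; ring
      have hs2 : stepSize η θ t ^ 2 ≤ 4 * a ^ 2 := by
        nlinarith [stepSize_pos hη θ t]
      have h1 := mul_le_mul_of_nonneg_left (hv t ht) (sq_nonneg (stepSize η θ t))
      have h2 := mul_le_mul_of_nonneg_right hs2 hq
      have h3 : 0 ≤ stepSize η θ t ^ 2 * D := by positivity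
      linarith
  have hrefl : ∑ t ∈ Finset.range T, (1 + a * ((T - 1 - t : ℕ) : ℝ)) ^ (-p)
      = ∑ j ∈ Finset.range T, (1 + a * (j : ℝ)) ^ (-p) :=
    Finset.sum_range_reflect (fun j : ℕ => (1 + a * (j : ℝ)) ^ (-p)) T
  calc ∑ t ∈ Finset.range T, stepSize η θ t ^ 2 * v t
      ≤ (∑ t ∈ Finset.range T, stepSize η θ t ^ 2) * (ε + D)
        + 4 * a ^ 2 * ∑ j ∈ Finset.range T, (1 + a * (j : ℝ)) ^ (-p) := by
        rw [Finset.sum_mul, ← hrefl, Finset.mul_sum, ← Finset.sum_add_distrib]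
        exact Finset.sum_le_sum hterm
    _ ≤ C2 * (ε + D) + 4 * a ^ 2 * (1 + 1 / (a * (p - 1))) := by
        gcongr
        · exact hsum T
        · exact sum_range_one_add_mul_rpow_neg_le hp ha0 T
    _ ≤ C2 * (ε + (T : ℝ) ^ (-θ) + D)
        + 4 * η ^ 2 * (1 + 1 / (η * (p - 1))) * (T : ℝ) ^ (-θ) := by
        -- The sum of `(1 + a j)^{-p}` is of order `1/a`, so one factor `a = η T^{-θ}` survives from
        -- `a²`.
        have h1 : 4 * a ^ 2 * (1 + 1 / (a * (p - 1)))
            = 4 * η ^ 2 * (T : ℝ) ^ (-θ) * ((T : ℝ) ^ (-θ) + 1 / (η * (p - 1))) := by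
          rw [ha]; field_simp
        rw [h1]
        have h2 : 4 * η ^ 2 * (T : ℝ) ^ (-θ) * ((T : ℝ) ^ (-θ) + 1 / (η * (p - 1)))
            ≤ 4 * η ^ 2 * (T : ℝ) ^ (-θ) * (1 + 1 / (η * (p - 1))) := by gcongr
        have h3 : 0 ≤ C2 * (T : ℝ) ^ (-θ) := by positivity
        linarith
    _ ≤ _ := by
        have h3 : 0 ≤ 4 * η ^ 2 * (1 + 1 / (η * (p - 1))) * (ε + D) := by positivity
        linarith

/-- `H(θ) ≤ η`. -/
theorem Hfun_le {η θ : ℝ} (hη : 0 < η) (hθ : 0 < θ) (hθ1 : θ < 1) : Hfun η θ ≤ η := by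
  have h1 : 0 < 1 - θ := by linarith
  unfold Hfun
  -- With `2 = (3/2)(4/3)` the difference becomes `(3/2)^{1-θ} ((4/3)^{1-θ} - 1)`, and Bernoulli
  -- bounds the bracket by `(1 - θ)/3`.
  have e1 : (2 : ℝ) ^ (1 - θ) = (3 / 2 : ℝ) ^ (1 - θ) * (1 + 1 / 3) ^ (1 - θ) := by
    rw [← Real.mul_rpow (by norm_num) (by norm_num)]; norm_num
  have e2 : (2 : ℝ) ^ (1 - θ) * (3 / 4 : ℝ) ^ (1 - θ) = (3 / 2 : ℝ) ^ (1 - θ) := by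
    rw [← Real.mul_rpow (by norm_num) (by norm_num)]; norm_num
  have e3 := rpow_one_add_le_one_add_mul_self (s := 1 / 3) (p := 1 - θ) (by norm_num)
    h1.le (by linarith)
  have e4 : (3 / 2 : ℝ) ^ (1 - θ) ≤ 3 / 2 := by
    calc (3 / 2 : ℝ) ^ (1 - θ) ≤ (3 / 2) ^ (1 : ℝ) :=
          Real.rpow_le_rpow_of_exponent_le (by norm_num) (by linarith)
      _ = 3 / 2 := Real.rpow_one _
  have e5 : 0 < (3 / 2 : ℝ) ^ (1 - θ) := by positivity
  have key : (2 : ℝ) ^ (1 - θ) * (1 - (3 / 4 : ℝ) ^ (1 - θ)) ≤ (1 - θ) / 2 := by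
    rw [mul_sub, mul_one, e2, e1]
    nlinarith [mul_le_mul_of_nonneg_left e3 e5.le]
  calc _ = 2 * η / (1 - θ) * ((2 : ℝ) ^ (1 - θ) * (1 - (3 / 4 : ℝ) ^ (1 - θ))) := by ring
    _ ≤ 2 * η / (1 - θ) * ((1 - θ) / 2) := by gcongr
    _ = η := by field_simp

/-! ### Feature maps and kernel operators on `L²` -/

section L2

set_option linter.unusedSectionVars false

variable {X : Type*} [MeasurableSpace X] {ν : Measure X}

theorem l2_inner_eq (f g : Lp ℝ 2 ν) : inner ℝ f g = ∫ x, f x * g x ∂ν := by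
  rw [L2.inner_def]
  exact integral_congr_ae (Filter.Eventually.of_forall fun x => by simp [mul_comm])

theorem l2_norm_sq_eq (f : Lp ℝ 2 ν) : ‖f‖ ^ 2 = ∫ x, f x ^ 2 ∂ν := by
  rw [← real_inner_self_eq_norm_sq, l2_inner_eq]
  exact integral_congr_ae (Filter.Eventually.of_forall fun x => by simp [sq])

theorem l2_norm_sq_eq_of_ae {f : Lp ℝ 2 ν} {h : X → ℝ} (hf : f =ᵐ[ν] h) :
    ‖f‖ ^ 2 = ∫ x, h x ^ 2 ∂ν := by
  rw [l2_norm_sq_eq]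
  exact integral_congr_ae (hf.mono fun x hx => by simp [hx])

theorem l2_inner_eq_of_ae (f : Lp ℝ 2 ν) {g : Lp ℝ 2 ν} {h : X → ℝ} (hg : g =ᵐ[ν] h) :
    inner ℝ f g = ∫ x, f x * h x ∂ν := by
  rw [l2_inner_eq]
  exact integral_congr_ae (hg.mono fun x hx => by simp [hx])

/-- A jointly measurable kernel bounded by `b`. -/
structure IsBddKernel (k : X → X → ℝ) (b : ℝ) : Prop where
  meas : StronglyMeasurable (Function.uncurry k)
  bound : ∀ x x', |k x x'| ≤ b

variable [IsProbabilityMeasure ν]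

/-- For a function that is not integrable the integral is `0`, so `0 ≤ C` replaces an integrability
condition. -/
theorem integral_le_of_forall_le {f : X → ℝ} {C : ℝ} (hC : 0 ≤ C) (h : ∀ᵐ x ∂ν, f x ≤ C) :
    ∫ x, f x ∂ν ≤ C := by
  by_cases hf : Integrable f ν
  · calc ∫ x, f x ∂ν ≤ ∫ _, C ∂ν := integral_mono_ae hf (integrable_const _) h
      _ = C := by simp
  · rwa [integral_undef hf]

/-! ### Integral operators of bounded kernels and their Hilbert–Schmidt norms -/

section Kernel

variable {k : X → X → ℝ} {b : ℝ}

theorem IsBddKernel.stronglyMeasurable_left (hk : IsBddKernel k b) (x' : X) :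
    StronglyMeasurable fun x => k x x' :=
  hk.meas.comp_measurable (measurable_id.prodMk measurable_const)

theorem IsBddKernel.memLp (hk : IsBddKernel k b) (x' : X) : MemLp (fun x => k x x') 2 ν :=
  MemLp.of_bound (hk.stronglyMeasurable_left x').aestronglyMeasurable b
    (Filter.Eventually.of_forall fun x => hk.bound x x')

/-- The section `k(·, x')` as an element of `L²`. -/
noncomputable def kernelSection (ν : Measure X) [IsProbabilityMeasure ν]
    (hk : IsBddKernel k b) (x' : X) : Lp ℝ 2 ν :=
  (hk.memLp x').toLp

theorem inner_kernelSection (hk : IsBddKernel k b) (f : Lp ℝ 2 ν) (x' : X) :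
    inner ℝ f (kernelSection ν hk x') = ∫ x, f x * k x x' ∂ν :=
  l2_inner_eq_of_ae f (hk.memLp x').coeFn_toLp

theorem norm_kernelSection_sq (hk : IsBddKernel k b) (x' : X) :
    ‖kernelSection ν hk x'‖ ^ 2 = ∫ x, k x x' ^ 2 ∂ν :=
  l2_norm_sq_eq_of_ae (hk.memLp x').coeFn_toLp

theorem IsBddKernel.nonneg [Nonempty X] (hk : IsBddKernel k b) : 0 ≤ b := by
  obtain ⟨x⟩ := ‹Nonempty X›
  exact (abs_nonneg _).trans (hk.bound x x)

theorem norm_kernelSection_le (hk : IsBddKernel k b) (x' : X) :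
    ‖kernelSection ν hk x'‖ ≤ b := by
  have : Nonempty X := ⟨x'⟩
  refine le_of_sq_le_sq ?_ hk.nonneg
  rw [norm_kernelSection_sq]
  refine integral_le_of_forall_le (sq_nonneg b) (Filter.Eventually.of_forall fun x => ?_)
  rw [← sq_abs]
  exact pow_le_pow_left₀ (abs_nonneg _) (hk.bound x x') 2

theorem stronglyMeasurable_integral_mul_kernel (hk : IsBddKernel k b) (f : Lp ℝ 2 ν) :
    StronglyMeasurable fun x' => ∫ x, f x * k x x' ∂ν := by
  have h : StronglyMeasurable (Function.uncurry fun (x' x : X) => f x * k x x') :=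
    ((Lp.stronglyMeasurable f).comp_measurable measurable_snd).mul
      (hk.meas.comp_measurable measurable_swap)
  exact h.integral_prod_right

theorem abs_integral_mul_kernel_le (hk : IsBddKernel k b) (f : Lp ℝ 2 ν) (x' : X) :
    |∫ x, f x * k x x' ∂ν| ≤ b * ‖f‖ := by
  rw [← inner_kernelSection hk]
  calc _ ≤ ‖f‖ * ‖kernelSection ν hk x'‖ := abs_real_inner_le_norm _ _
    _ ≤ ‖f‖ * b := by gcongr; exact norm_kernelSection_le hk x'
    _ = _ := mul_comm _ _

theorem memLp_integral_mul_kernel (hk : IsBddKernel k b) (f : Lp ℝ 2 ν) :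
    MemLp (fun x' => ∫ x, f x * k x x' ∂ν) 2 ν :=
  MemLp.of_bound (stronglyMeasurable_integral_mul_kernel hk f).aestronglyMeasurable (b * ‖f‖)
    (Filter.Eventually.of_forall fun x' => abs_integral_mul_kernel_le hk f x')

/-- The integral operator of a bounded kernel on `L²`. -/
noncomputable def kernelOp (ν : Measure X) [IsProbabilityMeasure ν]
    (hk : IsBddKernel k b) : Lp ℝ 2 ν →L[ℝ] Lp ℝ 2 ν :=
  LinearMap.mkContinuous
    { toFun := fun f => (memLp_integral_mul_kernel hk f).toLp
      map_add' := fun f g => by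
        rw [← MemLp.toLp_add]
        refine MemLp.toLp_congr _ _ (Filter.Eventually.of_forall fun x' => ?_)
        simp only [Pi.add_apply]
        rw [← inner_kernelSection hk, ← inner_kernelSection hk, ← inner_kernelSection hk,
          inner_add_left]
      map_smul' := fun c f => by
        rw [RingHom.id_apply, ← MemLp.toLp_const_smul]
        refine MemLp.toLp_congr _ _ (Filter.Eventually.of_forall fun x' => ?_)
        simp only [Pi.smul_apply]
        rw [← inner_kernelSection hk, ← inner_kernelSection hk, inner_smul_left]
        simp }
    |b| (fun f => by
      refine le_of_sq_le_sq ?_ (by positivity)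
      simp only [LinearMap.coe_mk, AddHom.coe_mk]
      rw [l2_norm_sq_eq_of_ae (memLp_integral_mul_kernel hk f).coeFn_toLp]
      refine integral_le_of_forall_le (by positivity) (Filter.Eventually.of_forall fun x' => ?_)
      rw [← sq_abs]
      refine pow_le_pow_left₀ (abs_nonneg _) ((abs_integral_mul_kernel_le hk f x').trans ?_) 2
      gcongr
      exact le_abs_self b)

theorem kernelOp_ae (hk : IsBddKernel k b) (f : Lp ℝ 2 ν) :
    kernelOp ν hk f =ᵐ[ν] fun x' => ∫ x, f x * k x x' ∂ν :=
  (memLp_integral_mul_kernel hk f).coeFn_toLp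

theorem norm_kernelOp_sq (hk : IsBddKernel k b) (f : Lp ℝ 2 ν) :
    ‖kernelOp ν hk f‖ ^ 2 = ∫ x', inner ℝ f (kernelSection ν hk x') ^ 2 ∂ν := by
  rw [l2_norm_sq_eq_of_ae (kernelOp_ae hk f)]
  simp only [inner_kernelSection hk]

theorem integrable_inner_kernelSection_sq (hk : IsBddKernel k b) (f : Lp ℝ 2 ν) :
    Integrable (fun x' => inner ℝ f (kernelSection ν hk x') ^ 2) ν := by
  simp only [inner_kernelSection hk]
  exact (memLp_integral_mul_kernel hk f).integrable_sq

theorem integrable_norm_kernelSection_sq (hk : IsBddKernel k b) :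
    Integrable (fun x' => ‖kernelSection ν hk x'‖ ^ 2) ν := by
  have h : StronglyMeasurable (Function.uncurry fun (x' x : X) => k x x' ^ 2) :=
    (hk.meas.comp_measurable measurable_swap).pow 2
  have h2 : StronglyMeasurable fun x' => ∫ x, k x x' ^ 2 ∂ν := h.integral_prod_right
  refine Integrable.of_bound (C := b ^ 2) ?_ (Filter.Eventually.of_forall fun x' => ?_)
  · simp only [norm_kernelSection_sq hk]
    exact h2.aestronglyMeasurable
  · rw [Real.norm_of_nonneg (sq_nonneg _)]
    exact pow_le_pow_left₀ (norm_nonneg _) (norm_kernelSection_le hk x') 2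

/-- The squared Hilbert–Schmidt norm of the operator of the kernel `k`. -/
noncomputable def kernelSq (ν : Measure X) (k : X → X → ℝ) : ℝ :=
  ∫ x', ∫ x, k x x' ^ 2 ∂ν ∂ν

theorem kernelSq_nonneg (k : X → X → ℝ) : 0 ≤ kernelSq ν k :=
  integral_nonneg fun _ => integral_nonneg fun _ => sq_nonneg _

theorem norm_kernelOp_le (hk : IsBddKernel k b) (f : Lp ℝ 2 ν) :
    ‖kernelOp ν hk f‖ ≤ Real.sqrt (kernelSq ν k) * ‖f‖ := by
  refine le_of_sq_le_sq ?_ (by positivity)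
  rw [norm_kernelOp_sq, mul_pow, Real.sq_sqrt (kernelSq_nonneg k), kernelSq]
  simp only [← norm_kernelSection_sq hk]
  rw [← integral_mul_const]
  refine integral_mono (integrable_inner_kernelSection_sq hk f)
    ((integrable_norm_kernelSection_sq hk).mul_const _) fun x' => ?_
  have := abs_real_inner_le_norm f (kernelSection ν hk x')
  calc _ = |inner ℝ f (kernelSection ν hk x')| ^ 2 := (sq_abs _).symm
    _ ≤ (‖f‖ * ‖kernelSection ν hk x'‖) ^ 2 := by gcongr
    _ = _ := by ring

/-- Bessel's inequality for each section `k(·, x')`, integrated over `x'`. -/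
theorem sum_norm_kernelOp_sq_le (hk : IsBddKernel k b) {ι : Type*} (s : Finset ι)
    {e : ι → Lp ℝ 2 ν} (he : Orthonormal ℝ e) :
    ∑ j ∈ s, ‖kernelOp ν hk (e j)‖ ^ 2 ≤ kernelSq ν k := by
  simp only [norm_kernelOp_sq]
  rw [← integral_finsetSum _ fun j _ => integrable_inner_kernelSection_sq hk (e j), kernelSq]
  simp only [← norm_kernelSection_sq hk]
  refine integral_mono (integrable_finsetSum _ fun j _ =>
    integrable_inner_kernelSection_sq hk (e j)) (integrable_norm_kernelSection_sq hk) fun x' => ?_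
  have := he.sum_inner_products_le (x := kernelSection ν hk x') (s := s)
  simpa [Real.norm_eq_abs, sq_abs] using this

end Kernel

/-! ### Feature maps and their covariance operators -/

section Feature

variable {H : Type*} [NormedAddCommGroup H] [InnerProductSpace ℝ H] [FiniteDimensional ℝ H]

/-- A measurable feature map bounded by `κ`. -/
structure IsFeature (Φ : X → H) (κ : ℝ) : Prop where
  meas : StronglyMeasurable Φ
  bound : ∀ x, ‖Φ x‖ ≤ κ
  pos : 0 < κ

variable {Φ : X → H} {κ : ℝ}

theorem IsFeature.abs_inner_le (hΦ : IsFeature Φ κ) (v : H) (x : X) :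
    |inner ℝ v (Φ x)| ≤ κ * ‖v‖ := by
  calc _ ≤ ‖v‖ * ‖Φ x‖ := abs_real_inner_le_norm _ _
    _ ≤ ‖v‖ * κ := by gcongr; exact hΦ.bound x
    _ = _ := mul_comm _ _

theorem IsFeature.memLp (hΦ : IsFeature Φ κ) (v : H) : MemLp (fun x => inner ℝ v (Φ x)) 2 ν :=
  MemLp.of_bound (stronglyMeasurable_const.inner hΦ.meas).aestronglyMeasurable (κ * ‖v‖)
    (Filter.Eventually.of_forall fun x => hΦ.abs_inner_le v x)

/-- The operator `v ↦ ⟨v, Φ(·)⟩` from parameters to functions. -/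
noncomputable def featureOp (ν : Measure X) [IsProbabilityMeasure ν] (hΦ : IsFeature Φ κ) :
    H →L[ℝ] Lp ℝ 2 ν :=
  LinearMap.toContinuousLinearMap
    { toFun := fun v => (hΦ.memLp v).toLp
      map_add' := fun v w => by
        rw [← MemLp.toLp_add]
        exact MemLp.toLp_congr _ _ (Filter.Eventually.of_forall fun x => by
          simp [inner_add_left])
      map_smul' := fun c v => by
        rw [RingHom.id_apply, ← MemLp.toLp_const_smul]
        exact MemLp.toLp_congr _ _ (Filter.Eventually.of_forall fun x => by
          simp [inner_smul_left]) }

theorem featureOp_ae (hΦ : IsFeature Φ κ) (v : H) :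
    featureOp ν hΦ v =ᵐ[ν] fun x => inner ℝ v (Φ x) :=
  (hΦ.memLp v).coeFn_toLp

theorem norm_featureOp_sq (hΦ : IsFeature Φ κ) (v : H) :
    ‖featureOp ν hΦ v‖ ^ 2 = ∫ x, inner ℝ v (Φ x) ^ 2 ∂ν :=
  l2_norm_sq_eq_of_ae (featureOp_ae hΦ v)

theorem norm_featureOp_le (hΦ : IsFeature Φ κ) (v : H) : ‖featureOp ν hΦ v‖ ≤ κ * ‖v‖ := by
  have := hΦ.pos
  refine le_of_sq_le_sq ?_ (by positivity)
  rw [norm_featureOp_sq]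
  refine integral_le_of_forall_le (sq_nonneg _) (Filter.Eventually.of_forall fun x => ?_)
  rw [← sq_abs]
  exact pow_le_pow_left₀ (abs_nonneg _) (hΦ.abs_inner_le v x) 2

/-- The covariance operator on functions. -/
noncomputable def featureCov (ν : Measure X) [IsProbabilityMeasure ν] (hΦ : IsFeature Φ κ) :
    Lp ℝ 2 ν →L[ℝ] Lp ℝ 2 ν :=
  (featureOp ν hΦ).comp (ContinuousLinearMap.adjoint (featureOp ν hΦ))

theorem featureCov_apply (hΦ : IsFeature Φ κ) (f : Lp ℝ 2 ν) :
    featureCov ν hΦ f = featureOp ν hΦ (ContinuousLinearMap.adjoint (featureOp ν hΦ) f) := rfl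

theorem inner_featureCov (hΦ : IsFeature Φ κ) (f g : Lp ℝ 2 ν) :
    inner ℝ (featureCov ν hΦ f) g = inner ℝ (ContinuousLinearMap.adjoint (featureOp ν hΦ) f)
      (ContinuousLinearMap.adjoint (featureOp ν hΦ) g) := by
  rw [featureCov_apply, ContinuousLinearMap.adjoint_inner_right]

/-- `‖S S* f‖ ≤ κ ‖S* f‖`, and `‖S* f‖²` is the quadratic form of `S S*` at `f`. -/
theorem isPosBounded_featureCov (hΦ : IsFeature Φ κ) :
    IsPosBounded (featureCov ν hΦ) (κ ^ 2) where
  symm f g := by rw [inner_featureCov, real_inner_comm, ← inner_featureCov, real_inner_comm]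
  sq_le f := by
    rw [inner_featureCov, real_inner_self_eq_norm_sq, ← mul_pow, featureCov_apply]
    exact pow_le_pow_left₀ (norm_nonneg _) (norm_featureOp_le hΦ _) 2
  pos := by have := hΦ.pos; positivity

theorem inner_adjoint_featureOp (hΦ : IsFeature Φ κ) (f : Lp ℝ 2 ν) (v : H) :
    inner ℝ (ContinuousLinearMap.adjoint (featureOp ν hΦ) f) v
      = ∫ x, f x * inner ℝ v (Φ x) ∂ν := by
  rw [ContinuousLinearMap.adjoint_inner_left]
  exact l2_inner_eq_of_ae f (featureOp_ae hΦ v)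

theorem IsFeature.isBddKernel (hΦ : IsFeature Φ κ) :
    IsBddKernel (fun x x' => inner ℝ (Φ x) (Φ x')) (κ ^ 2) where
  meas := (hΦ.meas.comp_measurable measurable_fst).inner (hΦ.meas.comp_measurable measurable_snd)
  bound x x' := by
    have := hΦ.pos
    calc _ ≤ κ * ‖Φ x‖ := hΦ.abs_inner_le _ _
      _ ≤ κ * κ := by gcongr; exact hΦ.bound x
      _ = _ := by ring

theorem featureCov_ae (hΦ : IsFeature Φ κ) (f : Lp ℝ 2 ν) :
    featureCov ν hΦ f =ᵐ[ν] fun x' => ∫ x, f x * inner ℝ (Φ x) (Φ x') ∂ν := by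
  refine (featureOp_ae hΦ _).trans (Filter.Eventually.of_forall fun x' => ?_)
  change inner ℝ (ContinuousLinearMap.adjoint (featureOp ν hΦ) f) (Φ x') = _
  rw [inner_adjoint_featureOp]
  exact integral_congr_ae (Filter.Eventually.of_forall fun x => by simp [real_inner_comm])

theorem IsBddKernel.sub {k k' : X → X → ℝ} {b b' : ℝ} (hk : IsBddKernel k b)
    (hk' : IsBddKernel k' b') : IsBddKernel (fun x x' => k x x' - k' x x') (b + b') where
  meas := hk.meas.sub hk'.meas
  bound x x' := (abs_sub _ _).trans (add_le_add (hk.bound x x') (hk'.bound x x'))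

/-- The deviation of the random operator is itself an integral operator, so both its operator norm
and its sums over orthonormal families are controlled by `kernelSq` of the difference of the
kernels. -/
theorem featureCov_sub_kernelOp {k : X → X → ℝ} {b : ℝ} (hΦ : IsFeature Φ κ)
    (hk : IsBddKernel k b) (f : Lp ℝ 2 ν) :
    featureCov ν hΦ f - kernelOp ν hk f = kernelOp ν (hΦ.isBddKernel.sub hk) f := by
  apply Lp.ext
  filter_upwards [Lp.coeFn_sub (featureCov ν hΦ f) (kernelOp ν hk f), featureCov_ae hΦ f,
    kernelOp_ae hk f, kernelOp_ae (hΦ.isBddKernel.sub hk) f] with x' h1 h2 h3 h4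
  rw [h1, Pi.sub_apply, h2, h3, h4, ← inner_kernelSection hk,
    ← inner_kernelSection hΦ.isBddKernel, ← inner_kernelSection (hΦ.isBddKernel.sub hk),
    ← inner_sub_right]
  rfl

/-- The trace identity `∫ ‖P S Φ(x)‖² = ∑_j ‖P A e_j‖²` for an orthonormal family `e` whose span
contains the range of `P S`. -/
theorem integral_norm_comp_feature_sq (hΦ : IsFeature Φ κ) {P : Lp ℝ 2 ν →L[ℝ] Lp ℝ 2 ν}
    (hPsymm : ∀ f g, inner ℝ (P f) g = inner ℝ f (P g))
    (hPA : ∀ f, featureCov ν hΦ (P f) = P (featureCov ν hΦ f))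
    {ι : Type*} [Fintype ι] {e : ι → Lp ℝ 2 ν}
    (hspan : ∀ v, ‖P (featureOp ν hΦ v)‖ ^ 2 = ∑ j, inner ℝ (e j) (P (featureOp ν hΦ v)) ^ 2) :
    ∫ x, ‖P (featureOp ν hΦ (Φ x))‖ ^ 2 ∂ν = ∑ j, ‖P (featureCov ν hΦ (e j))‖ ^ 2 := by
  -- Once the coefficient is a parameter vector paired with `Φ x`, the integral of its square is `‖S
  -- S* P e_j‖²`.
  have key : ∀ j x, inner ℝ (e j) (P (featureOp ν hΦ (Φ x)))
      = inner ℝ (ContinuousLinearMap.adjoint (featureOp ν hΦ) (P (e j))) (Φ x) := fun j x => by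
    rw [ContinuousLinearMap.adjoint_inner_left, hPsymm]
  simp only [hspan, key]
  rw [integral_finsetSum]
  · refine Finset.sum_congr rfl fun j _ => ?_
    rw [← norm_featureOp_sq hΦ, ← featureCov_apply, hPA]
  · exact fun j _ => (hΦ.memLp _).integrable_sq

end Feature

end L2

/-! ### Operators with a complete orthonormal eigensystem -/

section Spectral

variable {E : Type*} [NormedAddCommGroup E] [InnerProductSpace ℝ E]

/-- `L` acts diagonally on the orthonormal family `φ` and vanishes on its complement. -/
structure IsDiagonalized (L : E →L[ℝ] E) (μ : ℕ → ℝ) (φ : ℕ → E) : Prop where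
  orthonormal : Orthonormal ℝ φ
  eigen : ∀ i, L (φ i) = μ i • φ i
  complete : ∀ f, (∀ i, inner ℝ (φ i) f = 0) → L f = 0

theorem norm_sum_smul_orthonormal_sq {φ : ℕ → E} (hφ : Orthonormal ℝ φ) (c : ℕ → ℝ)
    (s : Finset ℕ) : ‖∑ i ∈ s, c i • φ i‖ ^ 2 = ∑ i ∈ s, c i ^ 2 := by
  rw [← real_inner_self_eq_norm_sq, hφ.inner_sum]
  exact Finset.sum_congr rfl fun i _ => by simp [sq]

theorem hasSum_sq_of_hasSum_smul {φ : ℕ → E} (hφ : Orthonormal ℝ φ) {c : ℕ → ℝ} {x : E}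
    (h : HasSum (fun i => c i • φ i) x) : HasSum (fun i => c i ^ 2) (‖x‖ ^ 2) := by
  have h1 := (h.norm).pow 2
  unfold HasSum
  refine h1.congr fun s => ?_
  exact norm_sum_smul_orthonormal_sq hφ c s

theorem inner_eq_of_hasSum_smul {φ : ℕ → E} (hφ : Orthonormal ℝ φ) {c : ℕ → ℝ} {x : E}
    (h : HasSum (fun i => c i • φ i) x) (j : ℕ) : inner ℝ (φ j) x = c j := by
  have h1 := h.mapL (innerSL ℝ (φ j))
  have h2 : HasSum (fun i => (innerSL ℝ (φ j)) (c i • φ i)) (c j) := by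
    have h3 := hasSum_single (f := fun i => (innerSL ℝ (φ j)) (c i • φ i)) j fun i hi => by
      simp [hφ.2 hi.symm]
    simpa [inner_smul_right, hφ.1 j] using h3
  exact h1.unique h2

variable [CompleteSpace E] {L : E →L[ℝ] E} {μ : ℕ → ℝ} {φ : ℕ → E}

theorem IsDiagonalized.hasSum_apply (hL : IsDiagonalized L μ φ) (x : E) :
    HasSum (fun i => (μ i * inner ℝ (φ i) x) • φ i) (L x) := by
  have hφ := hL.orthonormal
  have hs : Summable fun i => (inner ℝ (φ i) x : ℝ) • φ i := by
    have h1 := (hφ.orthogonalFamily.summable_iff_norm_sq_summable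
      (fun i => (inner ℝ (φ i) x : ℝ))).2 (hφ.inner_products_summable x)
    simpa using h1
  obtain ⟨p, hp⟩ := hs
  -- `p` is the projection of `x` onto the closed span of `φ`; completeness makes `L` vanish on the
  -- rest.
  have h1 : L (x - p) = 0 := hL.complete _ fun i => by
    rw [inner_sub_right, inner_eq_of_hasSum_smul hφ hp, sub_self]
  rw [map_sub, sub_eq_zero] at h1
  rw [h1]
  have h2 := hp.mapL L
  refine h2.congr_fun ?_
  intro i
  simp [hL.eigen, smul_smul, mul_comm]

/-- Exchanging the sums gives `∑_i μ_i² ∑_j ⟨φ_i, e_j⟩²`. Bessel for `φ_i` against `e` bounds the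
inner sum by `1`, and orthogonality removes the indices below `n`. -/
theorem IsDiagonalized.sum_norm_apply_sq_le (hL : IsDiagonalized L μ φ) {n : ℕ} {τ : ℝ}
    (hτ : ∀ N, ∑ i ∈ Finset.Ico n N, μ i ^ 2 ≤ τ) {ι : Type*} (s : Finset ι) {e : ι → E}
    (he : Orthonormal ℝ e) (hn : ∀ j ∈ s, ∀ i < n, inner ℝ (φ i) (e j) = 0) :
    ∑ j ∈ s, ‖L (e j)‖ ^ 2 ≤ τ := by
  have h1 : HasSum (fun i => ∑ j ∈ s, (μ i * inner ℝ (φ i) (e j)) ^ 2) (∑ j ∈ s, ‖L (e j)‖ ^ 2) :=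
    hasSum_sum fun j _ => hasSum_sq_of_hasSum_smul hL.orthonormal (hL.hasSum_apply (e j))
  refine hasSum_le_of_sum_le h1 fun F => ?_
  obtain ⟨N, hN⟩ := F.exists_nat_subset_range
  have hterm : ∀ i, ∑ j ∈ s, (μ i * inner ℝ (φ i) (e j)) ^ 2 ≤ μ i ^ 2 := fun i => by
    have h2 := he.sum_inner_products_le (x := φ i) (s := s)
    rw [hL.orthonormal.1 i] at h2
    simp only [mul_pow, ← Finset.mul_sum]
    have h3 : ∑ j ∈ s, inner ℝ (φ i) (e j) ^ 2 ≤ 1 := by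
      simpa [Real.norm_eq_abs, sq_abs, real_inner_comm] using h2
    nlinarith [sq_nonneg (μ i)]
  have hzero : ∀ i < n, ∑ j ∈ s, (μ i * inner ℝ (φ i) (e j)) ^ 2 = 0 := fun i hi =>
    Finset.sum_eq_zero fun j hj => by simp [hn j hj i hi]
  have hnn : ∀ i, 0 ≤ ∑ j ∈ s, (μ i * inner ℝ (φ i) (e j)) ^ 2 := fun i =>
    Finset.sum_nonneg fun _ _ => sq_nonneg _
  calc ∑ i ∈ F, ∑ j ∈ s, (μ i * inner ℝ (φ i) (e j)) ^ 2
      ≤ ∑ i ∈ Finset.range (n + N), ∑ j ∈ s, (μ i * inner ℝ (φ i) (e j)) ^ 2 :=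
        Finset.sum_le_sum_of_subset_of_nonneg
          (hN.trans (Finset.range_mono (Nat.le_add_left _ _))) fun i _ _ => hnn i
    _ = ∑ i ∈ Finset.Ico n (n + N), ∑ j ∈ s, (μ i * inner ℝ (φ i) (e j)) ^ 2 := by
        rw [← Finset.sum_range_add_sum_Ico _ (Nat.le_add_right n N),
          Finset.sum_eq_zero fun i hi => hzero i (Finset.mem_range.1 hi), zero_add]
    _ ≤ ∑ i ∈ Finset.Ico n (n + N), μ i ^ 2 := Finset.sum_le_sum fun i _ => hterm i
    _ ≤ τ := hτ _

end Spectral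

/-! ### Trace bounds for random features through a nearby kernel operator -/

section Trace

variable {X : Type*} [MeasurableSpace X] {ν : Measure X} [IsProbabilityMeasure ν]
  {H : Type*} [NormedAddCommGroup H] [InnerProductSpace ℝ H] [FiniteDimensional ℝ H]
  {Φ : X → H} {κ : ℝ} {k : X → X → ℝ} {b : ℝ} {μ : ℕ → ℝ} {φ : ℕ → Lp ℝ 2 ν}

/-- A trace bound for a random-feature operator in terms of the eigenvalues of a nearby
kernel operator. -/
theorem integral_norm_comp_feature_sq_le (hΦ : IsFeature Φ κ) (hk : IsBddKernel k b)
    (hL : IsDiagonalized (kernelOp ν hk) μ φ)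
    {P : Lp ℝ 2 ν →L[ℝ] Lp ℝ 2 ν} (hPsymm : ∀ f g, inner ℝ (P f) g = inner ℝ f (P g))
    (hPA : ∀ f, featureCov ν hΦ (P f) = P (featureCov ν hΦ f))
    (hPS : ∀ v, ∃ w, P (featureOp ν hΦ v) = featureOp ν hΦ w)
    (hP1 : ∀ f, ‖P f‖ ≤ ‖f‖) {q : ℝ} (hPq : ∀ f, ‖P (featureCov ν hΦ f)‖ ^ 2 ≤ q * ‖f‖ ^ 2)
    {n : ℕ} {τ : ℝ} (hτ : ∀ N, ∑ i ∈ Finset.Ico n N, μ i ^ 2 ≤ τ) :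
    ∫ x, ‖P (featureOp ν hΦ (Φ x))‖ ^ 2 ∂ν
      ≤ n * q + 2 * kernelSq ν (fun x x' => inner ℝ (Φ x) (Φ x') - k x x') + 2 * τ := by
  classical
  set S := featureOp ν hΦ
  set A := featureCov ν hΦ
  set L := kernelOp ν hk
  have hφ := hL.orthonormal
  -- A finite-dimensional space containing the range of `S` and the first `n` eigenvectors: the
  -- trace is then a finite sum over an orthonormal basis extending those eigenvectors.
  let W : Submodule ℝ (Lp ℝ 2 ν) :=
    LinearMap.range (S : H →ₗ[ℝ] Lp ℝ 2 ν) ⊔ Submodule.span ℝ (φ '' (Finset.range n : Set ℕ))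
  have hfin : FiniteDimensional ℝ W := by
    have : FiniteDimensional ℝ (Submodule.span ℝ (φ '' (Finset.range n : Set ℕ))) :=
      FiniteDimensional.span_of_finite ℝ ((Finset.finite_toSet _).image _)
    infer_instance
  have hφW : ∀ i < n, φ i ∈ W := fun i hi =>
    Submodule.mem_sup_right (Submodule.subset_span ⟨i, by simpa using hi, rfl⟩)
  let v : Set W := {w | ∃ i < n, φ i = w}
  have hv : Orthonormal ℝ ((↑) : v → W) := by
    rw [orthonormal_subtype_iff_ite]
    rintro x ⟨i, hi, hix⟩ y ⟨j, hj, hjy⟩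
    rw [Submodule.coe_inner, ← hix, ← hjy, orthonormal_iff_ite.1 hφ]
    have : (i = j) ↔ x = y := by
      rw [Subtype.ext_iff, ← hix, ← hjy]
      exact (hφ.linearIndependent.injective.eq_iff).symm
    simp [this]
  obtain ⟨u, bs, hvu, hbs⟩ := hv.exists_orthonormalBasis_extension
  let e : u → Lp ℝ 2 ν := fun j => ((bs j : W) : Lp ℝ 2 ν)
  have he : Orthonormal ℝ e := bs.orthonormal.comp_linearIsometry W.subtypeₗᵢ
  have hspan : ∀ w, ‖P (S w)‖ ^ 2 = ∑ j, inner ℝ (e j) (P (S w)) ^ 2 := fun w => by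
    obtain ⟨w', hw'⟩ := hPS w
    have hmem : P (S w) ∈ W := by
      rw [hw']; exact Submodule.mem_sup_left ⟨w', rfl⟩
    have := bs.sum_sq_norm_inner_right ⟨P (S w), hmem⟩
    simp only [Submodule.coe_inner, Real.norm_eq_abs, sq_abs, Submodule.coe_norm] at this
    exact this.symm
  rw [integral_norm_comp_feature_sq hΦ hPsymm hPA hspan]
  -- The at most `n` basis vectors in `J` are leading eigenvectors and cost `q` each. The others are
  -- orthogonal to these eigenvectors, so there the tail of `L` and the deviation from `L` suffice.
  let J : Finset u := Finset.univ.filter fun j => ∃ i < n, φ i = e j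
  have hcard : J.card ≤ n := by
    calc J.card = (J.image e).card :=
          (Finset.card_image_of_injective _ he.linearIndependent.injective).symm
      _ ≤ ((Finset.range n).image φ).card := by
          refine Finset.card_le_card fun x hx => ?_
          obtain ⟨j, hj, rfl⟩ := Finset.mem_image.1 hx
          obtain ⟨i, hi, hij⟩ := (Finset.mem_filter.1 hj).2
          exact Finset.mem_image.2 ⟨i, Finset.mem_range.2 hi, hij⟩
      _ ≤ n := Finset.card_image_le.trans (by simp)
  have horth : ∀ j ∈ Jᶜ, ∀ i < n, inner ℝ (φ i) (e j) = 0 := by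
    intro j hj i hi
    have hmem : (⟨φ i, hφW i hi⟩ : W) ∈ u := hvu ⟨i, hi, rfl⟩
    have hei : e ⟨_, hmem⟩ = φ i := by simp [e, hbs]
    rw [← hei]
    refine he.2 fun h => ?_
    simp only [J, Finset.mem_compl, Finset.mem_filter, Finset.mem_univ, true_and] at hj
    exact hj ⟨i, hi, by rw [← hei, h]⟩
  have hq : 0 ≤ q ∨ n = 0 := by
    rcases Nat.eq_zero_or_pos n with h | h
    · exact Or.inr h
    · left
      have := hPq (φ 0)
      rw [hφ.1 0] at this
      nlinarith [sq_nonneg ‖P (A (φ 0))‖]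
  have h1 : ∑ j ∈ J, ‖P (A (e j))‖ ^ 2 ≤ n * q := by
    calc _ ≤ ∑ j ∈ J, q := Finset.sum_le_sum fun j _ => by
          have := hPq (e j); rwa [he.1 j, one_pow, mul_one] at this
      _ = J.card * q := by rw [Finset.sum_const, nsmul_eq_mul]
      _ ≤ n * q := by
          rcases hq with hq | hq
          · gcongr
          · have : J.card = 0 := by omega
            simp [this, hq]
  have h2 : ∑ j ∈ Jᶜ, ‖P (A (e j))‖ ^ 2
      ≤ 2 * kernelSq ν (fun x x' => inner ℝ (Φ x) (Φ x') - k x x') + 2 * τ := by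
    have h3 := sum_norm_kernelOp_sq_le (hΦ.isBddKernel.sub hk) Jᶜ he
    have h4 := hL.sum_norm_apply_sq_le hτ Jᶜ he horth
    calc _ ≤ ∑ j ∈ Jᶜ, (2 * ‖kernelOp ν (hΦ.isBddKernel.sub hk) (e j)‖ ^ 2
            + 2 * ‖L (e j)‖ ^ 2) := Finset.sum_le_sum fun j _ => by
          have h5 : A (e j) = kernelOp ν (hΦ.isBddKernel.sub hk) (e j) + L (e j) := by
            rw [← featureCov_sub_kernelOp hΦ hk, sub_add_cancel]
          have h6 := hP1 (A (e j))
          have h7 := norm_add_le (kernelOp ν (hΦ.isBddKernel.sub hk) (e j)) (L (e j))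
          rw [← h5] at h7
          have h8 := pow_le_pow_left₀ (norm_nonneg _) (h6.trans h7) 2
          nlinarith [sq_nonneg (‖kernelOp ν (hΦ.isBddKernel.sub hk) (e j)‖ - ‖L (e j)‖)]
      _ = 2 * ∑ j ∈ Jᶜ, ‖kernelOp ν (hΦ.isBddKernel.sub hk) (e j)‖ ^ 2
            + 2 * ∑ j ∈ Jᶜ, ‖L (e j)‖ ^ 2 := by
          rw [Finset.sum_add_distrib, Finset.mul_sum, Finset.mul_sum]
      _ ≤ _ := by gcongr
  have h3 := Finset.sum_add_sum_compl J fun j => ‖P (A (e j))‖ ^ 2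
  linarith

end Trace

/-! ### The source condition -/

section Source

variable {E : Type*} [NormedAddCommGroup E] [InnerProductSpace ℝ E]
  {L : E →L[ℝ] E} {μ : ℕ → ℝ} {φ : ℕ → E}

/-- Spectral truncation of an element `G = L^r h` at the level `τ`. -/
theorem IsDiagonalized.exists_truncation (hL : IsDiagonalized L μ φ) (hμ : ∀ i, 0 < μ i)
    {c : ℝ} (hc : ∀ i, μ i ≤ c) {r : ℝ} (hr : 1 / 2 < r) (hr1 : r ≤ 1) {G h : E}
    (hG : HasSum (fun i => (μ i ^ r * inner ℝ (φ i) h) • φ i) G) {τ : ℝ} (hτ : 0 < τ)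
    {N : ℕ} (hN : ∀ i, N ≤ i → μ i ≤ τ) :
    ∃ u : E, ‖u‖ ≤ τ ^ (r - 1) * ‖h‖ ∧ ‖G - L u‖ ≤ τ ^ r * ‖h‖ ∧
      inner ℝ (L u) u ≤ c ^ (2 * r - 1) * ‖h‖ ^ 2 := by
  have hφ := hL.orthonormal
  let a : ℕ → ℝ := fun i => inner ℝ (φ i) h
  -- The witness `u` inverts `L` only on eigenvalues at least `τ`. There `μ_i^{r-1} ≤ τ^{r-1}`
  -- because `r ≤ 1`; the discarded part has `μ_i^r ≤ τ^r`.
  let F : Finset ℕ := (Finset.range N).filter fun i => τ ≤ μ i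
  have hF : ∀ i ∉ F, μ i ≤ τ := fun i hi => by
    by_contra hcon
    push Not at hcon
    refine hi (Finset.mem_filter.2 ⟨Finset.mem_range.2 ?_, hcon.le⟩)
    by_contra h'
    exact absurd (hN i (not_lt.1 h')) (not_le.2 hcon)
  have hbessel : ∀ s : Finset ℕ, ∑ i ∈ s, a i ^ 2 ≤ ‖h‖ ^ 2 := fun s => by
    have := hφ.sum_inner_products_le (x := h) (s := s)
    simpa [Real.norm_eq_abs, sq_abs] using this
  have hLu : L (∑ i ∈ F, (μ i ^ (r - 1) * a i) • φ i) = ∑ i ∈ F, (μ i ^ r * a i) • φ i := by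
    rw [map_sum]
    refine Finset.sum_congr rfl fun i _ => ?_
    rw [map_smul, hL.eigen, smul_smul]
    congr 1
    rw [Real.rpow_sub_one (hμ i).ne']
    have := (hμ i).ne'
    field_simp
  refine ⟨∑ i ∈ F, (μ i ^ (r - 1) * a i) • φ i, ?_, ?_, ?_⟩
  · refine le_of_sq_le_sq ?_ (by positivity)
    rw [norm_sum_smul_orthonormal_sq hφ]
    calc ∑ i ∈ F, (μ i ^ (r - 1) * a i) ^ 2 ≤ ∑ i ∈ F, (τ ^ (r - 1)) ^ 2 * a i ^ 2 := by
          refine Finset.sum_le_sum fun i hi => ?_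
          rw [mul_pow]
          exact mul_le_mul_of_nonneg_right (pow_le_pow_left₀ (Real.rpow_pos_of_pos (hμ i) _).le
            (Real.rpow_le_rpow_of_nonpos hτ (Finset.mem_filter.1 hi).2 (by linarith)) 2)
            (sq_nonneg _)
      _ = (τ ^ (r - 1)) ^ 2 * ∑ i ∈ F, a i ^ 2 := by rw [Finset.mul_sum]
      _ ≤ (τ ^ (r - 1)) ^ 2 * ‖h‖ ^ 2 := by gcongr; exact hbessel F
      _ = _ := by ring
  · refine le_of_sq_le_sq ?_ (by positivity)
    have h1 : HasSum (fun i => (if i ∈ F then 0 else μ i ^ r * a i) • φ i)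
        (G - ∑ i ∈ F, (μ i ^ r * a i) • φ i) := by
      have h2 : HasSum (fun i => (if i ∈ F then μ i ^ r * a i else 0) • φ i)
          (∑ i ∈ F, (μ i ^ r * a i) • φ i) := by
        have h3 : HasSum (fun i => (if i ∈ F then μ i ^ r * a i else 0) • φ i)
            (∑ i ∈ F, (if i ∈ F then μ i ^ r * a i else 0) • φ i) :=
          hasSum_sum_of_ne_finset_zero fun i hi => by simp [hi]
        rwa [Finset.sum_congr rfl fun i hi => by rw [if_pos hi]] at h3
      refine (hG.sub h2).congr_fun fun i => ?_
      by_cases hi : i ∈ F <;> simp [hi, a]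
    rw [hLu]
    refine hasSum_le_of_sum_le (hasSum_sq_of_hasSum_smul hφ h1) fun s => ?_
    calc ∑ i ∈ s, (if i ∈ F then 0 else μ i ^ r * a i) ^ 2
        ≤ ∑ i ∈ s, (τ ^ r) ^ 2 * a i ^ 2 := by
          refine Finset.sum_le_sum fun i _ => ?_
          by_cases hi : i ∈ F
          · rw [if_pos hi, zero_pow two_ne_zero]; positivity
          · rw [if_neg hi, mul_pow]
            exact mul_le_mul_of_nonneg_right (pow_le_pow_left₀ (Real.rpow_pos_of_pos (hμ i) _).le
              (Real.rpow_le_rpow (hμ i).le (hF i hi) (by linarith)) 2) (sq_nonneg _)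
      _ = (τ ^ r) ^ 2 * ∑ i ∈ s, a i ^ 2 := by rw [Finset.mul_sum]
      _ ≤ (τ ^ r) ^ 2 * ‖h‖ ^ 2 := by gcongr; exact hbessel s
      _ = _ := by ring
  · rw [hLu, hφ.inner_sum]
    calc _ ≤ ∑ i ∈ F, c ^ (2 * r - 1) * a i ^ 2 := by
          refine Finset.sum_le_sum fun i _ => ?_
          -- Since `2 r - 1 > 0`, the energy `⟨L u, u⟩` is bounded independently of `τ`, although
          -- the bound on `‖u‖` may grow as `τ` decreases.
          have e1 : μ i ^ r * μ i ^ (r - 1) = μ i ^ (2 * r - 1) := by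
            rw [← Real.rpow_add (hμ i)]; ring_nf
          calc _ = μ i ^ r * μ i ^ (r - 1) * a i ^ 2 := by simp; ring
            _ ≤ _ := by
              rw [e1]
              gcongr
              · exact (hμ i).le
              · linarith
              · exact hc i
      _ = c ^ (2 * r - 1) * ∑ i ∈ F, a i ^ 2 := by rw [Finset.mul_sum]
      _ ≤ _ := by
          have : 0 ≤ c := (hμ 0).le.trans (hc 0)
          gcongr; exact hbessel F

end Source

/-! ### Stochastic gradient descent for a linear model -/

section LinearSGD

variable {X : Type*} [MeasurableSpace X]
  {H : Type*} [NormedAddCommGroup H] [InnerProductSpace ℝ H] [FiniteDimensional ℝ H]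

/-- One regularized stochastic gradient step for the linear model `⟨v, Φ(x)⟩`. -/
def linStep (Φ : X → H) (lam s : ℝ) (v : H) (z : X × ℝ) : H :=
  (1 - s * lam) • v - (s * (inner ℝ v (Φ z.1) - z.2)) • Φ z.1

/-- Stochastic gradient descent for the linear model, started at `0`. -/
def linSgd (Φ : X → H) (lam : ℝ) (s : ℕ → ℝ) : (T : ℕ) → (Fin T → X × ℝ) → H
  | 0, _ => 0
  | T + 1, z => linStep Φ lam (s T) (linSgd Φ lam s T (Fin.init z)) (z (Fin.last T))

/-- `g` is the regression function of `ρ` as far as the features `Φ` can see, and the outputs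
are bounded by `1`. -/
structure IsRegression (ρ : Measure (X × ℝ)) (Φ : X → H) (κ : ℝ) (hΦ : IsFeature Φ κ)
    [IsProbabilityMeasure ρ] (g : Lp ℝ 2 ρ.fst) : Prop where
  output : ∀ᵐ z ∂ρ, |z.2| ≤ 1
  mean : ∀ v, ∫ z, z.2 * inner ℝ v (Φ z.1) ∂ρ = inner ℝ g (featureOp ρ.fst hΦ v)

variable {Φ : X → H} {κ lam : ℝ} {ρ : Measure (X × ℝ)} [IsProbabilityMeasure ρ]

theorem integral_comp_fst {f : X → ℝ} (hf : StronglyMeasurable f) :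
    ∫ z, f z.1 ∂ρ = ∫ x, f x ∂ρ.fst := by
  rw [Measure.fst, integral_map measurable_fst.aemeasurable hf.aestronglyMeasurable]

variable {hΦ : IsFeature Φ κ} {g : Lp ℝ 2 ρ.fst}

theorem IsRegression.integrable_of_bound {F : Type*} [NormedAddCommGroup F]
    (hg : IsRegression ρ Φ κ hΦ g) {f : X × ℝ → F} (hf : StronglyMeasurable f) {C : ℝ}
    (h : ∀ z : X × ℝ, |z.2| ≤ 1 → ‖f z‖ ≤ C) : Integrable f ρ :=
  Integrable.of_bound hf.aestronglyMeasurable C (hg.output.mono fun z hz => h z hz)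

theorem stronglyMeasurable_residual (hΦ : IsFeature Φ κ) (v : H) :
    StronglyMeasurable fun z : X × ℝ => inner ℝ v (Φ z.1) - z.2 :=
  (stronglyMeasurable_const.inner (hΦ.meas.comp_measurable measurable_fst)).sub
    measurable_snd.stronglyMeasurable

theorem abs_residual_le (hΦ : IsFeature Φ κ) (v : H) {z : X × ℝ} (hz : |z.2| ≤ 1) :
    |inner ℝ v (Φ z.1) - z.2| ≤ κ * ‖v‖ + 1 :=
  (abs_sub _ _).trans (add_le_add (hΦ.abs_inner_le v z.1) hz)

theorem residual_sq_le (hΦ : IsFeature Φ κ) (v : H) {z : X × ℝ} (hz : |z.2| ≤ 1) :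
    (inner ℝ v (Φ z.1) - z.2) ^ 2 ≤ 2 * (1 + κ ^ 2 * ‖v‖ ^ 2) := by
  have h := pow_le_pow_left₀ (abs_nonneg _) (abs_residual_le hΦ v hz) 2
  rw [sq_abs] at h
  nlinarith [sq_nonneg (κ * ‖v‖ - 1)]

theorem integral_residual_mul (hg : IsRegression ρ Φ κ hΦ g) (v w : H) :
    ∫ z, (inner ℝ v (Φ z.1) - z.2) * inner ℝ w (Φ z.1) ∂ρ
      = inner ℝ (featureOp ρ.fst hΦ v - g) (featureOp ρ.fst hΦ w) := by
  have hκ := hΦ.pos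
  have hm : ∀ v : H, StronglyMeasurable fun x => inner ℝ v (Φ x) := fun v =>
    stronglyMeasurable_const.inner hΦ.meas
  have hm' : ∀ v : H, StronglyMeasurable fun z : X × ℝ => inner ℝ v (Φ z.1) := fun v =>
    (hm v).comp_measurable measurable_fst
  have i1 : Integrable (fun z : X × ℝ => inner ℝ v (Φ z.1) * inner ℝ w (Φ z.1)) ρ :=
    hg.integrable_of_bound ((hm' v).mul (hm' w)) (C := κ * ‖v‖ * (κ * ‖w‖)) fun z _ => by
      rw [norm_mul]
      exact mul_le_mul (hΦ.abs_inner_le v _) (hΦ.abs_inner_le w _) (norm_nonneg _) (by positivity)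
  have i2 : Integrable (fun z : X × ℝ => z.2 * inner ℝ w (Φ z.1)) ρ :=
    hg.integrable_of_bound (measurable_snd.stronglyMeasurable.mul (hm' w))
      (C := 1 * (κ * ‖w‖)) fun z hz => by
      rw [norm_mul]
      exact mul_le_mul hz (hΦ.abs_inner_le w _) (norm_nonneg _) zero_le_one
  simp only [sub_mul]
  rw [integral_sub i1 i2, hg.mean, inner_sub_left]
  congr 1
  rw [integral_comp_fst (f := fun x => inner ℝ v (Φ x) * inner ℝ w (Φ x)) ((hm v).mul (hm w)),
    l2_inner_eq]
  exact integral_congr_ae (by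
    filter_upwards [featureOp_ae (ν := ρ.fst) hΦ v, featureOp_ae (ν := ρ.fst) hΦ w] with x h1 h2
    rw [h1, h2])

theorem integrable_residual_smul (hg : IsRegression ρ Φ κ hΦ g) (v : H) :
    Integrable (fun z : X × ℝ => (inner ℝ v (Φ z.1) - z.2) • Φ z.1) ρ :=
  hg.integrable_of_bound ((stronglyMeasurable_residual hΦ v).smul
    (hΦ.meas.comp_measurable measurable_fst)) (C := (κ * ‖v‖ + 1) * κ) fun z hz => by
      have hκ := hΦ.pos
      rw [norm_smul]
      exact mul_le_mul (abs_residual_le hΦ v hz) (hΦ.bound _) (norm_nonneg _) (by positivity)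

theorem integral_residual_smul (hg : IsRegression ρ Φ κ hΦ g) (v : H) :
    ∫ z, (inner ℝ v (Φ z.1) - z.2) • Φ z.1 ∂ρ
      = ContinuousLinearMap.adjoint (featureOp ρ.fst hΦ) (featureOp ρ.fst hΦ v - g) := by
  refine ext_inner_left ℝ fun w => ?_
  rw [← integral_inner (integrable_residual_smul hg v), ContinuousLinearMap.adjoint_inner_right,
    real_inner_comm, ← integral_residual_mul hg v w]
  exact integral_congr_ae (Filter.Eventually.of_forall fun z => by simp [inner_smul_right])

/-- The variance of `Y` is bounded by its second moment. -/
theorem integral_norm_sub_smul_sq_le {Ω E : Type*} [MeasurableSpace Ω] {P : Measure Ω}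
    [IsProbabilityMeasure P] [NormedAddCommGroup E] [InnerProductSpace ℝ E] [CompleteSpace E]
    {Y : Ω → E} (hY : Integrable Y P) (hY2 : Integrable (fun ω => ‖Y ω‖ ^ 2) P) (c : E) (s : ℝ) :
    ∫ ω, ‖c - s • Y ω‖ ^ 2 ∂P ≤ ‖c - s • ∫ ω, Y ω ∂P‖ ^ 2 + s ^ 2 * ∫ ω, ‖Y ω‖ ^ 2 ∂P := by
  have h1 : ∀ y : E, ‖c - s • y‖ ^ 2 = ‖c‖ ^ 2 - 2 * s * inner ℝ c y + s ^ 2 * ‖y‖ ^ 2 := fun y => by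
    rw [norm_sub_sq_real, inner_smul_right, norm_smul, mul_pow, Real.norm_eq_abs, sq_abs]; ring
  have h2 : ∫ ω, ‖c - s • Y ω‖ ^ 2 ∂P
      = ‖c‖ ^ 2 - 2 * s * inner ℝ c (∫ ω, Y ω ∂P) + s ^ 2 * ∫ ω, ‖Y ω‖ ^ 2 ∂P := by
    simp only [h1]
    have i1 : Integrable (fun ω => 2 * s * inner ℝ c (Y ω)) P := (hY.const_inner c).const_mul _
    have i2 : Integrable (fun ω => ‖c‖ ^ 2 - 2 * s * inner ℝ c (Y ω)) P :=
      (integrable_const _).sub i1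
    rw [integral_add i2 (hY2.const_mul _),
      integral_sub (integrable_const _) i1, integral_const_mul, integral_const_mul,
      integral_inner hY]
    simp
  rw [h2, h1]
  nlinarith [mul_nonneg (sq_nonneg s) (sq_nonneg ‖∫ ω, Y ω ∂P‖)]

/-- The one-step decomposition into mean and variance. -/
theorem integral_norm_linStep_sq_le (hg : IsRegression ρ Φ κ hΦ g) {E : Type*}
    [NormedAddCommGroup E] [InnerProductSpace ℝ E] [CompleteSpace E] (B : H →L[ℝ] E) (q : E)
    (s : ℝ) (v : H) :
    ∫ z, ‖B (linStep Φ lam s v z) - q‖ ^ 2 ∂ρ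
      ≤ ‖B ((1 - s * lam) • v - s • ContinuousLinearMap.adjoint (featureOp ρ.fst hΦ)
          (featureOp ρ.fst hΦ v - g)) - q‖ ^ 2
        + s ^ 2 * (2 * (1 + κ ^ 2 * ‖v‖ ^ 2) * ∫ x, ‖B (Φ x)‖ ^ 2 ∂ρ.fst) := by
  have hκ := hΦ.pos
  have hBm : StronglyMeasurable fun x => B (Φ x) := B.continuous.comp_stronglyMeasurable hΦ.meas
  have hBb : ∀ x, ‖B (Φ x)‖ ≤ ‖B‖ * κ := fun x =>
    (B.le_opNorm _).trans (by gcongr; exact hΦ.bound x)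
  let Y : X × ℝ → E := fun z => B ((inner ℝ v (Φ z.1) - z.2) • Φ z.1)
  have hY : Integrable Y ρ := B.integrable_comp (integrable_residual_smul hg v)
  have hYint : ∫ z, Y z ∂ρ = B (ContinuousLinearMap.adjoint (featureOp ρ.fst hΦ)
      (featureOp ρ.fst hΦ v - g)) := by
    rw [← integral_residual_smul hg v]
    exact B.integral_comp_comm (integrable_residual_smul hg v)
  have hYn : ∀ z, ‖Y z‖ ^ 2 = (inner ℝ v (Φ z.1) - z.2) ^ 2 * ‖B (Φ z.1)‖ ^ 2 := fun z => by
    simp only [Y, map_smul, norm_smul, mul_pow, Real.norm_eq_abs, sq_abs]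
  have hB2 : Integrable (fun z : X × ℝ => 2 * (1 + κ ^ 2 * ‖v‖ ^ 2) * ‖B (Φ z.1)‖ ^ 2) ρ := by
    refine Integrable.const_mul ?_ _
    refine hg.integrable_of_bound ((hBm.comp_measurable measurable_fst).norm.pow 2)
      (C := (‖B‖ * κ) ^ 2) fun z _ => ?_
    rw [Real.norm_of_nonneg (sq_nonneg _)]
    exact pow_le_pow_left₀ (norm_nonneg _) (hBb _) 2
  have hle : ∀ᵐ z ∂ρ, ‖Y z‖ ^ 2 ≤ 2 * (1 + κ ^ 2 * ‖v‖ ^ 2) * ‖B (Φ z.1)‖ ^ 2 :=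
    hg.output.mono fun z hz => by
      rw [hYn]; gcongr; exact residual_sq_le hΦ v hz
  have hY2 : Integrable (fun z => ‖Y z‖ ^ 2) ρ :=
    hB2.mono' (hY.aestronglyMeasurable.norm.pow 2) (hle.mono fun z hz => by
      rwa [Real.norm_of_nonneg (sq_nonneg _)])
  have h1 : ∀ z, B (linStep Φ lam s v z) - q = (B ((1 - s * lam) • v) - q) - s • Y z := fun z => by
    simp only [linStep, Y, map_sub, map_smul, mul_smul]; abel
  simp only [h1]
  refine (integral_norm_sub_smul_sq_le hY hY2 _ s).trans ?_
  have h2 : ∫ z, ‖Y z‖ ^ 2 ∂ρ ≤ 2 * (1 + κ ^ 2 * ‖v‖ ^ 2) * ∫ x, ‖B (Φ x)‖ ^ 2 ∂ρ.fst := by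
    calc _ ≤ _ := integral_mono_ae hY2 hB2 hle
      _ = _ := by
        rw [integral_const_mul, integral_comp_fst (f := fun x => ‖B (Φ x)‖ ^ 2) (hBm.norm.pow 2)]
  rw [hYint]
  refine add_le_add (le_of_eq ?_) (by gcongr)
  congr 2
  simp only [map_sub, map_smul, smul_sub]
  abel

/-- The one-step bound for the distance to a comparison point. -/
theorem integral_norm_linStep_sub_sq_le (hg : IsRegression ρ Φ κ hΦ g) {s c : ℝ} (hs : 0 ≤ s)
    (hlam : 0 ≤ lam) (hc : 1 ≤ c * (1 - s * lam)) (hsκ : 2 * s * κ ^ 2 ≤ 1 - s * lam)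
    (ha : 0 < 1 - s * lam) (v v₀ : H) :
    ∫ z, ‖linStep Φ lam s v z - v₀‖ ^ 2 ∂ρ
      ≤ (1 - s * lam) * ‖v - v₀‖ ^ 2
        + s * (‖featureOp ρ.fst hΦ v₀ - g‖ ^ 2 + lam * ‖v₀‖ ^ 2)
        + 4 * c * κ ^ 2 * (1 + κ ^ 2 * ‖v₀‖ ^ 2) * s ^ 2 := by
  have hκ := hΦ.pos
  set a := 1 - s * lam with ha_def
  set S := featureOp ρ.fst hΦ
  have hc0 : 0 < c := by
    by_contra h
    nlinarith [mul_nonneg (sub_nonneg.2 (not_lt.1 h)) ha.le]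
  let p : X × ℝ → ℝ := fun z => inner ℝ (v - v₀) (Φ z.1)
  let e : X × ℝ → ℝ := fun z => inner ℝ v₀ (Φ z.1) - z.2
  have hpt : ∀ z, ‖linStep Φ lam s v z - v₀‖ ^ 2
      ≤ a * ‖v - v₀‖ ^ 2 + s * lam * ‖v₀‖ ^ 2 - s * p z ^ 2 - 2 * s * (e z * p z)
        + 2 * c * κ ^ 2 * s ^ 2 * e z ^ 2 := fun z => by
    have hpe : inner ℝ v (Φ z.1) - z.2 = p z + e z := by
      simp only [p, e, inner_sub_left]; ring
    have h1 : linStep Φ lam s v z - v₀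
        = (a • (v - v₀) - (s * (p z + e z)) • Φ z.1) - (s * lam) • v₀ := by
      simp only [linStep, hpe, ha_def]; module
    have h2 : ‖linStep Φ lam s v z - v₀‖ ^ 2
        = a ^ 2 * ‖v - v₀‖ ^ 2 - 2 * a * s * (p z + e z) * p z
          + s ^ 2 * (p z + e z) ^ 2 * ‖Φ z.1‖ ^ 2
          - 2 * (s * lam) * (a * inner ℝ (v - v₀) v₀ - s * (p z + e z) * inner ℝ (Φ z.1) v₀)
          + (s * lam) ^ 2 * ‖v₀‖ ^ 2 := by
      rw [h1, norm_sub_sq_real, norm_sub_sq_real, inner_sub_left]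
      simp only [inner_smul_left, inner_smul_right, norm_smul, mul_pow, Real.norm_eq_abs, sq_abs,
        conj_trivial]
      simp only [p]; ring
    -- With `X = a (v - v₀) - s (p + e) Φ`, the identity `a ‖X - (1-a) v₀‖² + (1-a) ‖X + a v₀‖² =
    -- ‖X‖² + a (1-a) ‖v₀‖²` holds; dropping this nonnegative second term gives `h6`.
    have h3 : 0 ≤ ‖a • ((v - v₀) + v₀) - (s * (p z + e z)) • Φ z.1‖ ^ 2 := sq_nonneg _
    have h4 : ‖a • ((v - v₀) + v₀) - (s * (p z + e z)) • Φ z.1‖ ^ 2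
        = a ^ 2 * (‖v - v₀‖ ^ 2 + 2 * inner ℝ (v - v₀) v₀ + ‖v₀‖ ^ 2)
          - 2 * a * (s * (p z + e z)) * (p z + inner ℝ (Φ z.1) v₀)
          + s ^ 2 * (p z + e z) ^ 2 * ‖Φ z.1‖ ^ 2 := by
      rw [norm_sub_sq_real, norm_smul, norm_smul, mul_pow, mul_pow, norm_add_sq_real]
      simp only [inner_smul_left, inner_smul_right, Real.norm_eq_abs, sq_abs, conj_trivial,
        inner_add_left]
      rw [real_inner_comm v₀ (Φ z.1)]
      simp only [p]; ring
    have h5 : ‖Φ z.1‖ ^ 2 ≤ κ ^ 2 := pow_le_pow_left₀ (norm_nonneg _) (hΦ.bound _) 2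
    have hsl : 0 ≤ s * lam := mul_nonneg hs hlam
    have h6 : a * ‖linStep Φ lam s v z - v₀‖ ^ 2
        ≤ a * (a * ‖v - v₀‖ ^ 2 - 2 * s * (p z + e z) * p z + s * lam * ‖v₀‖ ^ 2)
          + s ^ 2 * (p z + e z) ^ 2 * ‖Φ z.1‖ ^ 2 := by
      rw [h4] at h3
      rw [h2]
      have h7 := mul_nonneg hsl h3
      have h8 : s * lam = 1 - a := by rw [ha_def]; ring
      rw [h8] at h7 ⊢
      nlinarith
    have h7 : s ^ 2 * (p z + e z) ^ 2 * ‖Φ z.1‖ ^ 2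
        ≤ a * (s * p z ^ 2) + a * (2 * c * κ ^ 2 * s ^ 2 * e z ^ 2) := by
      calc s ^ 2 * (p z + e z) ^ 2 * ‖Φ z.1‖ ^ 2
          ≤ s ^ 2 * (2 * p z ^ 2 + 2 * e z ^ 2) * κ ^ 2 := by
            gcongr
            nlinarith [sq_nonneg (p z - e z)]
        _ = (2 * s * κ ^ 2) * (s * p z ^ 2) + 1 * (2 * κ ^ 2 * s ^ 2 * e z ^ 2) := by ring
        _ ≤ a * (s * p z ^ 2) + (c * a) * (2 * κ ^ 2 * s ^ 2 * e z ^ 2) := by gcongr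
        _ = _ := by ring
    refine le_of_mul_le_mul_left ?_ ha
    nlinarith
  have hpm : StronglyMeasurable p :=
    stronglyMeasurable_const.inner (hΦ.meas.comp_measurable measurable_fst)
  have hem : StronglyMeasurable e := stronglyMeasurable_residual hΦ v₀
  have ip2 : Integrable (fun z => p z ^ 2) ρ :=
    hg.integrable_of_bound (hpm.pow 2) (C := (κ * ‖v - v₀‖) ^ 2) fun z _ => by
      rw [norm_pow]; exact pow_le_pow_left₀ (norm_nonneg _) (hΦ.abs_inner_le _ _) 2
  have iep : Integrable (fun z => e z * p z) ρ :=
    hg.integrable_of_bound (hem.mul hpm) (C := (κ * ‖v₀‖ + 1) * (κ * ‖v - v₀‖)) fun z hz => by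
      rw [norm_mul]
      exact mul_le_mul (abs_residual_le hΦ v₀ hz) (hΦ.abs_inner_le _ _) (norm_nonneg _)
        (by positivity)
  have ie2 : Integrable (fun z => e z ^ 2) ρ :=
    hg.integrable_of_bound (hem.pow 2) (C := 2 * (1 + κ ^ 2 * ‖v₀‖ ^ 2)) fun z hz => by
      rw [Real.norm_of_nonneg (sq_nonneg _)]; exact residual_sq_le hΦ v₀ hz
  have hp2 : ∫ z, p z ^ 2 ∂ρ = ‖S (v - v₀)‖ ^ 2 := by
    rw [norm_featureOp_sq]
    exact integral_comp_fst (f := fun x => inner ℝ (v - v₀) (Φ x) ^ 2)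
      ((stronglyMeasurable_const.inner hΦ.meas).pow 2)
  have hep : ∫ z, e z * p z ∂ρ = inner ℝ (S v₀ - g) (S (v - v₀)) := integral_residual_mul hg _ _
  have he2 : ∫ z, e z ^ 2 ∂ρ ≤ 2 * (1 + κ ^ 2 * ‖v₀‖ ^ 2) :=
    integral_le_of_forall_le (by positivity) (hg.output.mono fun z hz => residual_sq_le hΦ v₀ hz)
  have i1 : Integrable (fun z => a * ‖v - v₀‖ ^ 2 + s * lam * ‖v₀‖ ^ 2 - s * p z ^ 2) ρ :=
    (integrable_const _).sub (ip2.const_mul s)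
  have i2 : Integrable (fun z => a * ‖v - v₀‖ ^ 2 + s * lam * ‖v₀‖ ^ 2 - s * p z ^ 2
      - 2 * s * (e z * p z)) ρ := i1.sub (iep.const_mul (2 * s))
  have i3 : Integrable (fun z => 2 * c * κ ^ 2 * s ^ 2 * e z ^ 2) ρ := ie2.const_mul _
  refine (integral_mono_of_nonneg (μ := ρ)
    (f := fun z => ‖linStep Φ lam s v z - v₀‖ ^ 2) (Filter.Eventually.of_forall fun z => sq_nonneg _)
    (i2.add i3) (Filter.Eventually.of_forall hpt)).trans ?_
  simp only [Pi.add_apply]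
  rw [integral_add i2 i3, integral_sub i1 (iep.const_mul (2 * s)),
    integral_sub (integrable_const _) (ip2.const_mul s),
    integral_const_mul, integral_const_mul, integral_const_mul, hp2, hep]
  simp only [integral_const, probReal_univ, one_smul]
  have hcs := neg_le_of_abs_le (abs_real_inner_le_norm (S v₀ - g) (S (v - v₀)))
  have h1 : 2 * c * κ ^ 2 * s ^ 2 * ∫ z, e z ^ 2 ∂ρ
      ≤ 2 * c * κ ^ 2 * s ^ 2 * (2 * (1 + κ ^ 2 * ‖v₀‖ ^ 2)) := by gcongr
  -- Completing the square: only the approximation error of the comparison point remains.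
  have h2 : - ‖S (v - v₀)‖ ^ 2 - 2 * inner ℝ (S v₀ - g) (S (v - v₀)) ≤ ‖S v₀ - g‖ ^ 2 := by
    nlinarith [sq_nonneg (‖S (v - v₀)‖ - ‖S v₀ - g‖)]
  have h3 := mul_le_mul_of_nonneg_left h2 hs
  linarith

end LinearSGD

/-! ### Expectations over the samples -/

section Expectation

/-- Conditioning on all samples but the last; every recursion over the training samples rests on it.
-/
theorem lintegral_pi_fin_succ {Z : Type*} [MeasurableSpace Z] (ρ : Measure Z)
    [IsProbabilityMeasure ρ] (T : ℕ) {F : (Fin T → Z) → Z → ℝ≥0∞}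
    (hF : Measurable (Function.uncurry F)) :
    ∫⁻ z, F (Fin.init z) (z (Fin.last T)) ∂(Measure.pi fun _ : Fin (T + 1) => ρ)
      = ∫⁻ z, ∫⁻ z', F z z' ∂ρ ∂(Measure.pi fun _ : Fin T => ρ) := by
  have h := measurePreserving_piFinSuccAbove (fun _ : Fin (T + 1) => ρ) (Fin.last T)
  have h1 : ∀ z : Fin (T + 1) → Z, F (Fin.init z) (z (Fin.last T))
      = (fun p : Z × (Fin T → Z) => F p.2 p.1)
        (MeasurableEquiv.piFinSuccAbove (fun _ : Fin (T + 1) => Z) (Fin.last T) z) := fun z => by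
    simp only [MeasurableEquiv.piFinSuccAbove_apply, Fin.insertNthEquiv_symm_apply]
    congr 1
    funext j
    simp [Fin.init, Fin.removeNth]
  simp only [h1]
  rw [h.lintegral_comp (f := fun p : Z × (Fin T → Z) => F p.2 p.1) (hF.comp measurable_swap)]
  exact lintegral_prod_symm' _ (hF.comp measurable_swap)

variable {X : Type*} [MeasurableSpace X]
  {H : Type*} [NormedAddCommGroup H] [InnerProductSpace ℝ H] [FiniteDimensional ℝ H]
  {Φ : X → H} {κ lam : ℝ} {s : ℕ → ℝ} {ρ : Measure (X × ℝ)} [IsProbabilityMeasure ρ]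
  {hΦ : IsFeature Φ κ} {g : Lp ℝ 2 ρ.fst}

theorem measurable_fin_init {Z : Type*} [MeasurableSpace Z] (T : ℕ) :
    Measurable (Fin.init : (Fin (T + 1) → Z) → Fin T → Z) :=
  measurable_pi_lambda _ fun _ => measurable_pi_apply _

theorem stronglyMeasurable_linStep_comp {Ω : Type*} [MeasurableSpace Ω] (hΦ : IsFeature Φ κ)
    (lam s : ℝ) {V : Ω → H} (hV : StronglyMeasurable V) {z : Ω → X × ℝ} (hz : Measurable z) :
    StronglyMeasurable fun ω => linStep Φ lam s (V ω) (z ω) := by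
  have h1 : StronglyMeasurable fun ω => Φ (z ω).1 :=
    hΦ.meas.comp_measurable (measurable_fst.comp hz)
  have h2 : StronglyMeasurable fun ω => (z ω).2 := (measurable_snd.comp hz).stronglyMeasurable
  exact (hV.const_smul _).sub
    ((((hV.inner h1).sub h2).const_mul s).smul h1)

theorem stronglyMeasurable_linSgd (hΦ : IsFeature Φ κ) (lam : ℝ) (s : ℕ → ℝ) (T : ℕ) :
    StronglyMeasurable (linSgd Φ lam s T) := by
  induction T with
  | zero => exact stronglyMeasurable_const
  | succ T ih =>
    exact stronglyMeasurable_linStep_comp hΦ lam (s T) (ih.comp_measurable (measurable_fin_init T))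
      (measurable_pi_apply _)

theorem integrable_norm_linStep_sq (hg : IsRegression ρ Φ κ hΦ g) {E : Type*}
    [NormedAddCommGroup E] [InnerProductSpace ℝ E] (B : H →L[ℝ] E) (q : E)
    (s : ℝ) (v : H) : Integrable (fun z => ‖B (linStep Φ lam s v z) - q‖ ^ 2) ρ := by
  have hκ := hΦ.pos
  have hm : StronglyMeasurable fun z : X × ℝ => linStep Φ lam s v z :=
    stronglyMeasurable_linStep_comp hΦ lam s stronglyMeasurable_const measurable_id
  refine hg.integrable_of_bound
    (((B.continuous.comp_stronglyMeasurable hm).sub stronglyMeasurable_const).norm.pow 2)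
    (C := (‖B‖ * (|1 - s * lam| * ‖v‖ + |s| * (κ * ‖v‖ + 1) * κ) + ‖q‖) ^ 2) fun z hz => ?_
  rw [Real.norm_of_nonneg (sq_nonneg _)]
  refine pow_le_pow_left₀ (norm_nonneg _) ((norm_sub_le _ _).trans ?_) 2
  gcongr
  refine (B.le_opNorm _).trans ?_
  gcongr
  refine (norm_sub_le _ _).trans ?_
  rw [norm_smul, norm_smul, Real.norm_eq_abs, Real.norm_eq_abs, abs_mul]
  gcongr
  · exact abs_residual_le hΦ v hz
  · exact hΦ.bound _

theorem lintegral_norm_linStep_sq_eq (hg : IsRegression ρ Φ κ hΦ g) {E : Type*}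
    [NormedAddCommGroup E] [InnerProductSpace ℝ E] (B : H →L[ℝ] E) (q : E)
    (s : ℝ) (v : H) :
    ∫⁻ z, ENNReal.ofReal (‖B (linStep Φ lam s v z) - q‖ ^ 2) ∂ρ
      = ENNReal.ofReal (∫ z, ‖B (linStep Φ lam s v z) - q‖ ^ 2 ∂ρ) :=
  (ofReal_integral_eq_lintegral_ofReal (integrable_norm_linStep_sq hg B q s v)
    (Filter.Eventually.of_forall fun _ => sq_nonneg _)).symm

theorem lintegral_linSgd_succ (hg : IsRegression ρ Φ κ hΦ g) {E : Type*}
    [NormedAddCommGroup E] [InnerProductSpace ℝ E] (B : H →L[ℝ] E) (q : E) (T : ℕ) :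
    ∫⁻ z, ENNReal.ofReal (‖B (linSgd Φ lam s (T + 1) z) - q‖ ^ 2)
        ∂(Measure.pi fun _ : Fin (T + 1) => ρ)
      = ∫⁻ z, ENNReal.ofReal (∫ z', ‖B (linStep Φ lam (s T) (linSgd Φ lam s T z) z') - q‖ ^ 2 ∂ρ)
        ∂(Measure.pi fun _ : Fin T => ρ) := by
  have hm : StronglyMeasurable fun p : (Fin T → X × ℝ) × (X × ℝ) =>
      linStep Φ lam (s T) (linSgd Φ lam s T p.1) p.2 :=
    stronglyMeasurable_linStep_comp hΦ lam (s T)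
      ((stronglyMeasurable_linSgd hΦ lam s T).comp_measurable measurable_fst) measurable_snd
  have hm2 : Measurable fun p : (Fin T → X × ℝ) × (X × ℝ) =>
      ENNReal.ofReal (‖B (linStep Φ lam (s T) (linSgd Φ lam s T p.1) p.2) - q‖ ^ 2) :=
    (((B.continuous.comp_stronglyMeasurable hm).sub
      (stronglyMeasurable_const (b := q))).norm.pow 2).measurable.ennreal_ofReal
  have h := lintegral_pi_fin_succ ρ T (F := fun z z' =>
    ENNReal.ofReal (‖B (linStep Φ lam (s T) (linSgd Φ lam s T z) z') - q‖ ^ 2)) hm2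
  simp only [lintegral_norm_linStep_sq_eq hg] at h
  exact h

/-- The second moment of the iterates of stochastic gradient descent. -/
theorem lintegral_norm_linSgd_sub_sq_le (hg : IsRegression ρ Φ κ hΦ g) {c : ℝ}
    (hs : ∀ i, 0 ≤ s i) (hlam : 0 < lam) (hc : ∀ i, 1 ≤ c * (1 - s i * lam))
    (hsκ : ∀ i, 2 * s i * κ ^ 2 ≤ 1 - s i * lam) (ha : ∀ i, 0 < 1 - s i * lam) (v₀ : H) (T : ℕ) :
    ∫⁻ z, ENNReal.ofReal (‖linSgd Φ lam s T z - v₀‖ ^ 2) ∂(Measure.pi fun _ : Fin T => ρ)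
      ≤ ENNReal.ofReal (‖v₀‖ ^ 2 + ‖featureOp ρ.fst hΦ v₀ - g‖ ^ 2 / lam
        + 4 * c * κ ^ 2 * (1 + κ ^ 2 * ‖v₀‖ ^ 2) * ∑ i ∈ Finset.range T, s i ^ 2) := by
  have hc0 : 0 ≤ c := by
    by_contra h
    nlinarith [mul_neg_of_neg_of_pos (not_le.1 h) (ha 0), hc 0]
  set R := ‖featureOp ρ.fst hΦ v₀ - g‖ ^ 2
  set D := 4 * c * κ ^ 2 * (1 + κ ^ 2 * ‖v₀‖ ^ 2)
  have hD : 0 ≤ D := by positivity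
  have hR : 0 ≤ R := sq_nonneg _
  induction T with
  | zero =>
    simp only [linSgd, zero_sub, norm_neg, Finset.range_zero, Finset.sum_empty, mul_zero, add_zero,
      lintegral_const, measure_univ, mul_one]
    exact ENNReal.ofReal_le_ofReal (by have : 0 ≤ R / lam := by positivity
                                       linarith)
  | succ T ih =>
    have h1 := lintegral_linSgd_succ (lam := lam) (s := s) hg (ContinuousLinearMap.id ℝ H) v₀ T
    simp only [ContinuousLinearMap.id_apply] at h1
    rw [h1]
    set e := s T * (R + lam * ‖v₀‖ ^ 2) + D * s T ^ 2
    have he : 0 ≤ e := by have := hs T; positivity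
    calc _ ≤ ∫⁻ z, (ENNReal.ofReal (1 - s T * lam)
            * ENNReal.ofReal (‖linSgd Φ lam s T z - v₀‖ ^ 2) + ENNReal.ofReal e)
            ∂(Measure.pi fun _ : Fin T => ρ) := by
          refine lintegral_mono fun z => ?_
          rw [← ENNReal.ofReal_mul (ha T).le, ← ENNReal.ofReal_add
            (mul_nonneg (ha T).le (sq_nonneg _)) he]
          refine ENNReal.ofReal_le_ofReal ?_
          have := integral_norm_linStep_sub_sq_le hg (hs T) hlam.le (hc T) (hsκ T) (ha T)
            (linSgd Φ lam s T z) v₀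
          simp only [e]; linarith
      _ ≤ ENNReal.ofReal (1 - s T * lam) * ENNReal.ofReal (‖v₀‖ ^ 2 + R / lam
            + D * ∑ i ∈ Finset.range T, s i ^ 2) + ENNReal.ofReal e := by
          rw [lintegral_add_right _ measurable_const, lintegral_const_mul' _ _ ENNReal.ofReal_ne_top]
          simp only [lintegral_const, measure_univ, mul_one]
          gcongr
      _ ≤ _ := by
          have hS : 0 ≤ ∑ i ∈ Finset.range T, s i ^ 2 := Finset.sum_nonneg fun _ _ => sq_nonneg _
          rw [← ENNReal.ofReal_mul (ha T).le, ← ENNReal.ofReal_add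
            (mul_nonneg (ha T).le (by positivity)) he]
          refine ENNReal.ofReal_le_ofReal ?_
          rw [Finset.sum_range_succ]
          simp only [e]
          -- `‖v₀‖² + R / lam` is the fixed point of `m ↦ (1 - s lam) m + s (R + lam ‖v₀‖²)`, so
          -- only the `D s²` terms accumulate.
          have h2 : s T * lam * (R / lam) = s T * R := by field_simp
          have h3 : 0 ≤ s T * lam * (D * ∑ i ∈ Finset.range T, s i ^ 2) := by
            have := hs T; positivity
          nlinarith

/-- The bias–variance bound for stochastic gradient descent in a linear model. -/
theorem lintegral_linSgd_sq_le (hg : IsRegression ρ Φ κ hΦ g) {K : ℝ} (hK : 0 ≤ K)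
    (T : ℕ) (hmom : ∀ t < T, ∫⁻ z, ENNReal.ofReal (2 * (1 + κ ^ 2 * ‖linSgd Φ lam s t z‖ ^ 2))
      ∂(Measure.pi fun _ : Fin t => ρ) ≤ ENNReal.ofReal K)
    (P : Lp ℝ 2 ρ.fst →L[ℝ] Lp ℝ 2 ρ.fst) (q : Lp ℝ 2 ρ.fst) :
    ∫⁻ z, ENNReal.ofReal (‖P (featureOp ρ.fst hΦ (linSgd Φ lam s T z)) - q‖ ^ 2)
        ∂(Measure.pi fun _ : Fin T => ρ)
      ≤ ENNReal.ofReal (‖P (ridgePath (featureCov ρ.fst hΦ) lam s g T) - q‖ ^ 2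
        + ∑ t ∈ Finset.range T, s t ^ 2 * (K * ∫ x, ‖P (ridgeProd (featureCov ρ.fst hΦ) lam s (t + 1)
            (T - 1 - t) (featureOp ρ.fst hΦ (Φ x)))‖ ^ 2 ∂ρ.fst)) := by
  set S := featureOp ρ.fst hΦ with hS
  set A := featureCov ρ.fst hΦ with hA
  induction T generalizing P q with
  | zero => simp [linSgd, ridgePath]
  | succ T ih =>
    have hv : ∀ Q : Lp ℝ 2 ρ.fst →L[ℝ] Lp ℝ 2 ρ.fst, 0 ≤ ∫ x, ‖Q (S (Φ x))‖ ^ 2 ∂ρ.fst :=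
      fun Q => integral_nonneg fun _ => sq_nonneg _
    have h1 := lintegral_linSgd_succ (lam := lam) (s := s) hg (P.comp S) q T
    simp only [ContinuousLinearMap.comp_apply] at h1
    rw [h1]
    -- The mean of the last step is absorbed into a new test operator and a new target. The
    -- induction therefore runs over arbitrary `P` and `q`, and each step leaves behind only its own
    -- variance.
    set P' := P.comp (ridgeStep A lam (s T)) with hP'
    set q' := q - s T • P (A g) with hq'
    set v := ∫ x, ‖P (S (Φ x))‖ ^ 2 ∂ρ.fst with hvdef
    have hv0 : 0 ≤ v := integral_nonneg fun _ => sq_nonneg _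
    have hstep : ∀ w, ∫ z', ‖P (S (linStep Φ lam (s T) w z')) - q‖ ^ 2 ∂ρ
        ≤ ‖P' (S w) - q'‖ ^ 2 + s T ^ 2 * v * (2 * (1 + κ ^ 2 * ‖w‖ ^ 2)) := fun w => by
      have h2 := integral_norm_linStep_sq_le (lam := lam) hg (P.comp S) q (s T) w
      simp only [ContinuousLinearMap.comp_apply] at h2
      refine h2.trans (add_le_add (le_of_eq ?_) (le_of_eq (by ring)))
      congr 2
      simp only [hP', hq', ContinuousLinearMap.comp_apply, ridgeStep_apply, map_sub, map_smul,
        hA, featureCov_apply, smul_sub]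
      abel
    have hsucc : ∀ t ∈ Finset.range T, s t ^ 2 * (K * ∫ x, ‖P' (ridgeProd A lam s (t + 1)
          (T - 1 - t) (S (Φ x)))‖ ^ 2 ∂ρ.fst)
        = s t ^ 2 * (K * ∫ x, ‖P (ridgeProd A lam s (t + 1)
          (T + 1 - 1 - t) (S (Φ x)))‖ ^ 2 ∂ρ.fst) := fun t ht => by
      have ht := Finset.mem_range.1 ht
      have h3 : T + 1 - 1 - t = (T - 1 - t) + 1 := by omega
      have h4 : t + 1 + (T - 1 - t) = T := by omega
      rw [h3]
      simp only [ridgeProd, h4, hP', ContinuousLinearMap.comp_apply]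
    calc _ ≤ ∫⁻ z, (ENNReal.ofReal (‖P' (S (linSgd Φ lam s T z)) - q'‖ ^ 2)
            + ENNReal.ofReal (s T ^ 2 * v)
              * ENNReal.ofReal (2 * (1 + κ ^ 2 * ‖linSgd Φ lam s T z‖ ^ 2)))
            ∂(Measure.pi fun _ : Fin T => ρ) := by
          refine lintegral_mono fun z => ?_
          rw [← ENNReal.ofReal_mul (by positivity), ← ENNReal.ofReal_add (sq_nonneg _)
            (by positivity)]
          exact ENNReal.ofReal_le_ofReal (hstep _)
      _ ≤ ENNReal.ofReal (‖P' (ridgePath A lam s g T) - q'‖ ^ 2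
            + ∑ t ∈ Finset.range T, s t ^ 2 * (K * ∫ x, ‖P' (ridgeProd A lam s (t + 1)
            (T - 1 - t) (S (Φ x)))‖ ^ 2 ∂ρ.fst))
          + ENNReal.ofReal (s T ^ 2 * v) * ENNReal.ofReal K := by
          have hm := stronglyMeasurable_linSgd hΦ lam s T
          have hm2 : Measurable fun z => ENNReal.ofReal (‖P' (S (linSgd Φ lam s T z)) - q'‖ ^ 2) :=
            ((((P'.comp S).continuous.comp_stronglyMeasurable hm).sub
              stronglyMeasurable_const).norm.pow 2).measurable.ennreal_ofReal
          rw [lintegral_add_left hm2, lintegral_const_mul' _ _ ENNReal.ofReal_ne_top]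
          gcongr
          · exact ih (fun t ht => hmom t (by omega)) P' q'
          · exact hmom T (by omega)
      _ = _ := by
          rw [Finset.sum_congr rfl hsucc, ← ENNReal.ofReal_mul (by positivity),
            ← ENNReal.ofReal_add]
          · rw [Finset.sum_range_succ]
            have h5 : T + 1 - 1 - T = 0 := by omega
            simp only [h5, ridgeProd, ContinuousLinearMap.id_apply, ← hvdef]
            have h6 : P' (ridgePath A lam s g T) - q' = P (ridgePath A lam s g (T + 1)) - q := by
              simp only [hP', hq', ridgePath, ContinuousLinearMap.comp_apply, map_add, map_smul]
              abel
            rw [h6]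
            congr 1
            ring
          · refine add_nonneg (sq_nonneg _) (Finset.sum_nonneg fun t _ => ?_)
            have := hv (P.comp (ridgeProd A lam s (t + 1) (T + 1 - 1 - t)))
            simp only [ContinuousLinearMap.comp_apply] at this
            positivity
          · positivity

end Expectation

/-! ### The risk of linear stochastic gradient descent -/

section RidgeProd

variable {E : Type*} [NormedAddCommGroup E] [InnerProductSpace ℝ E] {A : E →L[ℝ] E} {K : ℝ}

theorem ridgeProd_ridgeStep_comm (A : E →L[ℝ] E) (lam : ℝ) (s : ℕ → ℝ) (t k : ℕ) (e : ℝ) (x : E) :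
    ridgeStep A lam e (ridgeProd A lam s t k x) = ridgeProd A lam s t k (ridgeStep A lam e x) := by
  simp only [ridgeStep_apply, map_sub, map_smul, ridgeProd_comm]

theorem ridgeProd_symm (hA : IsPosBounded A K) (lam : ℝ) (s : ℕ → ℝ) (t k : ℕ) (x y : E) :
    inner ℝ (ridgeProd A lam s t k x) y = inner ℝ x (ridgeProd A lam s t k y) := by
  induction k generalizing x y with
  | zero => simp [ridgeProd]
  | succ k ih =>
    have h : ∀ e x y, inner ℝ (ridgeStep A lam e x) y = inner ℝ x (ridgeStep A lam e y) := by
      intro e x y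
      simp [ridgeStep_apply, inner_sub_left, inner_sub_right, inner_smul_left, inner_smul_right,
        hA.symm]
    simp only [ridgeProd, ContinuousLinearMap.comp_apply]
    rw [h, ih, ridgeProd_ridgeStep_comm]

end RidgeProd

section Risk

variable {X : Type*} [MeasurableSpace X]
  {H : Type*} [NormedAddCommGroup H] [InnerProductSpace ℝ H] [FiniteDimensional ℝ H]
  {ν : Measure X} [IsProbabilityMeasure ν] {Φ : X → H} {κ : ℝ} {k : X → X → ℝ} {b : ℝ}

/-- Invariance of the range of `S` under the steps keeps the trace in
`integral_norm_comp_feature_sq_le` inside a finite-dimensional space. -/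
theorem ridgeProd_featureOp_mem (hΦ : IsFeature Φ κ) (lam : ℝ) (s : ℕ → ℝ) (t k : ℕ) (v : H) :
    ∃ w, ridgeProd (featureCov ν hΦ) lam s t k (featureOp ν hΦ v) = featureOp ν hΦ w := by
  induction k with
  | zero => exact ⟨v, rfl⟩
  | succ k ih =>
    obtain ⟨w, hw⟩ := ih
    refine ⟨(1 - s (t + k) * lam) • w - s (t + k) • ContinuousLinearMap.adjoint (featureOp ν hΦ)
      (featureOp ν hΦ w), ?_⟩
    simp only [ridgeProd, ContinuousLinearMap.comp_apply, hw, ridgeStep_apply, map_sub, map_smul,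
      featureCov_apply]

/-- The eigensystem, the decay of the eigenvalues and the source condition `G = L^r h`. -/
structure IsSource (ν : Measure X) [IsProbabilityMeasure ν] (hk : IsBddKernel k b) (μ : ℕ → ℝ)
    (φ : ℕ → Lp ℝ 2 ν) (r β c : ℝ) (G h : Lp ℝ 2 ν) : Prop where
  diag : IsDiagonalized (kernelOp ν hk) μ φ
  pos : ∀ i, 0 < μ i
  decay : ∀ i : ℕ, μ i ≤ c * ((i : ℝ) + 1) ^ (-β)
  one_lt : 1 < β
  half_lt : 1 / 2 < r
  le_one : r ≤ 1
  source : HasSum (fun i => (μ i ^ r * inner ℝ (φ i) h) • φ i) G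

variable {hk : IsBddKernel k b} {μ : ℕ → ℝ} {φ : ℕ → Lp ℝ 2 ν} {r β c : ℝ} {G h : Lp ℝ 2 ν}

theorem IsSource.const_pos (hS : IsSource ν hk μ φ r β c G h) : 0 < c := by
  have h1 := hS.decay 0
  have h2 := hS.pos 0
  simp only [Nat.cast_zero, zero_add, Real.one_rpow, mul_one] at h1
  linarith

theorem IsSource.le_const (hS : IsSource ν hk μ φ r β c G h) (i : ℕ) : μ i ≤ c := by
  refine (hS.decay i).trans ?_
  have : ((i : ℝ) + 1) ^ (-β) ≤ 1 :=
    Real.rpow_le_one_of_one_le_of_nonpos (by linarith [(Nat.cast_nonneg i : (0:ℝ) ≤ i)])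
      (by linarith [hS.one_lt])
  nlinarith [hS.const_pos]

theorem IsSource.exists_truncation (hS : IsSource ν hk μ φ r β c G h) {τ : ℝ} (hτ : 0 < τ) :
    ∃ u : Lp ℝ 2 ν, ‖u‖ ≤ τ ^ (r - 1) * ‖h‖ ∧ ‖G - kernelOp ν hk u‖ ≤ τ ^ r * ‖h‖ ∧
      inner ℝ (kernelOp ν hk u) u ≤ c ^ (2 * r - 1) * ‖h‖ ^ 2 := by
  have hlim : Filter.Tendsto (fun i : ℕ => c * ((i : ℝ) + 1) ^ (-β)) Filter.atTop (nhds (c * 0)) := by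
    refine Filter.Tendsto.const_mul c ?_
    exact (tendsto_rpow_neg_atTop (by linarith [hS.one_lt])).comp
      (Filter.tendsto_atTop_add_const_right _ 1 tendsto_natCast_atTop_atTop)
  rw [mul_zero] at hlim
  obtain ⟨N, hN⟩ := Filter.eventually_atTop.1 (hlim.eventually_le_const hτ)
  exact hS.diag.exists_truncation hS.pos hS.le_const hS.half_lt hS.le_one hS.source hτ
    (N := N) fun i hi => (hS.decay i).trans (hN i hi)

/-- The trace of the squared covariance operator after gradient steps of total length `S`. -/
theorem IsSource.exists_trace_bound (hS : IsSource ν hk μ φ r β c G h) (κ : ℝ) :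
    ∃ C : ℝ, 1 ≤ C ∧ ∀ (H : Type) [NormedAddCommGroup H] [InnerProductSpace ℝ H]
      [FiniteDimensional ℝ H] (Φ : X → H) (hΦ : IsFeature Φ κ) (lam : ℝ) (s : ℕ → ℝ), 0 ≤ lam →
      (∀ i, 0 ≤ s i) → (∀ i, s i * (lam + κ ^ 2) ≤ 1) → ∀ t n : ℕ,
      ∫ x, ‖ridgeProd (featureCov ν hΦ) lam s t n (featureOp ν hΦ (Φ x))‖ ^ 2 ∂ν
        ≤ C * (kernelSq ν (fun x x' => inner ℝ (Φ x) (Φ x') - k x x')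
          + (1 + ∑ i ∈ Finset.range n, s (t + i)) ^ (-(2 - 1 / β))) := by
  have hβ := hS.one_lt
  have hc := hS.const_pos
  have hβ2 : 0 < 2 * β - 1 := by linarith
  refine ⟨2 + 2 * (2 * (κ ^ 2) ^ 2 + 4) + 2 * (c ^ 2 / (2 * β - 1)), ?_, ?_⟩
  · have : 0 ≤ 2 * (c ^ 2 / (2 * β - 1)) := by positivity
    nlinarith [sq_nonneg (κ ^ 2)]
  -- The constant is fixed before the feature space, whose dimension grows with the width of the
  -- network.
  intro H _ _ _ Φ hΦ lam s hlam hs hsK t n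
  set S := ∑ i ∈ Finset.range n, s (t + i)
  have hS0 : 0 ≤ S := Finset.sum_nonneg fun i _ => hs _
  have hA := isPosBounded_featureCov (ν := ν) hΦ
  -- The cutoff `⌈y⌉₊` balances `n (1 + S)^{-2}` from the leading eigenvectors against the tail
  -- `n^{1 - 2β}`; both are of order `(1 + S)^{-(2 - 1/β)}`.
  set y := (1 + S) ^ (1 / β) with hy
  have hy1 : 1 ≤ y := Real.one_le_rpow (by linarith) (by positivity)
  have hn1 : y ≤ ⌈y⌉₊ := Nat.le_ceil y
  have hn2 : (⌈y⌉₊ : ℝ) ≤ 2 * y := by have := Nat.ceil_lt_add_one (by linarith : 0 ≤ y); linarith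
  have hn0 : 0 < ⌈y⌉₊ := Nat.ceil_pos.2 (by linarith)
  have hp1 : y * ((1 + S) ^ 2)⁻¹ = (1 + S) ^ (-(2 - 1 / β)) := by
    rw [hy, ← Real.rpow_natCast (1 + S) 2, ← Real.rpow_neg (by positivity),
      ← Real.rpow_add (by positivity)]
    congr 1; push_cast; ring
  have hp2 : (⌈y⌉₊ : ℝ) ^ (1 - 2 * β) ≤ (1 + S) ^ (-(2 - 1 / β)) := by
    calc (⌈y⌉₊ : ℝ) ^ (1 - 2 * β) ≤ y ^ (1 - 2 * β) :=
          Real.rpow_le_rpow_of_nonpos (by linarith) hn1 (by linarith)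
      _ = _ := by
          rw [hy, ← Real.rpow_mul (by positivity)]
          congr 1; field_simp; ring
  have htail : ∀ N, ∑ i ∈ Finset.Ico ⌈y⌉₊ N, μ i ^ 2
      ≤ c ^ 2 / (2 * β - 1) * (1 + S) ^ (-(2 - 1 / β)) := fun N => by
    calc ∑ i ∈ Finset.Ico ⌈y⌉₊ N, μ i ^ 2
        ≤ ∑ i ∈ Finset.Ico ⌈y⌉₊ N, c ^ 2 * ((i : ℝ) + 1) ^ (-(2 * β)) := by
          refine Finset.sum_le_sum fun i _ => ?_
          refine (pow_le_pow_left₀ (hS.pos i).le (hS.decay i) 2).trans (le_of_eq ?_)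
          rw [mul_pow, ← Real.rpow_natCast (((i : ℝ) + 1) ^ (-β)), ← Real.rpow_mul (by positivity)]
          congr 2; push_cast; ring
      _ = c ^ 2 * ∑ i ∈ Finset.Ico ⌈y⌉₊ N, ((i : ℝ) + 1) ^ (-(2 * β)) := by rw [Finset.mul_sum]
      _ ≤ c ^ 2 * ((⌈y⌉₊ : ℝ) ^ (1 - 2 * β) / (2 * β - 1)) := by
          gcongr; exact sum_Ico_rpow_neg_le (by linarith) hn0 N
      _ ≤ c ^ 2 * ((1 + S) ^ (-(2 - 1 / β)) / (2 * β - 1)) := by gcongr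
      _ = _ := by ring
  -- `(1 + S)² ≤ 2 + 2 S²` combines the plain bound `κ²`, useful for small `S`, with the smoothing
  -- bound.
  have hPq : ∀ f, ‖ridgeProd (featureCov ν hΦ) lam s t n (featureCov ν hΦ f)‖ ^ 2
      ≤ (2 * (κ ^ 2) ^ 2 + 4) * ((1 + S) ^ 2)⁻¹ * ‖f‖ ^ 2 := fun f => by
    have h1 := norm_comp_ridgeProd_sq_le hA hlam hs hsK t n f
    have h2 := norm_ridgeProd_le hA hlam hs hsK t n (featureCov ν hΦ f)
    have h3 := pow_le_pow_left₀ (norm_nonneg _) (h2.trans (hA.norm_le f)) 2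
    rw [ridgeProd_comm] at h1
    rw [mul_assoc, inv_mul_eq_div, ← mul_div_assoc, le_div_iff₀ (by positivity)]
    nlinarith [mul_nonneg (sq_nonneg (1 - S))
      (sq_nonneg ‖ridgeProd (featureCov ν hΦ) lam s t n (featureCov ν hΦ f)‖)]
  have key := integral_norm_comp_feature_sq_le hΦ hk hS.diag
    (ridgeProd_symm hA lam s t n) (ridgeProd_comm _ lam s t n) (ridgeProd_featureOp_mem hΦ lam s t n)
    (norm_ridgeProd_le hA hlam hs hsK t n) hPq htail
  refine key.trans ?_
  set ε := kernelSq ν (fun x x' => inner ℝ (Φ x) (Φ x') - k x x')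
  have hε : 0 ≤ ε := kernelSq_nonneg _
  set w := (1 + S) ^ (-(2 - 1 / β))
  have hw : 0 ≤ w := by positivity
  have h1 : (⌈y⌉₊ : ℝ) * ((2 * (κ ^ 2) ^ 2 + 4) * ((1 + S) ^ 2)⁻¹)
      ≤ 2 * (2 * (κ ^ 2) ^ 2 + 4) * w := by
    calc _ ≤ (2 * y) * ((2 * (κ ^ 2) ^ 2 + 4) * ((1 + S) ^ 2)⁻¹) := by gcongr
      _ = 2 * (2 * (κ ^ 2) ^ 2 + 4) * (y * ((1 + S) ^ 2)⁻¹) := by ring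
      _ = _ := by rw [hp1]
  have h2 : 0 ≤ 2 * (2 * (κ ^ 2) ^ 2 + 4) * ε := by positivity
  have h3 : 0 ≤ 2 * (c ^ 2 / (2 * β - 1)) * ε := by positivity
  linarith

theorem integral_ridgeProd_le_exp (hΦ : IsFeature Φ κ) {lam : ℝ} {s : ℕ → ℝ}
    (hs : ∀ i, 0 ≤ s i) (hsK : ∀ i, s i * (lam + κ ^ 2) ≤ 1) (t n : ℕ) :
    ∫ x, ‖ridgeProd (featureCov ν hΦ) lam s t n (featureOp ν hΦ (Φ x))‖ ^ 2 ∂ν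
      ≤ (κ ^ 2) ^ 2 * Real.exp (-(2 * lam * ∑ i ∈ Finset.range n, s (t + i))) := by
  have hκ := hΦ.pos
  refine integral_le_of_forall_le (by positivity) (Filter.Eventually.of_forall fun x => ?_)
  have h1 := norm_ridgeProd_le_exp (isPosBounded_featureCov (ν := ν) hΦ) hs hsK t n
    (featureOp ν hΦ (Φ x))
  have h2 : ‖featureOp ν hΦ (Φ x)‖ ≤ κ ^ 2 := by
    calc _ ≤ κ * ‖Φ x‖ := norm_featureOp_le hΦ _
      _ ≤ κ * κ := by gcongr; exact hΦ.bound x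
      _ = _ := by ring
  calc _ ≤ (Real.exp (-(lam * ∑ i ∈ Finset.range n, s (t + i))) * κ ^ 2) ^ 2 :=
        pow_le_pow_left₀ (norm_nonneg _) (h1.trans (by gcongr)) 2
    _ = _ := by
        rw [mul_pow, ← Real.exp_nat_mul]
        push_cast
        rw [mul_comm]
        congr 2; ring

/-- The assumptions on a random-feature model, with a deviation of the kernel of size `ℓ`. -/
structure IsFeatureModel (ρ : Measure (X × ℝ)) [IsProbabilityMeasure ρ] (k : X → X → ℝ)
    (η θ κ c₀ Kd : ℝ) (Φ : X → H) (hΦ : IsFeature Φ κ) (G : Lp ℝ 2 ρ.fst) (lam : ℝ) (T : ℕ)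
    (ℓ : ℝ) : Prop where
  reg : IsRegression ρ Φ κ hΦ G
  lam_pos : 0 < lam
  T_pos : 0 < T
  log_ge : 1 / 2 ≤ ℓ
  step_one : 1 ≤ c₀ * (1 - η * lam)
  step_two : 2 * η * κ ^ 2 ≤ 1 - η * lam
  dev : kernelSq ρ.fst (fun x x' => inner ℝ (Φ x) (Φ x') - k x x') ≤ Kd * ℓ * (T : ℝ) ^ (-θ)
  dev_lam : kernelSq ρ.fst (fun x x' => inner ℝ (Φ x) (Φ x') - k x x')
    ≤ Kd * ℓ * (T : ℝ) ^ (-θ) * lam ^ 2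

end Risk

/-! ### Bias of gradient descent under the source condition -/

section Model

variable {X : Type*} [MeasurableSpace X] {ρ : Measure (X × ℝ)} [IsProbabilityMeasure ρ]
  {k : X → X → ℝ} {b : ℝ} {hk : IsBddKernel k b} {μ : ℕ → ℝ} {φ : ℕ → Lp ℝ 2 ρ.fst} {r β c : ℝ}
  {G h : Lp ℝ 2 ρ.fst} {η θ κ c₀ Kd : ℝ}
  {H : Type*} [NormedAddCommGroup H] [InnerProductSpace ℝ H] [FiniteDimensional ℝ H] {Φ : X → H}
  {hΦ : IsFeature Φ κ} {lam : ℝ} {T : ℕ} {ℓ : ℝ}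

theorem IsFeatureModel.lam_le (hM : IsFeatureModel ρ k η θ κ c₀ Kd Φ hΦ G lam T ℓ) (hη : 0 < η) :
    lam ≤ 1 / η := by
  have h := hM.step_two
  have : 0 ≤ 2 * η * κ ^ 2 := by positivity
  rw [le_div_iff₀ hη]; linarith

theorem IsFeatureModel.const_pos (hM : IsFeatureModel ρ k η θ κ c₀ Kd Φ hΦ G lam T ℓ)
    (hη : 0 < η) : 0 < c₀ := by
  have h := hM.step_two
  have hκ := hΦ.pos
  have : 0 < 2 * η * κ ^ 2 := by positivity
  by_contra h'
  nlinarith [mul_nonneg (sub_nonneg.2 (not_lt.1 h')) (by linarith : 0 ≤ 1 - η * lam), hM.step_one]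

theorem IsFeatureModel.step (hM : IsFeatureModel ρ k η θ κ c₀ Kd Φ hΦ G lam T ℓ)
    (hη : 0 < η) (hθ : 0 < θ) (i : ℕ) :
    1 ≤ c₀ * (1 - stepSize η θ i * lam) ∧ 2 * stepSize η θ i * κ ^ 2 ≤ 1 - stepSize η θ i * lam ∧
      0 < 1 - stepSize η θ i * lam ∧ stepSize η θ i * (lam + κ ^ 2) ≤ 1 := by
  have h1 := stepSize_le hη hθ i
  have h0 := stepSize_pos hη θ i
  have hl := hM.lam_pos
  have hc := hM.const_pos hη
  have hκ := hΦ.pos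
  have h2 : stepSize η θ i * lam ≤ η * lam := by gcongr
  have h3 : 2 * stepSize η θ i * κ ^ 2 ≤ 2 * η * κ ^ 2 := by gcongr
  have h4 := hM.step_two
  have h5 : 0 < 2 * η * κ ^ 2 := by positivity
  have h6 : 0 < stepSize η θ i * κ ^ 2 := by positivity
  refine ⟨hM.step_one.trans (by gcongr), by linarith, by linarith, by nlinarith⟩

theorem IsFeatureModel.sqrt_dev (hM : IsFeatureModel ρ k η θ κ c₀ Kd Φ hΦ G lam T ℓ)
    (hK : 0 ≤ Kd) :
    Real.sqrt (kernelSq ρ.fst (fun x x' => inner ℝ (Φ x) (Φ x') - k x x'))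
      ≤ Real.sqrt (Kd * ℓ * (T : ℝ) ^ (-θ)) * lam := by
  have hl := hM.lam_pos
  have hlog := hM.log_ge
  rw [← Real.sqrt_sq hl.le, ← Real.sqrt_mul (by positivity)]
  exact Real.sqrt_le_sqrt hM.dev_lam

theorem norm_sub_featureCov_le (hk : IsBddKernel k b) (hΦ : IsFeature Φ κ) (G u : Lp ℝ 2 ρ.fst) :
    ‖G - featureCov ρ.fst hΦ u‖ ≤ ‖G - kernelOp ρ.fst hk u‖
      + Real.sqrt (kernelSq ρ.fst (fun x x' => inner ℝ (Φ x) (Φ x') - k x x')) * ‖u‖ := by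
  have h1 := norm_kernelOp_le (hΦ.isBddKernel.sub hk) u
  rw [← featureCov_sub_kernelOp hΦ hk] at h1
  have h2 : G - featureCov ρ.fst hΦ u
      = (G - kernelOp ρ.fst hk u) - (featureCov ρ.fst hΦ u - kernelOp ρ.fst hk u) := by abel
  rw [h2]
  exact (norm_sub_le _ _).trans (by gcongr)

/-- The bias of gradient descent under the source condition. -/
theorem IsSource.bias_le (hS : IsSource ρ.fst hk μ φ r β c G h)
    (hM : IsFeatureModel ρ k η θ κ c₀ Kd Φ hΦ G lam T ℓ) (hη : 0 < η) (hθ : 0 < θ)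
    (hK : 0 ≤ Kd) :
    ‖ridgePath (featureCov ρ.fst hΦ) lam (stepSize η θ) G T - G‖ ^ 2
      ≤ (100 * (1 + η ^ (-(2 * r))) + 2 * Kd) * ‖h‖ ^ 2
        * (((T : ℝ) ^ (-(2 * r * (1 - θ))) + (T : ℝ) ^ (-θ) + lam ^ (2 * r)) * ℓ) := by
  have hr := hS.half_lt
  have hr1 := hS.le_one
  have hl := hM.lam_pos
  have hlog := hM.log_ge
  have hT1 : (1 : ℝ) ≤ T := by exact_mod_cast hM.T_pos
  have hT0 : (0 : ℝ) < T := by linarith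
  set S := η * (T : ℝ) ^ (1 - θ) with hSdef
  have hS0 : 0 < S := by positivity
  have hsum : S ≤ ∑ i ∈ Finset.range T, stepSize η θ i := by
    have := mul_le_sum_stepSize hη hθ (t := 0) (k := T) (T := T) (by simp)
    simp only [zero_add] at this
    refine le_trans (le_of_eq ?_) this
    rw [hSdef, show 1 - θ = -θ + 1 by ring, Real.rpow_add_one hT0.ne']; ring
  -- The range estimate costs `2/S + 2 lam ≤ 4 τ` per unit of `‖u‖`. Truncating at this level makes
  -- it comparable with the remainder `τ^r`.
  set τ := max lam (1 / S) with hτdef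
  have hτ : 0 < τ := lt_of_lt_of_le hl (le_max_left _ _)
  obtain ⟨u, hu1, hu2, -⟩ := hS.exists_truncation hτ
  have hbias := norm_ridgePath_sub_le_of_range (isPosBounded_featureCov (ν := ρ.fst) hΦ) hl.le
    (fun i => (stepSize_pos hη θ i).le) (fun i => (hM.step hη hθ i).2.2.2) G u T
    (hS0.trans_le hsum)
  have h1 := norm_sub_featureCov_le hk hΦ G u
  have h2 := hM.sqrt_dev hK
  set y := Kd * ℓ * (T : ℝ) ^ (-θ) with hy
  have hy0 : 0 ≤ y := by positivity
  have hTθ : (T : ℝ) ^ (-θ) ≤ 1 := Real.rpow_le_one_of_one_le_of_nonpos hT1 (by linarith)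
  have hyK : y ≤ Kd * ℓ := by
    rw [hy]; exact mul_le_of_le_one_right (by positivity) hTθ
  -- Used only against the kernel deviation: its factor `lam` from `sqrt_dev` turns `lam^{r-1}` into
  -- `lam^r`.
  have h3 : τ ^ (r - 1) ≤ lam ^ (r - 1) :=
    Real.rpow_le_rpow_of_nonpos hl (le_max_left _ _) (by linarith)
  have hstep : (2 / (∑ i ∈ Finset.range T, stepSize η θ i) + 2 * lam) ≤ 4 * τ := by
    have e1 : 2 / (∑ i ∈ Finset.range T, stepSize η θ i) ≤ 2 / S := by gcongr
    have e2 : 1 / S ≤ τ := le_max_right _ _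
    have e3 : lam ≤ τ := le_max_left _ _
    have e4 : 2 / S = 2 * (1 / S) := by ring
    linarith
  have hττ : τ * τ ^ (r - 1) = τ ^ r := by
    rw [Real.rpow_sub_one hτ.ne']; field_simp
  have hll : lam * lam ^ (r - 1) = lam ^ r := by
    rw [Real.rpow_sub_one hl.ne']; field_simp
  have htot : ‖ridgePath (featureCov ρ.fst hΦ) lam (stepSize η θ) G T - G‖
      ≤ 5 * τ ^ r * ‖h‖ + Real.sqrt y * lam ^ r * ‖h‖ := by
    calc _ ≤ _ := hbias
      _ ≤ (τ ^ r * ‖h‖ + Real.sqrt y * lam * (lam ^ (r - 1) * ‖h‖))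
          + 4 * τ * (τ ^ (r - 1) * ‖h‖) := by
          gcongr
          refine h1.trans ?_
          gcongr
          exact hu1.trans (by gcongr)
      _ = τ ^ r * ‖h‖ + Real.sqrt y * (lam * lam ^ (r - 1)) * ‖h‖
          + 4 * (τ * τ ^ (r - 1)) * ‖h‖ := by ring
      _ = _ := by rw [hll, hττ]; ring
  have hsq : ∀ z : ℝ, 0 < z → (z ^ r) ^ 2 = z ^ (2 * r) := fun z hz => by
    rw [← Real.rpow_natCast (z ^ r), ← Real.rpow_mul hz.le]; congr 1; push_cast; ring
  have hτ2 : (τ ^ r) ^ 2 ≤ lam ^ (2 * r) + η ^ (-(2 * r)) * (T : ℝ) ^ (-(2 * r * (1 - θ))) := by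
    rw [hsq τ hτ]
    have e1 : (1 / S) ^ (2 * r) = η ^ (-(2 * r)) * (T : ℝ) ^ (-(2 * r * (1 - θ))) := by
      rw [one_div, Real.inv_rpow hS0.le, ← Real.rpow_neg hS0.le, hSdef,
        Real.mul_rpow hη.le (by positivity), ← Real.rpow_mul hT0.le]
      congr 2; ring
    rw [← e1]
    have e2 : 0 ≤ lam ^ (2 * r) := by positivity
    have e3 : 0 ≤ (1 / S) ^ (2 * r) := by positivity
    rcases max_cases lam (1 / S) with ⟨e, _⟩ | ⟨e, _⟩ <;> rw [hτdef, e] <;> linarith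
  set a := (T : ℝ) ^ (-(2 * r * (1 - θ)))
  set w := lam ^ (2 * r)
  set d := (T : ℝ) ^ (-θ)
  have ha : 0 ≤ a := by positivity
  have hw : 0 ≤ w := by positivity
  have hd : 0 ≤ d := by positivity
  set e := η ^ (-(2 * r))
  have he : 0 ≤ e := by positivity
  calc _ ≤ (5 * τ ^ r * ‖h‖ + Real.sqrt y * lam ^ r * ‖h‖) ^ 2 :=
        pow_le_pow_left₀ (norm_nonneg _) htot 2
    _ ≤ 2 * (5 * τ ^ r * ‖h‖) ^ 2 + 2 * (Real.sqrt y * lam ^ r * ‖h‖) ^ 2 := by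
        nlinarith [sq_nonneg (5 * τ ^ r * ‖h‖ - Real.sqrt y * lam ^ r * ‖h‖)]
    _ = (50 * (τ ^ r) ^ 2 + 2 * (y * w)) * ‖h‖ ^ 2 := by
        rw [mul_pow, mul_pow, mul_pow, mul_pow, Real.sq_sqrt hy0, hsq lam hl]; ring
    _ ≤ (50 * (w + e * a) + 2 * (Kd * ℓ * w)) * ‖h‖ ^ 2 := by gcongr
    _ ≤ ((100 * (1 + e) + 2 * Kd) * ((a + d + w) * ℓ)) * ‖h‖ ^ 2 := by
        gcongr
        have g1 : w ≤ 2 * ℓ * w := le_mul_of_one_le_left hw (by linarith)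
        have g2 : e * a ≤ 2 * ℓ * (e * a) := le_mul_of_one_le_left (by positivity) (by linarith)
        have g3 : 0 ≤ 100 * (a + d) * ℓ := by positivity
        have g4 : 0 ≤ 100 * e * (d + w) * ℓ := by positivity
        have g5 : 0 ≤ 2 * Kd * (a + d) * ℓ := by positivity
        nlinarith
    _ = _ := by ring

end Model

/-! ### Moments of the iterates and the risk of the linear model -/

section Model

variable {X : Type*} [MeasurableSpace X] {ρ : Measure (X × ℝ)} [IsProbabilityMeasure ρ]
  {k : X → X → ℝ} {b : ℝ} {hk : IsBddKernel k b} {μ : ℕ → ℝ} {φ : ℕ → Lp ℝ 2 ρ.fst} {r β c : ℝ}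
  {G h : Lp ℝ 2 ρ.fst} {η θ κ c₀ Kd : ℝ}
  {H : Type*} [NormedAddCommGroup H] [InnerProductSpace ℝ H] [FiniteDimensional ℝ H] {Φ : X → H}
  {hΦ : IsFeature Φ κ} {lam : ℝ} {T : ℕ} {ℓ : ℝ}

/-- A comparison point of bounded norm that nearly represents the regression function. -/
theorem IsSource.exists_comparison (hS : IsSource ρ.fst hk μ φ r β c G h)
    (hM : IsFeatureModel ρ k η θ κ c₀ Kd Φ hΦ G lam T ℓ) (hη : 0 < η) (hK : 0 ≤ Kd) :
    ∃ v₀ : H, ‖v₀‖ ^ 2 ≤ (c ^ (2 * r - 1) + (1 / η) ^ (2 * r - 1)) * ‖h‖ ^ 2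
          * (1 + Kd * (ℓ * (T : ℝ) ^ (-θ))) ∧
      ‖featureOp ρ.fst hΦ v₀ - G‖ ^ 2 / lam
        ≤ 2 * (1 / η) ^ (2 * r - 1) * ‖h‖ ^ 2 * (1 + Kd * (ℓ * (T : ℝ) ^ (-θ))) := by
  have hr := hS.half_lt
  have hr1 := hS.le_one
  have hl := hM.lam_pos
  have hlog := hM.log_ge
  have hc := hS.const_pos
  obtain ⟨u, hu1, hu2, hu3⟩ := hS.exists_truncation hl
  have hdev := hM.sqrt_dev hK
  rw [mul_assoc Kd ℓ] at hdev
  set y := Kd * (ℓ * (T : ℝ) ^ (-θ)) with hy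
  have hy0 : 0 ≤ y := by positivity
  set ε := Real.sqrt (kernelSq ρ.fst (fun x x' => inner ℝ (Φ x) (Φ x') - k x x'))
  have hε : 0 ≤ ε := Real.sqrt_nonneg _
  have hsy : Real.sqrt y ≤ 1 + y := by
    rw [Real.sqrt_le_left (by positivity)]; nlinarith
  have hll : lam * lam ^ (r - 1) = lam ^ r := by
    rw [Real.rpow_sub_one hl.ne']; field_simp
  have hll2 : lam ^ r * lam ^ (r - 1) = lam ^ (2 * r - 1) := by
    rw [← Real.rpow_add hl]; ring_nf
  have hlL : lam ^ (2 * r - 1) ≤ (1 / η) ^ (2 * r - 1) :=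
    Real.rpow_le_rpow hl.le (hM.lam_le hη) (by linarith)
  -- For `v₀ = S* u` one has `‖v₀‖² = ⟨A u, u⟩` and `S v₀ = A u`. The truncation level `lam` makes
  -- both the energy and `‖S v₀ - G‖² / lam` bounded, since `lam^{2r-1} ≤ (1/η)^{2r-1}`.
  refine ⟨ContinuousLinearMap.adjoint (featureOp ρ.fst hΦ) u, ?_, ?_⟩
  · rw [← real_inner_self_eq_norm_sq, ← inner_featureCov]
    have h1 : featureCov ρ.fst hΦ u = kernelOp ρ.fst hk u
        + kernelOp ρ.fst (hΦ.isBddKernel.sub hk) u := by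
      rw [← featureCov_sub_kernelOp hΦ hk]; abel
    have h2 : inner ℝ (kernelOp ρ.fst (hΦ.isBddKernel.sub hk) u) u
        ≤ Real.sqrt y * lam ^ (2 * r - 1) * ‖h‖ ^ 2 := by
      calc _ ≤ ‖kernelOp ρ.fst (hΦ.isBddKernel.sub hk) u‖ * ‖u‖ := real_inner_le_norm _ _
        _ ≤ (ε * ‖u‖) * ‖u‖ := by gcongr; exact norm_kernelOp_le _ u
        _ ≤ (Real.sqrt y * lam * (lam ^ (r - 1) * ‖h‖)) * (lam ^ (r - 1) * ‖h‖) := by gcongr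
        _ = Real.sqrt y * (lam * lam ^ (r - 1) * lam ^ (r - 1)) * ‖h‖ ^ 2 := by ring
        _ = _ := by rw [hll, hll2]
    rw [h1, inner_add_left]
    have h3 : Real.sqrt y * lam ^ (2 * r - 1) * ‖h‖ ^ 2
        ≤ (1 + y) * (1 / η) ^ (2 * r - 1) * ‖h‖ ^ 2 := by gcongr
    have h4 : 0 ≤ c ^ (2 * r - 1) * ‖h‖ ^ 2 * y := by positivity
    linarith
  · have h1 := norm_sub_featureCov_le hk hΦ G u
    rw [← featureCov_apply, norm_sub_rev]
    have h2 : ‖G - featureCov ρ.fst hΦ u‖ ≤ lam ^ r * ‖h‖ * (1 + Real.sqrt y) := by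
      calc _ ≤ lam ^ r * ‖h‖ + Real.sqrt y * lam * (lam ^ (r - 1) * ‖h‖) :=
            h1.trans (by gcongr)
        _ = lam ^ r * ‖h‖ + Real.sqrt y * (lam * lam ^ (r - 1)) * ‖h‖ := by ring
        _ = _ := by rw [hll]; ring
    rw [div_le_iff₀ hl]
    have h3 : (lam ^ r) ^ 2 = lam ^ (2 * r - 1) * lam := by
      rw [← Real.rpow_natCast (lam ^ r), ← Real.rpow_mul hl.le, ← Real.rpow_add_one hl.ne']
      congr 1; push_cast; ring
    calc _ ≤ (lam ^ r * ‖h‖ * (1 + Real.sqrt y)) ^ 2 := pow_le_pow_left₀ (norm_nonneg _) h2 2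
      _ = lam ^ (2 * r - 1) * lam * ‖h‖ ^ 2 * (1 + Real.sqrt y) ^ 2 := by
          rw [mul_pow, mul_pow, h3]
      _ ≤ (1 / η) ^ (2 * r - 1) * lam * ‖h‖ ^ 2 * (2 * (1 + y)) := by
          gcongr
          nlinarith [Real.sq_sqrt hy0, sq_nonneg (1 - Real.sqrt y)]
      _ = _ := by ring

/-- A second moment bound for the iterates, uniform in the number of steps. -/
theorem IsSource.exists_moment_bound (hS : IsSource ρ.fst hk μ φ r β c G h) (hη : 0 < η)
    (hθ : 1 / 2 < θ) (hc₀ : 0 < c₀) (hK : 0 ≤ Kd) :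
    ∃ C : ℝ, 0 < C ∧ ∀ (H : Type) [NormedAddCommGroup H] [InnerProductSpace ℝ H]
      [FiniteDimensional ℝ H] (Φ : X → H) (hΦ : IsFeature Φ κ) (lam : ℝ) (T : ℕ) (ℓ : ℝ),
      IsFeatureModel ρ k η θ κ c₀ Kd Φ hΦ G lam T ℓ → ∀ t : ℕ,
      ∫⁻ z, ENNReal.ofReal (2 * (1 + κ ^ 2 * ‖linSgd Φ lam (stepSize η θ) t z‖ ^ 2))
        ∂(Measure.pi fun _ : Fin t => ρ) ≤ ENNReal.ofReal (C * (1 + ℓ * (T : ℝ) ^ (-θ))) := by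
  obtain ⟨C2, hC2, hsum⟩ := exists_sum_stepSize_sq_le η hθ
  have hc := hS.const_pos
  set a₁ := (c ^ (2 * r - 1) + (1 / η) ^ (2 * r - 1)) * ‖h‖ ^ 2
  set a₂ := 2 * (1 / η) ^ (2 * r - 1) * ‖h‖ ^ 2
  have ha₁ : 0 ≤ a₁ := by positivity
  have ha₂ : 0 ≤ a₂ := by positivity
  set D := a₁ + a₂ + 4 * c₀ * κ ^ 2 * C2 * (1 + κ ^ 2 * a₁)
  have hD : 0 ≤ D := by positivity
  refine ⟨(2 + 4 * κ ^ 2 * (D + a₁)) * (1 + Kd), by positivity, ?_⟩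
  intro H _ _ _ Φ hΦ lam T ℓ hM t
  have hlog := hM.log_ge
  obtain ⟨v₀, hv1, hv2⟩ := hS.exists_comparison hM hη hK
  set x := ℓ * (T : ℝ) ^ (-θ)
  have hx : 0 ≤ x := by positivity
  have hstep := fun i => hM.step hη (by linarith : 0 < θ) i
  have hmom := lintegral_norm_linSgd_sub_sq_le hM.reg (c := c₀)
    (fun i => (stepSize_pos hη θ i).le) hM.lam_pos (fun i => (hstep i).1)
    (fun i => (hstep i).2.1) (fun i => (hstep i).2.2.1) v₀ t
  have hbound : ‖v₀‖ ^ 2 + ‖featureOp ρ.fst hΦ v₀ - G‖ ^ 2 / lam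
        + 4 * c₀ * κ ^ 2 * (1 + κ ^ 2 * ‖v₀‖ ^ 2) * ∑ i ∈ Finset.range t, stepSize η θ i ^ 2
      ≤ D * (1 + Kd * x) := by
    have h1 : 4 * c₀ * κ ^ 2 * (1 + κ ^ 2 * ‖v₀‖ ^ 2) * ∑ i ∈ Finset.range t, stepSize η θ i ^ 2
        ≤ 4 * c₀ * κ ^ 2 * (1 + κ ^ 2 * (a₁ * (1 + Kd * x))) * C2 := by
      gcongr
      exact hsum t
    have h2 : 0 ≤ 4 * c₀ * κ ^ 2 * C2 * (Kd * x) := by positivity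
    simp only [D]
    linarith
  calc _ ≤ ∫⁻ z, (ENNReal.ofReal (4 * κ ^ 2)
          * ENNReal.ofReal (‖linSgd Φ lam (stepSize η θ) t z - v₀‖ ^ 2)
          + ENNReal.ofReal (2 + 4 * κ ^ 2 * ‖v₀‖ ^ 2)) ∂(Measure.pi fun _ : Fin t => ρ) := by
        refine lintegral_mono fun z => ?_
        rw [← ENNReal.ofReal_mul (by positivity), ← ENNReal.ofReal_add (by positivity)
          (by positivity)]
        refine ENNReal.ofReal_le_ofReal ?_
        set V := linSgd Φ lam (stepSize η θ) t z
        have h1 := norm_add_le (V - v₀) v₀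
        rw [sub_add_cancel] at h1
        have h2 : ‖V‖ ^ 2 ≤ 2 * ‖V - v₀‖ ^ 2 + 2 * ‖v₀‖ ^ 2 := by
          nlinarith [pow_le_pow_left₀ (norm_nonneg _) h1 2, sq_nonneg (‖V - v₀‖ - ‖v₀‖)]
        nlinarith [mul_le_mul_of_nonneg_left h2 (sq_nonneg κ)]
    _ ≤ ENNReal.ofReal (4 * κ ^ 2) * ENNReal.ofReal (D * (1 + Kd * x))
          + ENNReal.ofReal (2 + 4 * κ ^ 2 * ‖v₀‖ ^ 2) := by
        rw [lintegral_add_right _ measurable_const, lintegral_const_mul' _ _ ENNReal.ofReal_ne_top]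
        simp only [lintegral_const, measure_univ, mul_one]
        gcongr
        exact hmom.trans (ENNReal.ofReal_le_ofReal hbound)
    _ ≤ _ := by
        rw [← ENNReal.ofReal_mul (by positivity), ← ENNReal.ofReal_add (by positivity)
          (by positivity)]
        refine ENNReal.ofReal_le_ofReal ?_
        have h1 : 4 * κ ^ 2 * ‖v₀‖ ^ 2 ≤ 4 * κ ^ 2 * (a₁ * (1 + Kd * x)) := by gcongr
        have h2 : 1 + Kd * x ≤ (1 + Kd) * (1 + x) := by nlinarith
        have h3 : (2 + 4 * κ ^ 2 * (D + a₁)) * (1 + Kd * x)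
            ≤ (2 + 4 * κ ^ 2 * (D + a₁)) * ((1 + Kd) * (1 + x)) := by gcongr
        have h4 : 0 ≤ Kd * x := by positivity
        linarith

/-- The risk of linear stochastic gradient descent with random features. -/
theorem IsSource.exists_risk_bound (hS : IsSource ρ.fst hk μ φ r β c G h) (hη : 0 < η)
    (hθ : 1 / 2 < θ) (hθ1 : θ < 1) (hc₀ : 0 < c₀) (hK : 0 ≤ Kd) (κ : ℝ) :
    ∃ C : ℝ, 0 < C ∧ ∀ (H : Type) [NormedAddCommGroup H] [InnerProductSpace ℝ H]
      [FiniteDimensional ℝ H] (Φ : X → H) (hΦ : IsFeature Φ κ) (lam : ℝ) (T : ℕ) (ℓ D : ℝ),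
      IsFeatureModel ρ k η θ κ c₀ Kd Φ hΦ G lam T ℓ → 0 ≤ D →
      (θ ≤ (2 - 1 / β) * (1 - θ) ∨ Real.exp (-(η * lam * (T : ℝ) ^ (1 - θ))) ≤ D) →
      ∫⁻ z, ENNReal.ofReal (‖featureOp ρ.fst hΦ (linSgd Φ lam (stepSize η θ) T z) - G‖ ^ 2)
        ∂(Measure.pi fun _ : Fin T => ρ)
        ≤ ENNReal.ofReal (C * (((T : ℝ) ^ (-(2 * r * (1 - θ))) + D + (T : ℝ) ^ (-θ)
          + lam ^ (2 * r)) * ℓ)) := by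
  have hβ := hS.one_lt
  have hθ0 : 0 < θ := by linarith
  have hp : 1 < 2 - 1 / β := by
    have : 1 / β < 1 := by rw [div_lt_one (by linarith)]; exact hβ
    linarith
  obtain ⟨Cm, hCm, hmom⟩ := hS.exists_moment_bound (κ := κ) hη hθ hc₀ hK
  obtain ⟨Ct, hCt, htrace⟩ := hS.exists_trace_bound κ
  obtain ⟨Cs, hCs, hsum⟩ := exists_sum_stepSize_sq_mul_le hη hθ hθ1 hp
  set Cb := (100 * (1 + η ^ (-(2 * r))) + 2 * Kd) * ‖h‖ ^ 2 with hCb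
  have hCb0 : 0 ≤ Cb := by positivity
  set Cp := (η / 2) ^ (-(2 - 1 / β)) with hCp
  have hCp0 : 0 ≤ Cp := by positivity
  set Cv := Ct + (κ ^ 2) ^ 2 with hCv
  have hCv0 : 0 < Cv := by positivity
  set C₁ := Cb + 2 * Cm * Cv * Cs * (2 * Cp + Kd + 2) with hC₁
  have hC₁0 : 0 ≤ C₁ := by positivity
  refine ⟨C₁ + 4 * Cm + 2 * ‖G‖ ^ 2, by positivity, ?_⟩
  intro H _ _ _ Φ hΦ lam T ℓ D hM hD hcase
  have hκ := hΦ.pos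
  have hlog := hM.log_ge
  have hl := hM.lam_pos
  have hT1 : (1 : ℝ) ≤ T := by exact_mod_cast hM.T_pos
  have hT0 : (0 : ℝ) < T := by linarith
  set a := (T : ℝ) ^ (-(2 * r * (1 - θ)))
  set w := lam ^ (2 * r)
  set d := (T : ℝ) ^ (-θ) with hd_def
  have ha : 0 ≤ a := by positivity
  have hw : 0 ≤ w := by positivity
  have hd : 0 ≤ d := by positivity
  have hstep := fun i => hM.step hη hθ0 i
  have hm := hmom H Φ hΦ lam T ℓ hM
  -- If `ℓ T^{-θ} ≥ 1`, the claimed bound already dominates the plain second moment of the iterates.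
  by_cases hbig : 1 ≤ ℓ * d
  · calc _ ≤ ∫⁻ z, (ENNReal.ofReal (2 * (1 + κ ^ 2 * ‖linSgd Φ lam (stepSize η θ) T z‖ ^ 2))
            + ENNReal.ofReal (2 * ‖G‖ ^ 2)) ∂(Measure.pi fun _ : Fin T => ρ) := by
          refine lintegral_mono fun z => ?_
          rw [← ENNReal.ofReal_add (by positivity) (by positivity)]
          refine ENNReal.ofReal_le_ofReal ?_
          set V := linSgd Φ lam (stepSize η θ) T z
          have h1 := norm_sub_le (featureOp ρ.fst hΦ V) G
          have h2 := norm_featureOp_le (ν := ρ.fst) hΦ V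
          have h3 := pow_le_pow_left₀ (norm_nonneg _) (h1.trans (by gcongr : _ ≤ κ * ‖V‖ + ‖G‖)) 2
          nlinarith [sq_nonneg (κ * ‖V‖ - ‖G‖)]
      _ ≤ ENNReal.ofReal (Cm * (1 + ℓ * d)) + ENNReal.ofReal (2 * ‖G‖ ^ 2) := by
          rw [lintegral_add_right _ measurable_const]
          simp only [lintegral_const, measure_univ, mul_one]
          gcongr
          exact hm T
      _ ≤ _ := by
          rw [← ENNReal.ofReal_add (by positivity) (by positivity)]
          refine ENNReal.ofReal_le_ofReal ?_
          have h1 : ℓ * d ≤ (a + D + d + w) * ℓ := by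
            have : 0 ≤ (a + D + w) * ℓ := by positivity
            linarith
          have h2 : (C₁ + 4 * Cm + 2 * ‖G‖ ^ 2) * (ℓ * d)
              ≤ (C₁ + 4 * Cm + 2 * ‖G‖ ^ 2) * ((a + D + d + w) * ℓ) := by gcongr
          have h3 : 0 ≤ C₁ * (ℓ * d) := by positivity
          have h4 : Cm * 1 ≤ Cm * (ℓ * d) := by gcongr
          have h5 : 2 * ‖G‖ ^ 2 * 1 ≤ 2 * ‖G‖ ^ 2 * (ℓ * d) := by gcongr
          have h6 : 0 ≤ Cm * (ℓ * d) := by positivity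
          linarith
  · push Not at hbig
    set ε := kernelSq ρ.fst (fun x x' => inner ℝ (Φ x) (Φ x') - k x x') with hεdef
    have hε : 0 ≤ ε := kernelSq_nonneg _
    set A := featureCov ρ.fst hΦ
    set S := featureOp ρ.fst hΦ
    set v : ℕ → ℝ := fun t => ∫ x, ‖ridgeProd A lam (stepSize η θ) (t + 1) (T - 1 - t)
      (S (Φ x))‖ ^ 2 ∂ρ.fst with hv
    -- In this case `ℓ T^{-θ} < 1`, so the moments are bounded by `2 Cm` without any logarithm.
    have hbv := lintegral_linSgd_sq_le hM.reg (K := 2 * Cm) (by positivity) T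
      (lam := lam) (s := stepSize η θ)
      (fun t _ => (hm t).trans (ENNReal.ofReal_le_ofReal (by nlinarith)))
      (ContinuousLinearMap.id ℝ _) G
    simp only [ContinuousLinearMap.id_apply] at hbv
    refine hbv.trans (ENNReal.ofReal_le_ofReal ?_)
    have hbias := hS.bias_le hM hη hθ0 hK
    have hlen : ∀ t < T, η * d * ((T - 1 - t : ℕ) : ℝ)
        ≤ ∑ i ∈ Finset.range (T - 1 - t), stepSize η θ (t + 1 + i) := fun t ht =>
      mul_le_sum_stepSize hη hθ0 (by omega)
    have htr : ∀ t, v t ≤ Ct * (ε + (1 + ∑ i ∈ Finset.range (T - 1 - t),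
        stepSize η θ (t + 1 + i)) ^ (-(2 - 1 / β))) := fun t =>
      htrace H Φ hΦ lam (stepSize η θ) hl.le (fun i => (stepSize_pos hη θ i).le)
        (fun i => (hstep i).2.2.2) (t + 1) (T - 1 - t)
    have hv1 : ∀ t < T, v t / Cv ≤ ε + (1 + η * (T : ℝ) ^ (-θ) * ((T - 1 - t : ℕ) : ℝ))
        ^ (-(2 - 1 / β)) := fun t ht => by
      rw [div_le_iff₀' hCv0]
      have h1 : (1 + ∑ i ∈ Finset.range (T - 1 - t), stepSize η θ (t + 1 + i)) ^ (-(2 - 1 / β))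
          ≤ (1 + η * d * ((T - 1 - t : ℕ) : ℝ)) ^ (-(2 - 1 / β)) :=
        Real.rpow_le_rpow_of_nonpos (by positivity) (by linarith [hlen t ht]) (by linarith)
      calc v t ≤ _ := htr t
        _ ≤ Ct * (ε + (1 + η * d * ((T - 1 - t : ℕ) : ℝ)) ^ (-(2 - 1 / β))) := by gcongr
        _ ≤ Cv * (ε + (1 + η * d * ((T - 1 - t : ℕ) : ℝ)) ^ (-(2 - 1 / β))) := by
            gcongr; linarith [sq_nonneg (κ ^ 2)]
    -- An early sample is followed by at least `T/2` steps, each at least `η T^{-θ}`.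
    have hhalf : ∀ t < T, 2 * (t + 1) ≤ T →
        η * (T : ℝ) ^ (1 - θ) / 2 ≤ ∑ i ∈ Finset.range (T - 1 - t), stepSize η θ (t + 1 + i) :=
      fun t ht h2 => by
        refine le_trans ?_ (hlen t ht)
        have h3 : (T : ℝ) / 2 ≤ ((T - 1 - t : ℕ) : ℝ) := by
          have : (T : ℝ) ≤ 2 * ((T - 1 - t : ℕ) : ℝ) := by exact_mod_cast (by omega)
          linarith
        calc η * (T : ℝ) ^ (1 - θ) / 2 = η * d * (T / 2) := by
              rw [hd_def, show 1 - θ = -θ + 1 by ring, Real.rpow_add_one hT0.ne']; ring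
          _ ≤ _ := by gcongr
    have hv2 : ∀ t < T, 2 * (t + 1) ≤ T → v t / Cv ≤ ε + (Cp * d + D) := fun t ht h2 => by
      rw [div_le_iff₀' hCv0]
      have hh := hhalf t ht h2
      -- The early samples are forgotten either polynomially, through the trace bound and the
      -- condition on `θ`, or exponentially, through the ridge contraction. Squaring that
      -- contraction cancels the factor `1/2` in `hhalf`.
      rcases hcase with hc | hc
      · have h1 : (1 + ∑ i ∈ Finset.range (T - 1 - t), stepSize η θ (t + 1 + i)) ^ (-(2 - 1 / β))
            ≤ Cp * d := by
          calc _ ≤ (η / 2 * (T : ℝ) ^ (1 - θ)) ^ (-(2 - 1 / β)) :=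
                Real.rpow_le_rpow_of_nonpos (by positivity) (by linarith) (by linarith)
            _ = Cp * (T : ℝ) ^ (-((2 - 1 / β) * (1 - θ))) := by
                rw [Real.mul_rpow (by positivity) (by positivity), ← Real.rpow_mul hT0.le]
                congr 2; ring
            _ ≤ Cp * d := by
                gcongr
                exact Real.rpow_le_rpow_of_exponent_le hT1 (by linarith)
        calc v t ≤ _ := htr t
          _ ≤ Ct * (ε + (Cp * d + D)) := by gcongr; linarith
          _ ≤ Cv * (ε + (Cp * d + D)) := by
              gcongr; linarith [sq_nonneg (κ ^ 2)]
      · have h1 := integral_ridgeProd_le_exp (ν := ρ.fst) (lam := lam) hΦ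
          (fun i => (stepSize_pos hη θ i).le) (fun i => (hstep i).2.2.2) (t + 1) (T - 1 - t)
        calc v t ≤ _ := h1
          _ ≤ (κ ^ 2) ^ 2 * D := by
              gcongr
              refine le_trans (Real.exp_le_exp.2 ?_) hc
              have := mul_le_mul_of_nonneg_left hh hl.le
              linarith
          _ ≤ Cv * (ε + (Cp * d + D)) := by
              have : 0 ≤ Cp * d := by positivity
              gcongr
              · linarith
              · linarith
    have hfin := hsum T (fun t => v t / Cv) ε (Cp * d + D) hM.T_pos hε (by positivity) hv1 hv2
    have hεd : ε ≤ Kd * (ℓ * d) := by have := hM.dev; rwa [mul_assoc] at this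
    have hvar : ∑ t ∈ Finset.range T, stepSize η θ t ^ 2 * (2 * Cm * v t)
        ≤ 2 * Cm * Cv * Cs * (2 * Cp + Kd + 2) * ((a + D + d + w) * ℓ) := by
      calc _ = 2 * Cm * Cv * ∑ t ∈ Finset.range T, stepSize η θ t ^ 2 * (v t / Cv) := by
            rw [Finset.mul_sum]
            refine Finset.sum_congr rfl fun t _ => ?_
            field_simp
        _ ≤ 2 * Cm * Cv * (Cs * (ε + d + (Cp * d + D))) := by gcongr
        _ ≤ 2 * Cm * Cv * (Cs * ((2 * Cp + Kd + 2) * ((a + D + d + w) * ℓ))) := by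
            gcongr
            have g1 : d ≤ 2 * ℓ * d := le_mul_of_one_le_left hd (by linarith)
            have g2 : D ≤ 2 * ℓ * D := le_mul_of_one_le_left hD (by linarith)
            have g3 : Cp * d ≤ 2 * ℓ * (Cp * d) :=
              le_mul_of_one_le_left (by positivity) (by linarith)
            have g4 : 0 ≤ 2 * Cp * ((a + D + w) * ℓ) := by positivity
            have g5 : 0 ≤ Kd * ((a + D + w) * ℓ) := by positivity
            have g6 : 0 ≤ 2 * ((a + w) * ℓ) := by positivity
            linarith
        _ = _ := by ring
    have g1 : 0 ≤ Cb * (D * ℓ) := by positivity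
    have g2 : 0 ≤ (4 * Cm + 2 * ‖G‖ ^ 2) * ((a + D + d + w) * ℓ) := by positivity
    simp only [hC₁]
    linarith

end Model

/-! ### Concentration of averages in `L²` -/

section Concentration

variable {W Y : Type*} [MeasurableSpace W] [MeasurableSpace Y] {P : Measure W}
  [IsProbabilityMeasure P] {ν : Measure Y} [IsProbabilityMeasure ν]

/-- A bounded field on `Y`, centered with respect to the random parameter in `W`. -/
structure IsCenteredField (P : Measure W) (h : W → Y → ℝ) (B : ℝ) : Prop where
  meas : Measurable (Function.uncurry h)
  bound : ∀ w y, |h w y| ≤ B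
  mean : ∀ y, ∫ w, h w y ∂P = 0
  pos : 0 < B

variable {h : W → Y → ℝ} {B : ℝ}

theorem IsCenteredField.lintegral_exp_le (hh : IsCenteredField P h B) {f : Y → ℝ}
    (hf : Measurable f) {R : ℝ} (hR : ∀ y, |f y| ≤ R) {c : ℝ} (hc : 0 ≤ c) :
    ∫⁻ w, ENNReal.ofReal (Real.exp (c * ∫ y, (f y + h w y) ^ 2 ∂ν)) ∂P
      ≤ ENNReal.ofReal (Real.exp (c * (1 + 2 * c * B ^ 2) * (∫ y, f y ^ 2 ∂ν) + c * B ^ 2)) := by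
  have hB := hh.pos
  have hhy : ∀ w, Measurable (h w) := fun w => hh.meas.comp (measurable_const.prodMk measurable_id)
  have if2 : Integrable (fun y => f y ^ 2) ν :=
    Integrable.of_bound (hf.pow_const 2).aestronglyMeasurable (R ^ 2)
      (Filter.Eventually.of_forall fun y => by
        rw [norm_pow]; exact pow_le_pow_left₀ (norm_nonneg _) (hR y) 2)
  have ih2 : ∀ w, Integrable (fun y => h w y ^ 2) ν := fun w =>
    Integrable.of_bound ((hhy w).pow_const 2).aestronglyMeasurable (B ^ 2)
      (Filter.Eventually.of_forall fun y => by
        rw [norm_pow]; exact pow_le_pow_left₀ (norm_nonneg _) (hh.bound w y) 2)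
  have ifh : ∀ w, Integrable (fun y => f y * h w y) ν := fun w =>
    Integrable.of_bound (hf.mul (hhy w)).aestronglyMeasurable (R * B)
      (Filter.Eventually.of_forall fun y => by
        rw [norm_mul]
        exact mul_le_mul (hR y) (hh.bound w y) (norm_nonneg _) ((abs_nonneg _).trans (hR y)))
  set F := ∫ y, f y ^ 2 ∂ν with hF
  have hF0 : 0 ≤ F := integral_nonneg fun _ => sq_nonneg _
  let X : W → ℝ := fun w => ∫ y, f y * h w y ∂ν
  have hh2 : ∀ w, ∫ y, h w y ^ 2 ∂ν ≤ B ^ 2 := fun w =>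
    integral_le_of_forall_le (sq_nonneg _) (Filter.Eventually.of_forall fun y => by
      rw [← sq_abs]; exact pow_le_pow_left₀ (abs_nonneg _) (hh.bound w y) 2)
  have hexp : ∀ w, ∫ y, (f y + h w y) ^ 2 ∂ν ≤ F + 2 * X w + B ^ 2 := fun w => by
    have e1 : ∀ y, (f y + h w y) ^ 2 = f y ^ 2 + 2 * (f y * h w y) + h w y ^ 2 := fun y => by ring
    have i1 : Integrable (fun y => f y ^ 2 + 2 * (f y * h w y)) ν := if2.add ((ifh w).const_mul 2)
    simp only [e1]
    rw [integral_add i1 (ih2 w), integral_add if2 ((ifh w).const_mul 2), integral_const_mul]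
    have := hh2 w
    simp only [X]
    linarith
  have hXb : ∀ w, |X w| ≤ B * Real.sqrt F := fun w => by
    have h1 : MemLp f 2 ν := (memLp_two_iff_integrable_sq hf.aestronglyMeasurable).2 if2
    have h2 : MemLp (h w) 2 ν :=
      (memLp_two_iff_integrable_sq (hhy w).aestronglyMeasurable).2 (ih2 w)
    have h3 : X w = inner ℝ h1.toLp h2.toLp := by
      rw [l2_inner_eq_of_ae _ h2.coeFn_toLp]
      exact integral_congr_ae (h1.coeFn_toLp.mono fun y hy => by simp only [hy])
    have h4 : ‖h1.toLp‖ = Real.sqrt F := by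
      rw [hF, ← l2_norm_sq_eq_of_ae h1.coeFn_toLp, Real.sqrt_sq (norm_nonneg _)]
    have h5 : ‖h2.toLp‖ ≤ B := by
      refine le_of_sq_le_sq ?_ hB.le
      rw [l2_norm_sq_eq_of_ae h2.coeFn_toLp]
      exact hh2 w
    rw [h3]
    calc _ ≤ ‖h1.toLp‖ * ‖h2.toLp‖ := abs_real_inner_le_norm _ _
      _ ≤ Real.sqrt F * B := by rw [h4]; gcongr
      _ = _ := mul_comm _ _
  have hjoint : StronglyMeasurable (Function.uncurry fun w y => f y * h w y) :=
    ((hf.comp measurable_snd).mul hh.meas).stronglyMeasurable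
  have hXm : StronglyMeasurable X := hjoint.integral_prod_right
  have hX0 : ∫ w, X w ∂P = 0 := by
    have hintegr : Integrable (Function.uncurry fun w y => f y * h w y) (P.prod ν) :=
      Integrable.of_bound hjoint.aestronglyMeasurable (R * B)
        (Filter.Eventually.of_forall fun p => by
          simp only [Function.uncurry, norm_mul]
          exact mul_le_mul (hR _) (hh.bound _ _) (norm_nonneg _) ((abs_nonneg _).trans (hR p.2)))
    simp only [X]
    rw [integral_integral_swap hintegr]
    simp only [integral_const_mul, hh.mean, mul_zero, integral_zero]
  -- Hoeffding's lemma for the cross term `X = ⟨f, h_w⟩`, which is centered and bounded by `B ‖f‖`.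
  -- The remaining square of `h_w` is at most `B²` deterministically.
  have hsub := ProbabilityTheory.hasSubgaussianMGF_of_mem_Icc_of_integral_eq_zero
    (μ := P) (X := X) (a := -(B * Real.sqrt F)) (b := B * Real.sqrt F) hXm.measurable.aemeasurable
    (Filter.Eventually.of_forall fun w => abs_le.1 (hXb w)) hX0
  have hmgf := hsub.mgf_le (2 * c)
  have hcoef : (((‖B * Real.sqrt F - -(B * Real.sqrt F)‖₊ / 2) ^ 2 : NNReal) : ℝ) = B ^ 2 * F := by
    push_cast
    rw [sub_neg_eq_add, ← two_mul, Real.norm_of_nonneg (by positivity)]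
    rw [mul_div_cancel_left₀ _ (two_ne_zero), mul_pow, Real.sq_sqrt hF0]
  rw [hcoef] at hmgf
  have hintegr := hsub.integrable_exp_mul (2 * c)
  calc _ ≤ ∫⁻ w, ENNReal.ofReal (Real.exp (c * F + c * B ^ 2) * Real.exp (2 * c * X w)) ∂P := by
        refine lintegral_mono fun w => ENNReal.ofReal_le_ofReal ?_
        rw [← Real.exp_add]
        refine Real.exp_le_exp.2 ?_
        have := mul_le_mul_of_nonneg_left (hexp w) hc
        linarith
    _ = ENNReal.ofReal (∫ w, Real.exp (c * F + c * B ^ 2) * Real.exp (2 * c * X w) ∂P) :=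
        (ofReal_integral_eq_lintegral_ofReal (hintegr.const_mul _)
          (Filter.Eventually.of_forall fun _ => by positivity)).symm
    _ ≤ _ := by
        refine ENNReal.ofReal_le_ofReal ?_
        rw [integral_const_mul]
        calc _ ≤ Real.exp (c * F + c * B ^ 2) * Real.exp (B ^ 2 * F * (2 * c) ^ 2 / 2) := by
              gcongr; exact hmgf
          _ = _ := by rw [← Real.exp_add]; congr 1; ring

/-- The squared `L²` norm of a sum of independent copies of the field. -/
noncomputable def fieldSq (ν : Measure Y) (h : W → Y → ℝ) (m : ℕ) (w : Fin m → W) : ℝ :=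
  ∫ y, (∑ r, h (w r) y) ^ 2 ∂ν

theorem IsCenteredField.measurable_sum (hh : IsCenteredField P h B) (m : ℕ) :
    Measurable (Function.uncurry fun (w : Fin m → W) y => ∑ r, h (w r) y) := by
  have h1 : Measurable fun q : (Fin m → W) × Y => ∑ r, h (q.1 r) q.2 := by
    refine Finset.measurable_sum _ fun r _ => ?_
    have h2 : Measurable fun q : (Fin m → W) × Y => (q.1 r, q.2) :=
      ((measurable_pi_apply r).comp measurable_fst).prodMk measurable_snd
    exact hh.meas.comp h2
  exact h1

theorem IsCenteredField.measurable_fieldSq (hh : IsCenteredField P h B) (m : ℕ) :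
    Measurable (fieldSq ν h m) :=
  (((hh.measurable_sum m).pow_const 2).stronglyMeasurable.integral_prod_right).measurable

/-- Integrating out one copy replaces the exponent `1/x` by at most `1/(x - 2B²)`, so `m` copies
lower `x` by `2 m B²`. -/
theorem IsCenteredField.lintegral_exp_fieldSq_le (hh : IsCenteredField P h B) (m : ℕ) {x : ℝ}
    (hx : 2 * m * B ^ 2 < x) :
    ∫⁻ w, ENNReal.ofReal (Real.exp (fieldSq ν h m w / x)) ∂(Measure.pi fun _ : Fin m => P)
      ≤ ENNReal.ofReal (Real.exp (m * B ^ 2 / (x - 2 * m * B ^ 2))) := by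
  have hB := hh.pos
  induction m generalizing x with
  | zero => simp [fieldSq]
  | succ m ih =>
    push_cast at hx
    have hx' : 2 * m * B ^ 2 < x - 2 * B ^ 2 := by linarith
    have hm0 : (0 : ℝ) ≤ 2 * m * B ^ 2 := by positivity
    have hB2 : 0 < B ^ 2 := by positivity
    have hx0 : 0 < x - 2 * B ^ 2 := by linarith
    have hx1 : 0 < x := by linarith
    let F : (Fin m → W) → W → ℝ≥0∞ := fun w w' =>
      ENNReal.ofReal (Real.exp (1 / x * ∫ y, (∑ r, h (w r) y + h w' y) ^ 2 ∂ν))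
    have hFm : Measurable (Function.uncurry F) := by
      have h1 : Measurable fun q : ((Fin m → W) × W) × Y => ∑ r, h (q.1.1 r) q.2 :=
        (hh.measurable_sum m).comp ((measurable_fst.comp measurable_fst).prodMk measurable_snd)
      have h2 : Measurable fun q : ((Fin m → W) × W) × Y => h q.1.2 q.2 :=
        hh.meas.comp ((measurable_snd.comp measurable_fst).prodMk measurable_snd)
      have h3 : StronglyMeasurable fun q : (Fin m → W) × W =>
          ∫ y, (∑ r, h (q.1 r) y + h q.2 y) ^ 2 ∂ν :=
        StronglyMeasurable.integral_prod_right (f := fun (q : (Fin m → W) × W) (y : Y) =>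
          (∑ r, h (q.1 r) y + h q.2 y) ^ 2) ((h1.add h2).pow_const 2).stronglyMeasurable
      exact ((h3.measurable.const_mul _).exp).ennreal_ofReal
    have hsplit : ∀ w : Fin (m + 1) → W,
        ENNReal.ofReal (Real.exp (fieldSq ν h (m + 1) w / x))
          = F (Fin.init w) (w (Fin.last m)) := fun w => by
      simp only [F, fieldSq, Fin.sum_univ_castSucc, Fin.init]
      congr 2
      ring
    simp only [hsplit]
    rw [lintegral_pi_fin_succ P m hFm]
    calc _ ≤ ∫⁻ w, ENNReal.ofReal (Real.exp (1 / x * B ^ 2))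
            * ENNReal.ofReal (Real.exp (fieldSq ν h m w / (x - 2 * B ^ 2)))
            ∂(Measure.pi fun _ : Fin m => P) := by
          refine lintegral_mono fun w => ?_
          have hfm : Measurable fun y => ∑ r, h (w r) y :=
            (hh.measurable_sum m).comp (measurable_const.prodMk measurable_id)
          have hfb : ∀ y, |∑ r, h (w r) y| ≤ m * B := fun y => by
            calc _ ≤ ∑ r : Fin m, |h (w r) y| := Finset.abs_sum_le_sum_abs _ _
              _ ≤ ∑ _r : Fin m, B := Finset.sum_le_sum fun r _ => hh.bound _ _
              _ = m * B := by simp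
          refine (hh.lintegral_exp_le (ν := ν) hfm hfb (c := 1 / x) (by positivity)).trans ?_
          rw [← ENNReal.ofReal_mul (by positivity), ← Real.exp_add]
          refine ENNReal.ofReal_le_ofReal (Real.exp_le_exp.2 ?_)
          have hnn : 0 ≤ fieldSq ν h m w := integral_nonneg fun _ => sq_nonneg _
          have hcoef : 1 / x * (1 + 2 * (1 / x) * B ^ 2) ≤ 1 / (x - 2 * B ^ 2) := by
            rw [le_div_iff₀ hx0]
            have : 1 / x * (1 + 2 * (1 / x) * B ^ 2) * (x - 2 * B ^ 2)
                = 1 - (2 * B ^ 2 / x) ^ 2 := by field_simp; ring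
            rw [this]
            nlinarith [sq_nonneg (2 * B ^ 2 / x)]
          have h1 := mul_le_mul_of_nonneg_right hcoef hnn
          simp only [fieldSq] at h1 ⊢
          rw [one_div_mul_eq_div (x - 2 * B ^ 2)] at h1
          linarith
      _ ≤ ENNReal.ofReal (Real.exp (1 / x * B ^ 2))
            * ENNReal.ofReal (Real.exp (m * B ^ 2 / (x - 2 * B ^ 2 - 2 * m * B ^ 2))) := by
          rw [lintegral_const_mul' _ _ ENNReal.ofReal_ne_top]
          gcongr
          exact ih hx'
      _ ≤ _ := by
          rw [← ENNReal.ofReal_mul (by positivity), ← Real.exp_add]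
          refine ENNReal.ofReal_le_ofReal (Real.exp_le_exp.2 ?_)
          push_cast
          have e1 : x - 2 * B ^ 2 - 2 * m * B ^ 2 = x - 2 * (m + 1) * B ^ 2 := by ring
          rw [e1, add_mul, one_mul, add_div, add_comm]
          have hx2 : 0 < x - 2 * (m + 1) * B ^ 2 := by linarith
          gcongr
          rw [one_div, inv_mul_eq_div]
          gcongr
          have : 0 ≤ 2 * ((m : ℝ) + 1) * B ^ 2 := by positivity
          linarith

/-- A Hoeffding bound for the `L²` norm of a sum of independent centered bounded fields. -/
theorem IsCenteredField.measure_fieldSq_le (hh : IsCenteredField P h B) {m : ℕ} (hm : 0 < m)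
    {δ : ℝ} (hδ : 0 < δ) :
    ENNReal.ofReal (1 - δ) ≤ (Measure.pi fun _ : Fin m => P)
      {w | fieldSq ν h m w ≤ 4 * m * B ^ 2 * Real.log (2 / δ)} := by
  have hB := hh.pos
  have hm0 : (0 : ℝ) < m := by exact_mod_cast hm
  -- With this `x` the exponential moment is at most `e^{1/2} ≤ 2`; Markov's inequality at level
  -- `2/δ` then produces the logarithm.
  set x : ℝ := 4 * m * B ^ 2 with hx
  have hx0 : 0 < x := by positivity
  have hmeas := hh.measurable_fieldSq (ν := ν) m
  have h1 := hh.lintegral_exp_fieldSq_le (ν := ν) m (x := x) (by rw [hx]; nlinarith [sq_pos_of_pos hB])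
  have h2 : Real.exp (m * B ^ 2 / (x - 2 * m * B ^ 2)) ≤ 2 := by
    have : m * B ^ 2 / (x - 2 * m * B ^ 2) = 1 / 2 := by
      rw [hx]; field_simp; norm_num
    rw [this]
    have h3 : Real.exp (1 / 2) ^ 2 ≤ 2 ^ 2 := by
      rw [← Real.exp_nat_mul]
      have := Real.exp_one_lt_d9
      norm_num
      linarith
    exact le_of_sq_le_sq h3 (by norm_num)
  set μ := Measure.pi fun _ : Fin m => P
  set s := {w | fieldSq ν h m w ≤ x * Real.log (2 / δ)}
  have hs : MeasurableSet s := measurableSet_le hmeas measurable_const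
  have hmark := meas_ge_le_lintegral_div (μ := μ)
    (f := fun w => ENNReal.ofReal (Real.exp (fieldSq ν h m w / x)))
    ((hmeas.div_const x).exp.ennreal_ofReal).aemeasurable
    (ε := ENNReal.ofReal (2 / δ)) (by simp; positivity) ENNReal.ofReal_ne_top
  have hcompl : μ sᶜ ≤ ENNReal.ofReal δ := by
    calc μ sᶜ ≤ μ {w | ENNReal.ofReal (2 / δ) ≤ ENNReal.ofReal (Real.exp (fieldSq ν h m w / x))} := by
          refine measure_mono fun w hw => ?_
          simp only [s, mem_compl_iff, mem_ofPred_eq, not_le] at hw ⊢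
          refine ENNReal.ofReal_le_ofReal ?_
          rw [← Real.log_le_iff_le_exp (by positivity), le_div_iff₀ hx0]
          linarith
      _ ≤ _ := hmark
      _ ≤ ENNReal.ofReal 2 / ENNReal.ofReal (2 / δ) := by
          gcongr
          exact h1.trans (ENNReal.ofReal_le_ofReal h2)
      _ = ENNReal.ofReal δ := by
          rw [← ENNReal.ofReal_div_of_pos (by positivity)]
          congr 1; field_simp
  have hadd := prob_add_prob_compl (μ := μ) hs
  rw [ENNReal.ofReal_sub _ hδ.le, ENNReal.ofReal_one]
  rw [tsub_le_iff_right, ← hadd]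
  gcongr

end Concentration

/-! ### Linearization along stochastic gradient descent -/

section Coupling

variable {H : Type*} [NormedAddCommGroup H] [InnerProductSpace ℝ H]

/-- For a linear model the cross term `-2 s e ⟨W, D⟩` makes the residual `e` push the parameters
back, up to the bounded output `y`. Near linearity changes this only by `E`, with `|E| ≤ 1`, so the
growth is at most `4 s`. -/
theorem norm_nearlyLinear_step_sq_le {W Φ D : H} {v y s lam κ L : ℝ} (hΦ : ‖Φ‖ ≤ κ)
    (hD : ‖D - Φ‖ ≤ L * ‖W‖) (hv : |v - inner ℝ W Φ| ≤ L * ‖W‖ ^ 2) (hy : |y| ≤ 1)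
    (hL2 : L * ‖W‖ ^ 2 ≤ 1 / 2) (hL1 : L * ‖W‖ ≤ 1) (hs : 0 ≤ s) (hlam : 0 ≤ lam)
    (hsκ : s * (κ + 1) ^ 2 ≤ 1 - s * lam) :
    ‖(1 - s * lam) • W - (s * (v - y)) • D‖ ^ 2 ≤ ‖W‖ ^ 2 + 4 * s := by
  have ha0 : 0 ≤ 1 - s * lam := le_trans (by positivity) hsκ
  have hsl : 0 ≤ s * lam := mul_nonneg hs hlam
  set a := 1 - s * lam
  set e := v - y with he
  set E := inner ℝ W D - v with hE
  have hDn : ‖D‖ ≤ κ + 1 := by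
    have h1 := norm_add_le (D - Φ) Φ
    rw [sub_add_cancel] at h1
    linarith
  have hE1 : |E| ≤ 1 := by
    have h1 : E = inner ℝ W (D - Φ) - (v - inner ℝ W Φ) := by rw [hE, inner_sub_right]; ring
    have h2 := abs_real_inner_le_norm W (D - Φ)
    have h3 : ‖W‖ * ‖D - Φ‖ ≤ ‖W‖ * (L * ‖W‖) := by gcongr
    rw [h1]
    have h4 := abs_sub (inner ℝ W (D - Φ)) (v - inner ℝ W Φ)
    nlinarith
  have h1 : ‖a • W - (s * e) • D‖ ^ 2
      = a ^ 2 * ‖W‖ ^ 2 - 2 * a * s * (e * (e + (y + E))) + s ^ 2 * e ^ 2 * ‖D‖ ^ 2 := by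
    rw [norm_sub_sq_real, norm_smul, norm_smul, inner_smul_left, inner_smul_right]
    simp only [mul_pow, Real.norm_eq_abs, sq_abs, abs_mul, conj_trivial]
    rw [show (inner ℝ W D : ℝ) = e + (y + E) by rw [he, hE]; ring]
    ring
  rw [h1]
  have h2 : -(e * (e + (y + E))) ≤ -(e ^ 2 / 2) + 2 := by
    have hb := abs_le.1 (abs_add_le y E)
    have h3 : (y + E) ^ 2 ≤ 4 := by
      have : |y + E| ≤ 2 := (abs_add_le y E).trans (by linarith)
      rw [← sq_abs]; nlinarith [abs_nonneg (y + E)]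
    nlinarith [sq_nonneg (e + (y + E))]
  have h3 : s ^ 2 * e ^ 2 * ‖D‖ ^ 2 ≤ a * s * e ^ 2 := by
    calc s ^ 2 * e ^ 2 * ‖D‖ ^ 2 ≤ s ^ 2 * e ^ 2 * (κ + 1) ^ 2 := by gcongr
      _ = (s * (κ + 1) ^ 2) * (s * e ^ 2) := by ring
      _ ≤ a * (s * e ^ 2) := by gcongr
      _ = _ := by ring
  have h4 := mul_le_mul_of_nonneg_left h2 (by positivity : 0 ≤ 2 * a * s)
  have ha1 : a ≤ 1 := by simp only [a]; linarith
  have h5 : a ^ 2 * ‖W‖ ^ 2 ≤ 1 * ‖W‖ ^ 2 := by gcongr; nlinarith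
  have h6 : a * s ≤ 1 * s := by gcongr
  linarith

/-- The linear update is nonexpansive in the parameters for a fixed sample, so errors of
linearization only add up over the steps. -/
theorem norm_nearlyLinear_step_sub_le {W V Φ D : H} {v y s lam κ L R : ℝ} (hΦ : ‖Φ‖ ≤ κ)
    (hD : ‖D - Φ‖ ≤ L * ‖W‖) (hv : |v - inner ℝ W Φ| ≤ L * ‖W‖ ^ 2) (hy : |y| ≤ 1)
    (hL1 : L * ‖W‖ ≤ 1) (hL : 0 ≤ L) (hs : 0 ≤ s) (hlam : 0 ≤ lam)
    (hsκ : s * (κ + 1) ^ 2 ≤ 1 - s * lam) (hR : ‖W‖ ^ 2 ≤ R) :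
    ‖((1 - s * lam) • W - (s * (v - y)) • D)
        - ((1 - s * lam) • V - (s * (inner ℝ V Φ - y)) • Φ)‖
      ≤ ‖W - V‖ + s * (L * (2 * κ + 2) * (R + 1)) := by
  have hκ : 0 ≤ κ := (norm_nonneg _).trans hΦ
  have ha0 : 0 ≤ 1 - s * lam := le_trans (by positivity) hsκ
  have hsl : 0 ≤ s * lam := mul_nonneg hs hlam
  set a := 1 - s * lam
  set p := inner ℝ (W - V) Φ with hp
  have hDn : ‖D‖ ≤ κ + 1 := by
    have h1 := norm_add_le (D - Φ) Φ
    rw [sub_add_cancel] at h1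
    linarith
  have hsplit : (a • W - (s * (v - y)) • D) - (a • V - (s * (inner ℝ V Φ - y)) • Φ)
      = (a • (W - V) - (s * p) • Φ)
        - s • ((v - inner ℝ W Φ) • D + (inner ℝ W Φ - y) • (D - Φ)) := by
    rw [hp, inner_sub_left]; module
  have h1 : ‖a • (W - V) - (s * p) • Φ‖ ≤ ‖W - V‖ := by
    refine le_of_sq_le_sq ?_ (norm_nonneg _)
    have e1 : ‖a • (W - V) - (s * p) • Φ‖ ^ 2
        = a ^ 2 * ‖W - V‖ ^ 2 - 2 * a * s * p ^ 2 + s ^ 2 * p ^ 2 * ‖Φ‖ ^ 2 := by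
      rw [norm_sub_sq_real, norm_smul, norm_smul, inner_smul_left, inner_smul_right]
      simp only [mul_pow, Real.norm_eq_abs, sq_abs, abs_mul, conj_trivial]
      rw [← hp]; ring
    have e2 : s ^ 2 * p ^ 2 * ‖Φ‖ ^ 2 ≤ a * s * p ^ 2 := by
      calc s ^ 2 * p ^ 2 * ‖Φ‖ ^ 2 ≤ s ^ 2 * p ^ 2 * (κ + 1) ^ 2 := by gcongr; linarith
        _ = (s * (κ + 1) ^ 2) * (s * p ^ 2) := by ring
        _ ≤ a * (s * p ^ 2) := by gcongr
        _ = _ := by ring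
    have ha1 : a ≤ 1 := by simp only [a]; linarith
    have e3 : a ^ 2 * ‖W - V‖ ^ 2 ≤ 1 * ‖W - V‖ ^ 2 := by gcongr; nlinarith
    have e4 : 0 ≤ a * s * p ^ 2 := by positivity
    rw [e1]; linarith
  have h2 : ‖(v - inner ℝ W Φ) • D + (inner ℝ W Φ - y) • (D - Φ)‖ ≤ L * (2 * κ + 2) * (R + 1) := by
    have hWΦ : |inner ℝ W Φ - y| ≤ κ * ‖W‖ + 1 := by
      have e1 := abs_sub (inner ℝ W Φ) y
      have e2 := abs_real_inner_le_norm W Φ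
      have e3 : ‖W‖ * ‖Φ‖ ≤ ‖W‖ * κ := by gcongr
      linarith
    have hW1 : ‖W‖ ≤ R + 1 := by nlinarith [sq_nonneg (‖W‖ - 1)]
    calc _ ≤ ‖(v - inner ℝ W Φ) • D‖ + ‖(inner ℝ W Φ - y) • (D - Φ)‖ := norm_add_le _ _
      _ ≤ (L * ‖W‖ ^ 2) * (κ + 1) + (κ * ‖W‖ + 1) * (L * ‖W‖) := by
          rw [norm_smul, norm_smul, Real.norm_eq_abs, Real.norm_eq_abs]
          gcongr
      _ = L * ((2 * κ + 1) * ‖W‖ ^ 2 + ‖W‖) := by ring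
      _ ≤ L * ((2 * κ + 1) * (R + 1) + (R + 1)) := by gcongr; linarith
      _ = _ := by ring
  rw [hsplit]
  refine (norm_sub_le _ _).trans ?_
  rw [norm_smul, Real.norm_of_nonneg hs]
  gcongr

end Coupling

/-! ### The parameter space of the network -/

section Network

variable {d M : ℕ}

/-- The Euclidean space of the parameters of one neuron. -/
abbrev NeuronSpace (d : ℕ) : Type := WithLp 2 (ℝ × WithLp 2 (Inp d × ℝ))

/-- The Euclidean space of all parameters. -/
abbrev ParamSpace (d M : ℕ) : Type := PiLp 2 fun _ : Fin M => NeuronSpace d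

/-- The parameters of one neuron as a vector. -/
def neuron (a : ℝ) (v : Inp d) (c : ℝ) : NeuronSpace d := WithLp.toLp 2 (a, WithLp.toLp 2 (v, c))

theorem inner_neuron (a a' c c' : ℝ) (v v' : Inp d) :
    inner ℝ (neuron a v c) (neuron a' v' c') = a * a' + (inner ℝ v v' + c * c') := by
  simp [neuron, WithLp.prod_inner_apply, mul_comm]

theorem norm_neuron_sq (a c : ℝ) (v : Inp d) :
    ‖neuron a v c‖ ^ 2 = a ^ 2 + (‖v‖ ^ 2 + c ^ 2) := by
  rw [← real_inner_self_eq_norm_sq, inner_neuron, real_inner_self_eq_norm_sq]; ring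

theorem neuron_sub (a a' c c' : ℝ) (v v' : Inp d) :
    neuron a v c - neuron a' v' c' = neuron (a - a') (v - v') (c - c') := rfl

theorem smul_neuron (s a c : ℝ) (v : Inp d) :
    s • neuron a v c = neuron (s * a) (s • v) (s * c) := rfl

theorem norm_neuron_le (a c : ℝ) (v : Inp d) : ‖neuron a v c‖ ≤ |a| + ‖v‖ + |c| := by
  refine le_of_sq_le_sq ?_ (by positivity)
  rw [norm_neuron_sq, ← sq_abs a, ← sq_abs c]
  nlinarith [mul_nonneg (abs_nonneg a) (norm_nonneg v), mul_nonneg (abs_nonneg a) (abs_nonneg c),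
    mul_nonneg (norm_nonneg v) (abs_nonneg c)]

theorem le_norm_neuron (a c : ℝ) (v : Inp d) :
    |a| ≤ ‖neuron a v c‖ ∧ ‖v‖ ≤ ‖neuron a v c‖ ∧ |c| ≤ ‖neuron a v c‖ := by
  have h := norm_neuron_sq a c v
  refine ⟨?_, ?_, ?_⟩ <;> refine le_of_sq_le_sq ?_ (norm_nonneg _) <;> rw [h] <;>
    (try rw [sq_abs]) <;> nlinarith [sq_nonneg a, sq_nonneg c, sq_nonneg ‖v‖]

/-- The parameters as a vector. -/
def Params.vec (Θ : Params d M) : ParamSpace d M :=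
  WithLp.toLp 2 fun r => neuron (Θ.a r) (Θ.B r) (Θ.c r)

/-- The argument of the activation function in neuron `r`. -/
noncomputable def preact (γ : ℝ) (Θ : Params d M) (x : Inp d) (r : Fin M) : ℝ :=
  inner ℝ (Θ.B r) x + γ * Θ.c r

/-- The gradient of the network with respect to its parameters. -/
noncomputable def networkGrad (σ : ℝ → ℝ) (γ : ℝ) (Θ : Params d M) (x : Inp d) : ParamSpace d M :=
  (1 / Real.sqrt M) • WithLp.toLp 2 fun r => neuron (σ (preact γ Θ x r))
    ((Θ.a r * deriv σ (preact γ Θ x r)) • x) (Θ.a r * γ * deriv σ (preact γ Θ x r))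

/-- In terms of the displacement the ridge term is plain shrinkage, so the step has the shape of
`linStep`. -/
theorem vec_sgdStep (σ : ℝ → ℝ) (γ lam s : ℝ) (Θ₀ Θ : Params d M) (z : Inp d × ℝ) :
    (sgdStep σ γ lam s Θ₀ Θ z).vec - Θ₀.vec
      = (1 - s * lam) • (Θ.vec - Θ₀.vec)
        - (s * (network σ γ Θ z.1 - z.2)) • networkGrad σ γ Θ z.1 := by
  have h : (sgdStep σ γ lam s Θ₀ Θ z).vec = Θ.vec
      - (s * (network σ γ Θ z.1 - z.2)) • networkGrad σ γ Θ z.1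
      - (s * lam) • (Θ.vec - Θ₀.vec) := by
    ext1 r
    change neuron _ _ _ = neuron _ _ _ - (s * (network σ γ Θ z.1 - z.2)) • ((1 / Real.sqrt M) •
      neuron _ _ _) - (s * lam) • (neuron _ _ _ - neuron _ _ _)
    simp only [neuron_sub, smul_neuron, smul_smul]
    simp only [sgdStep, preact]
  rw [h]; module

variable {σ : ℝ → ℝ} {C γ : ℝ}

theorem IsSmoothActivation.lipschitz (hσ : IsSmoothActivation σ C) (u u₀ : ℝ) :
    |σ u - σ u₀| ≤ C * |u - u₀| := by
  have := Convex.norm_image_sub_le_of_norm_deriv_le (f := σ) (s := univ) (C := C)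
    (fun x _ => hσ.diff x) (fun x _ => hσ.deriv_le x) convex_univ (mem_univ u₀) (mem_univ u)
  simpa using this

theorem IsSmoothActivation.lipschitz_deriv (hσ : IsSmoothActivation σ C) (u u₀ : ℝ) :
    |deriv σ u - deriv σ u₀| ≤ C * |u - u₀| := by
  have := Convex.norm_image_sub_le_of_norm_deriv_le (f := deriv σ) (s := univ) (C := C)
    (fun x _ => hσ.diff_deriv x) (fun x _ => hσ.deriv2_le x) convex_univ (mem_univ u₀) (mem_univ u)
  simpa using this

theorem IsSmoothActivation.taylor (hσ : IsSmoothActivation σ C) (u u₀ : ℝ) :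
    |σ u - σ u₀ - deriv σ u₀ * (u - u₀)| ≤ C * |u - u₀| ^ 2 := by
  have hC := hσ.pos
  have hd : ∀ x, HasDerivAt (fun x => σ x - deriv σ u₀ * x) (deriv σ x - deriv σ u₀) x := fun x => by
    have := (hσ.diff x).hasDerivAt.fun_sub ((hasDerivAt_id' x).const_mul (deriv σ u₀))
    simpa using this
  have := Convex.norm_image_sub_le_of_norm_hasDerivWithin_le (f := fun x => σ x - deriv σ u₀ * x)
    (f' := fun x => deriv σ x - deriv σ u₀) (s := segment ℝ u₀ u) (C := C * |u - u₀|)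
    (fun x _ => (hd x).hasDerivWithinAt) (fun x hx => by
      refine (hσ.lipschitz_deriv x u₀).trans ?_
      rw [segment_eq_uIcc] at hx
      exact mul_le_mul_of_nonneg_left (abs_sub_left_of_mem_uIcc hx) hC.le)
    (convex_segment _ _) (left_mem_segment ℝ u₀ u) (right_mem_segment ℝ u₀ u)
  simp only [Real.norm_eq_abs] at this
  calc _ = |σ u - deriv σ u₀ * u - (σ u₀ - deriv σ u₀ * u₀)| := by congr 1; ring
    _ ≤ C * |u - u₀| * |u - u₀| := this
    _ = _ := by ring

theorem abs_preact_sub_le (hγ : γ ∈ Icc (0 : ℝ) 1) (Θ₀ Θ : Params d M) {x : Inp d} (hx : ‖x‖ ≤ 1)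
    (r : Fin M) : |preact γ Θ x r - preact γ Θ₀ x r| ≤ 2 * ‖(Θ.vec - Θ₀.vec) r‖ := by
  have h1 : preact γ Θ x r - preact γ Θ₀ x r
      = inner ℝ (Θ.B r - Θ₀.B r) x + γ * (Θ.c r - Θ₀.c r) := by
    simp only [preact, inner_sub_left]; ring
  obtain ⟨-, h2, h3⟩ := le_norm_neuron (Θ.a r - Θ₀.a r) (Θ.c r - Θ₀.c r) (Θ.B r - Θ₀.B r)
  change ‖Θ.B r - Θ₀.B r‖ ≤ ‖(Θ.vec - Θ₀.vec) r‖ at h2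
  change |Θ.c r - Θ₀.c r| ≤ ‖(Θ.vec - Θ₀.vec) r‖ at h3
  rw [h1]
  calc _ ≤ |inner ℝ (Θ.B r - Θ₀.B r) x| + |γ * (Θ.c r - Θ₀.c r)| := abs_add_le _ _
    _ ≤ ‖Θ.B r - Θ₀.B r‖ * 1 + 1 * |Θ.c r - Θ₀.c r| := by
        rw [abs_mul, abs_of_nonneg hγ.1]
        gcongr
        · exact (abs_real_inner_le_norm _ _).trans (by gcongr)
        · exact hγ.2
    _ ≤ _ := by linarith

/-- The gradient of the network is Lipschitz at an initialization with unit output weights. -/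
theorem norm_networkGrad_sub_le (hσ : IsSmoothActivation σ C) (hγ : γ ∈ Icc (0 : ℝ) 1)
    {Θ₀ : Params d M} (hΘ₀ : ∀ r, |Θ₀.a r| = 1) (Θ : Params d M) {x : Inp d} (hx : ‖x‖ ≤ 1) :
    ‖networkGrad σ γ Θ x - networkGrad σ γ Θ₀ x‖ ≤ 8 * C / Real.sqrt M * ‖Θ.vec - Θ₀.vec‖ := by
  have hC := hσ.pos
  rw [networkGrad, networkGrad, ← smul_sub, norm_smul, Real.norm_of_nonneg (by positivity)]
  suffices h : ‖(WithLp.toLp 2 fun r => neuron (σ (preact γ Θ x r))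
        ((Θ.a r * deriv σ (preact γ Θ x r)) • x) (Θ.a r * γ * deriv σ (preact γ Θ x r))
          : ParamSpace d M)
      - WithLp.toLp 2 fun r => neuron (σ (preact γ Θ₀ x r))
        ((Θ₀.a r * deriv σ (preact γ Θ₀ x r)) • x) (Θ₀.a r * γ * deriv σ (preact γ Θ₀ x r))‖
      ≤ 8 * C * ‖Θ.vec - Θ₀.vec‖ by
    calc _ ≤ 1 / Real.sqrt M * (8 * C * ‖Θ.vec - Θ₀.vec‖) := by gcongr
      _ = _ := by ring
  refine le_of_sq_le_sq ?_ (by positivity)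
  rw [mul_pow, PiLp.norm_sq_eq_of_L2, PiLp.norm_sq_eq_of_L2, Finset.mul_sum]
  refine Finset.sum_le_sum fun r _ => ?_
  rw [← mul_pow]
  refine pow_le_pow_left₀ (norm_nonneg _) ?_ 2
  have hu := abs_preact_sub_le hγ Θ₀ Θ hx r
  obtain ⟨ha, -, -⟩ := le_norm_neuron (Θ.a r - Θ₀.a r) (Θ.c r - Θ₀.c r) (Θ.B r - Θ₀.B r)
  change |Θ.a r - Θ₀.a r| ≤ ‖(Θ.vec - Θ₀.vec) r‖ at ha
  set n := ‖(Θ.vec - Θ₀.vec) r‖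
  set u := preact γ Θ x r
  set u₀ := preact γ Θ₀ x r
  have h1 : |σ u - σ u₀| ≤ C * (2 * n) := (hσ.lipschitz u u₀).trans (by gcongr)
  have h2 : |Θ.a r * deriv σ u - Θ₀.a r * deriv σ u₀| ≤ 3 * C * n := by
    have e1 : Θ.a r * deriv σ u - Θ₀.a r * deriv σ u₀
        = (Θ.a r - Θ₀.a r) * deriv σ u + Θ₀.a r * (deriv σ u - deriv σ u₀) := by ring
    rw [e1]
    calc _ ≤ |(Θ.a r - Θ₀.a r) * deriv σ u| + |Θ₀.a r * (deriv σ u - deriv σ u₀)| := abs_add_le _ _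
      _ ≤ n * C + 1 * (C * (2 * n)) := by
          rw [abs_mul, abs_mul, hΘ₀ r]
          gcongr
          · exact hσ.deriv_le u
          · exact (hσ.lipschitz_deriv u u₀).trans (by gcongr)
      _ = _ := by ring
  change ‖neuron (σ u) ((Θ.a r * deriv σ u) • x) (Θ.a r * γ * deriv σ u)
    - neuron (σ u₀) ((Θ₀.a r * deriv σ u₀) • x) (Θ₀.a r * γ * deriv σ u₀)‖ ≤ 8 * C * n
  rw [neuron_sub]
  refine (norm_neuron_le _ _ _).trans ?_
  have h3 : ‖(Θ.a r * deriv σ u) • x - (Θ₀.a r * deriv σ u₀) • x‖ ≤ 3 * C * n := by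
    rw [← sub_smul, norm_smul, Real.norm_eq_abs]
    calc _ ≤ (3 * C * n) * 1 := by gcongr
      _ = _ := mul_one _
  have h4 : |Θ.a r * γ * deriv σ u - Θ₀.a r * γ * deriv σ u₀| ≤ 3 * C * n := by
    have e1 : Θ.a r * γ * deriv σ u - Θ₀.a r * γ * deriv σ u₀
        = γ * (Θ.a r * deriv σ u - Θ₀.a r * deriv σ u₀) := by ring
    rw [e1, abs_mul, abs_of_nonneg hγ.1]
    calc _ ≤ 1 * (3 * C * n) := by gcongr; exact hγ.2
      _ = _ := one_mul _
  linarith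

/-- The error of the linearization of the network at an initialization with unit output weights. -/
theorem abs_network_sub_linear_le (hσ : IsSmoothActivation σ C) (hγ : γ ∈ Icc (0 : ℝ) 1)
    {Θ₀ : Params d M} (hΘ₀ : ∀ r, |Θ₀.a r| = 1) (Θ : Params d M) {x : Inp d} (hx : ‖x‖ ≤ 1) :
    |network σ γ Θ x - network σ γ Θ₀ x - inner ℝ (Θ.vec - Θ₀.vec) (networkGrad σ γ Θ₀ x)|
      ≤ 8 * C / Real.sqrt M * ‖Θ.vec - Θ₀.vec‖ ^ 2 := by
  have hC := hσ.pos
  -- Each neuron contributes a product of two first-order increments and a Taylor remainder of the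
  -- activation, both quadratic in its own displacement.
  have h0 : network σ γ Θ x - network σ γ Θ₀ x - inner ℝ (Θ.vec - Θ₀.vec) (networkGrad σ γ Θ₀ x)
      = 1 / Real.sqrt M * ∑ r, ((Θ.a r - Θ₀.a r) * (σ (preact γ Θ x r) - σ (preact γ Θ₀ x r))
        + Θ₀.a r * (σ (preact γ Θ x r) - σ (preact γ Θ₀ x r)
          - deriv σ (preact γ Θ₀ x r) * (preact γ Θ x r - preact γ Θ₀ x r))) := by
    have e1 : inner ℝ (Θ.vec - Θ₀.vec) (networkGrad σ γ Θ₀ x)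
        = 1 / Real.sqrt M * ∑ r, ((Θ.a r - Θ₀.a r) * σ (preact γ Θ₀ x r)
          + Θ₀.a r * deriv σ (preact γ Θ₀ x r) * (preact γ Θ x r - preact γ Θ₀ x r)) := by
      rw [networkGrad, inner_smul_right, PiLp.inner_apply]
      congr 1
      refine Finset.sum_congr rfl fun r _ => ?_
      change inner ℝ (neuron (Θ.a r - Θ₀.a r) (Θ.B r - Θ₀.B r) (Θ.c r - Θ₀.c r)) (neuron _ _ _) = _
      rw [inner_neuron, inner_smul_right]
      simp only [preact, inner_sub_left]
      ring
    rw [e1, network, network, ← mul_sub, ← mul_sub, ← Finset.sum_sub_distrib,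
      ← Finset.sum_sub_distrib]
    congr 1
    refine Finset.sum_congr rfl fun r _ => ?_
    simp only [preact]
    ring
  rw [h0, abs_mul, abs_of_nonneg (by positivity : 0 ≤ 1 / Real.sqrt M)]
  calc _ ≤ 1 / Real.sqrt M * (8 * C * ‖Θ.vec - Θ₀.vec‖ ^ 2) := by
        gcongr
        rw [PiLp.norm_sq_eq_of_L2, Finset.mul_sum]
        refine (Finset.abs_sum_le_sum_abs _ _).trans (Finset.sum_le_sum fun r _ => ?_)
        have hu := abs_preact_sub_le hγ Θ₀ Θ hx r
        obtain ⟨ha, -, -⟩ := le_norm_neuron (Θ.a r - Θ₀.a r) (Θ.c r - Θ₀.c r) (Θ.B r - Θ₀.B r)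
        change |Θ.a r - Θ₀.a r| ≤ ‖(Θ.vec - Θ₀.vec) r‖ at ha
        set n := ‖(Θ.vec - Θ₀.vec) r‖
        set u := preact γ Θ x r
        set u₀ := preact γ Θ₀ x r
        calc _ ≤ |(Θ.a r - Θ₀.a r) * (σ u - σ u₀)|
              + |Θ₀.a r * (σ u - σ u₀ - deriv σ u₀ * (u - u₀))| := abs_add_le _ _
          _ ≤ n * (C * (2 * n)) + 1 * (C * (2 * n) ^ 2) := by
              rw [abs_mul, abs_mul, hΘ₀ r]
              gcongr
              · exact (hσ.lipschitz u u₀).trans (by gcongr)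
              · exact (hσ.taylor u u₀).trans (by gcongr)
          _ ≤ 8 * C * n ^ 2 := by nlinarith [mul_nonneg hC.le (sq_nonneg n)]
    _ = _ := by ring

end Network

/-! ### The tangent kernel -/

section Kernel

variable {d m : ℕ} {σ : ℝ → ℝ} {C γ : ℝ}

/-- The identity on the unit ball, extended by `0`. -/
noncomputable def clip (x : Inp d) : Inp d := if ‖x‖ ≤ 1 then x else 0

theorem clip_of_norm_le {x : Inp d} (hx : ‖x‖ ≤ 1) : clip x = x := if_pos hx

theorem norm_clip_le (x : Inp d) : ‖clip x‖ ≤ 1 := by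
  unfold clip; split_ifs with h
  · exact h
  · simp

theorem measurable_clip : Measurable (clip : Inp d → Inp d) :=
  Measurable.ite (measurableSet_le measurable_norm measurable_const) measurable_id measurable_const

/-- The contribution of a pair of neurons with input weight `w` to the tangent kernel. -/
noncomputable def tangent (σ : ℝ → ℝ) (γ : ℝ) (w x x' : Inp d) : ℝ :=
  σ (inner ℝ w x) * σ (inner ℝ w x')
    + (inner ℝ x x' + γ ^ 2) * (deriv σ (inner ℝ w x) * deriv σ (inner ℝ w x'))

theorem kappa_sq (C : ℝ) : kappa C ^ 2 = 4 + 2 * C ^ 2 := Real.sq_sqrt (by positivity)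

theorem two_le_kappa (C : ℝ) : 2 ≤ kappa C :=
  Real.le_sqrt_of_sq_le (by nlinarith [sq_nonneg C])

theorem le_kappa (C : ℝ) : C ≤ kappa C :=
  Real.le_sqrt_of_sq_le (by nlinarith [sq_nonneg C])

theorem IsSmoothActivation.continuous (hσ : IsSmoothActivation σ C) : Continuous σ :=
  hσ.diff.continuous

theorem IsSmoothActivation.continuous_deriv (hσ : IsSmoothActivation σ C) : Continuous (deriv σ) :=
  hσ.diff_deriv.continuous

theorem abs_inner_le_one {x y : Inp d} (hx : ‖x‖ ≤ 1) (hy : ‖y‖ ≤ 1) : |inner ℝ x y| ≤ 1 :=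
  (abs_real_inner_le_norm x y).trans (mul_le_one₀ hx (norm_nonneg _) hy)

theorem IsSmoothActivation.abs_mul_le (hσ : IsSmoothActivation σ C) {u u' : ℝ} (hu : |u| ≤ 1)
    (hu' : |u'| ≤ 1) : |σ u * σ u'| ≤ 4 := by
  have h1 : |σ u| ≤ 2 := (hσ.growth u).trans (by linarith)
  have h2 : |σ u'| ≤ 2 := (hσ.growth u').trans (by linarith)
  rw [abs_mul]
  calc _ ≤ (2 : ℝ) * 2 := by gcongr
    _ = 4 := by norm_num

theorem IsSmoothActivation.abs_deriv_mul_le (hσ : IsSmoothActivation σ C) (u u' : ℝ) :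
    |deriv σ u * deriv σ u'| ≤ C ^ 2 := by
  have := hσ.pos
  rw [abs_mul, sq]
  gcongr
  exacts [hσ.deriv_le u, hσ.deriv_le u']

theorem abs_tangent_le (hσ : IsSmoothActivation σ C) (hγ : γ ∈ Icc (0 : ℝ) 1) {w x x' : Inp d}
    (hw : ‖w‖ ≤ 1) (hx : ‖x‖ ≤ 1) (hx' : ‖x'‖ ≤ 1) : |tangent σ γ w x x'| ≤ kappa C ^ 2 := by
  have h1 := hσ.abs_mul_le (abs_inner_le_one hw hx) (abs_inner_le_one hw hx')
  have h2 := hσ.abs_deriv_mul_le (inner ℝ w x) (inner ℝ w x')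
  have h3 : |inner ℝ x x' + γ ^ 2| ≤ 2 := by
    have e1 := abs_add_le (inner ℝ x x') (γ ^ 2)
    have e2 := abs_inner_le_one hx hx'
    have e3 : |γ ^ 2| ≤ 1 := by rw [abs_of_nonneg (sq_nonneg γ)]; nlinarith [hγ.1, hγ.2]
    linarith
  rw [kappa_sq, tangent]
  refine (abs_add_le _ _).trans (add_le_add h1 ?_)
  rw [abs_mul]
  gcongr

theorem abs_symInit_a (w : Fin m → Inp d) (r : Fin (m + m)) : |(symInit w).a r| = 1 := by
  refine Fin.addCases (fun i => ?_) (fun i => ?_) r <;>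
    simp only [symInit, Fin.append_left, Fin.append_right, abs_neg, abs_one]

/-- The output weights enter only through their squares, so the two copies of a neuron contribute
equally and `2/(m + m) = 1/m`. The random kernel is thus an average of `m` independent terms under
`initLaw`. -/
theorem inner_networkGrad_symInit (hm : 0 < m) (w : Fin m → Inp d) (x x' : Inp d) :
    inner ℝ (networkGrad σ γ (symInit w) x) (networkGrad σ γ (symInit w) x')
      = 1 / m * ∑ r, tangent σ γ (w r) x x' := by
  have hm0 : (0 : ℝ) < m := by exact_mod_cast hm
  rw [networkGrad, networkGrad, inner_smul_left, inner_smul_right, PiLp.inner_apply]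
  have h1 : ∀ r, inner ℝ (neuron (σ (preact γ (symInit w) x r))
        (((symInit w).a r * deriv σ (preact γ (symInit w) x r)) • x)
        ((symInit w).a r * γ * deriv σ (preact γ (symInit w) x r)))
      (neuron (σ (preact γ (symInit w) x' r))
        (((symInit w).a r * deriv σ (preact γ (symInit w) x' r)) • x')
        ((symInit w).a r * γ * deriv σ (preact γ (symInit w) x' r)))
      = tangent σ γ ((symInit w).B r) x x' := by
    intro r
    have ha : (symInit w).a r ^ 2 = 1 := by rw [← sq_abs, abs_symInit_a, one_pow]
    rw [inner_neuron, inner_smul_left, inner_smul_right, tangent]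
    have hc : (symInit w).c r = 0 := rfl
    simp only [preact, hc, mul_zero, add_zero, conj_trivial]
    linear_combination (inner ℝ x x' + γ ^ 2) * (deriv σ (inner ℝ ((symInit w).B r) x)
      * deriv σ (inner ℝ ((symInit w).B r) x')) * ha
  simp only [h1]
  rw [Fin.sum_univ_add]
  simp only [symInit, Fin.append_left, Fin.append_right, conj_trivial]
  rw [← mul_assoc]
  have h2 : 1 / Real.sqrt ((m + m : ℕ) : ℝ) * (1 / Real.sqrt ((m + m : ℕ) : ℝ)) = 1 / (m + m) := by
    rw [div_mul_div_comm, Real.mul_self_sqrt (by positivity)]; push_cast; ring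
  rw [h2]
  field_simp

theorem network_symInit (w : Fin m → Inp d) (x : Inp d) : network σ γ (symInit w) x = 0 := by
  rw [network, Fin.sum_univ_add]
  simp only [symInit, Fin.append_left, Fin.append_right, neg_mul, Finset.sum_neg_distrib,
    add_neg_cancel, mul_zero]

theorem continuous_networkGrad (hσ : IsSmoothActivation σ C) (Θ : Params d m) :
    Continuous (networkGrad σ γ Θ) := by
  have h1 := hσ.continuous
  have h2 := hσ.continuous_deriv
  unfold networkGrad neuron preact
  fun_prop

theorem isFeature_networkGrad (hσ : IsSmoothActivation σ C) (hγ : γ ∈ Icc (0 : ℝ) 1) (hm : 0 < m)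
    {w : Fin m → Inp d} (hw : ∀ r, ‖w r‖ ≤ 1) :
    IsFeature (fun x => networkGrad σ γ (symInit w) (clip x)) (kappa C) where
  meas := (continuous_networkGrad hσ _).comp_stronglyMeasurable measurable_clip.stronglyMeasurable
  bound := fun x => by
    have hm0 : (0 : ℝ) < m := by exact_mod_cast hm
    refine le_of_sq_le_sq ?_ (by linarith [two_le_kappa C])
    rw [← real_inner_self_eq_norm_sq, inner_networkGrad_symInit hm]
    calc _ ≤ 1 / m * ∑ _r : Fin m, kappa C ^ 2 := by
          gcongr with r
          exact (le_abs_self _).trans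
            (abs_tangent_le hσ hγ (hw r) (norm_clip_le x) (norm_clip_le x))
      _ = _ := by simp; field_simp
  pos := by linarith [two_le_kappa C]

theorem isProbabilityMeasure_sphereUniform (hd : 0 < d) :
    IsProbabilityMeasure (sphereUniform d) := by
  have : Nonempty (Fin d) := ⟨⟨0, hd⟩⟩
  have h0 : (volume : Measure (Inp d)).toSphere univ ≠ 0 := by
    rw [Ne, Measure.measure_univ_eq_zero]
    exact Measure.toSphere_ne_zero _
  refine ⟨?_⟩
  rw [sphereUniform, Measure.map_apply measurable_subtype_coe MeasurableSet.univ, preimage_univ,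
    Measure.smul_apply, smul_eq_mul, ENNReal.inv_mul_cancel h0 (measure_ne_top _ _)]

theorem ae_norm_sphereUniform : ∀ᵐ w ∂(sphereUniform d), ‖w‖ ≤ 1 := by
  rw [sphereUniform, ae_map_iff measurable_subtype_coe.aemeasurable
    (measurableSet_le measurable_norm measurable_const)]
  exact Filter.Eventually.of_forall fun w => by simp

theorem continuous_tangent (hσ : IsSmoothActivation σ C) (γ : ℝ) :
    Continuous fun p : Inp d × Inp d × Inp d => tangent σ γ p.1 p.2.1 p.2.2 := by
  have h1 := hσ.continuous
  have h2 := hσ.continuous_deriv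
  unfold tangent
  fun_prop

theorem integral_tangent (hd : 0 < d) (hσ : IsSmoothActivation σ C) {x x' : Inp d}
    (hx : ‖x‖ ≤ 1) (hx' : ‖x'‖ ≤ 1) :
    ∫ w, tangent σ γ (clip w) x x' ∂(sphereUniform d) = ntk σ γ x x' := by
  have := isProbabilityMeasure_sphereUniform hd
  have hc := hσ.continuous
  have hc' := hσ.continuous_deriv
  have h1 : Integrable (fun w => σ (inner ℝ w x) * σ (inner ℝ w x')) (sphereUniform d) := by
    refine Integrable.of_bound (Continuous.aestronglyMeasurable (by fun_prop)) 4 ?_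
    filter_upwards [ae_norm_sphereUniform] with w hw
    exact hσ.abs_mul_le (abs_inner_le_one hw hx) (abs_inner_le_one hw hx')
  have h2 : Integrable (fun w => deriv σ (inner ℝ w x) * deriv σ (inner ℝ w x'))
      (sphereUniform d) :=
    Integrable.of_bound (Continuous.aestronglyMeasurable (by fun_prop)) (C ^ 2)
      (Filter.Eventually.of_forall fun w => hσ.abs_deriv_mul_le _ _)
  rw [ntk, ← integral_const_mul, ← integral_add h1 (h2.const_mul _)]
  refine integral_congr_ae ?_
  filter_upwards [ae_norm_sphereUniform] with w hw
  rw [clip_of_norm_le hw, tangent]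

theorem measurable_tangent_clip (hσ : IsSmoothActivation σ C) (γ : ℝ) :
    Measurable fun p : Inp d × Inp d × Inp d =>
      tangent σ γ (clip p.1) (clip p.2.2) (clip p.2.1) := by
  have h : Measurable fun p : Inp d × Inp d × Inp d => (clip p.1, clip p.2.2, clip p.2.1) :=
    (measurable_clip.comp measurable_fst).prodMk
      ((measurable_clip.comp (measurable_snd.comp measurable_snd)).prodMk
        (measurable_clip.comp (measurable_fst.comp measurable_snd)))
  have h' : Measurable fun p : Inp d × Inp d × Inp d => tangent σ γ p.1 p.2.1 p.2.2 :=
    (continuous_tangent hσ γ).measurable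
  have := h'.comp h
  exact this

theorem abs_ntk_le (hd : 0 < d) (hσ : IsSmoothActivation σ C) (hγ : γ ∈ Icc (0 : ℝ) 1)
    {x x' : Inp d} (hx : ‖x‖ ≤ 1) (hx' : ‖x'‖ ≤ 1) : |ntk σ γ x x'| ≤ kappa C ^ 2 := by
  have := isProbabilityMeasure_sphereUniform hd
  rw [← integral_tangent hd hσ hx hx', ← Real.norm_eq_abs]
  have h := norm_integral_le_of_norm_le_const (μ := sphereUniform d)
    (f := fun w => tangent σ γ (clip w) x x') (C := kappa C ^ 2) (Filter.Eventually.of_forall fun w => abs_tangent_le hσ hγ (norm_clip_le w) hx hx')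
  simpa using h

theorem measurable_ntk_clip (hd : 0 < d) (hσ : IsSmoothActivation σ C) :
    Measurable fun p : Inp d × Inp d => ntk σ γ (clip p.2) (clip p.1) := by
  have := isProbabilityMeasure_sphereUniform hd
  have h : (fun p : Inp d × Inp d => ntk σ γ (clip p.2) (clip p.1))
      = fun p => ∫ w, tangent σ γ (clip w) (clip p.2) (clip p.1) ∂(sphereUniform d) := by
    funext p
    rw [integral_tangent hd hσ (norm_clip_le _) (norm_clip_le _)]
  rw [h]
  exact (StronglyMeasurable.integral_prod_left
    (measurable_tangent_clip hσ γ).stronglyMeasurable).measurable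

theorem isBddKernel_ntk (hd : 0 < d) (hσ : IsSmoothActivation σ C) (hγ : γ ∈ Icc (0 : ℝ) 1) :
    IsBddKernel (fun x x' : Inp d => ntk σ γ (clip x) (clip x')) (kappa C ^ 2) where
  meas := ((measurable_ntk_clip hd hσ).comp measurable_swap).stronglyMeasurable
  bound := fun x x' => abs_ntk_le hd hσ hγ (norm_clip_le x) (norm_clip_le x')

/-- The deviation of one summand of the random kernel from its mean. -/
noncomputable def tangentDev (σ : ℝ → ℝ) (γ : ℝ) (w : Inp d) (p : Inp d × Inp d) : ℝ :=
  tangent σ γ (clip w) (clip p.2) (clip p.1) - ntk σ γ (clip p.2) (clip p.1)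

theorem isCenteredField_tangentDev (hd : 0 < d) (hσ : IsSmoothActivation σ C)
    (hγ : γ ∈ Icc (0 : ℝ) 1) :
    IsCenteredField (sphereUniform d) (tangentDev σ γ) (2 * kappa C ^ 2) where
  meas := (measurable_tangent_clip hσ γ).sub ((measurable_ntk_clip hd hσ).comp measurable_snd)
  bound := fun w p => by
    have h1 := abs_tangent_le hσ hγ (norm_clip_le w) (norm_clip_le p.2) (norm_clip_le p.1)
    have h2 := abs_ntk_le hd hσ hγ (norm_clip_le p.2) (norm_clip_le p.1)
    have h3 := abs_sub (tangent σ γ (clip w) (clip p.2) (clip p.1)) (ntk σ γ (clip p.2) (clip p.1))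
    rw [tangentDev]
    linarith
  mean := fun p => by
    have := isProbabilityMeasure_sphereUniform hd
    have hi : Integrable (fun w => tangent σ γ (clip w) (clip p.2) (clip p.1))
        (sphereUniform d) :=
      Integrable.of_bound ((measurable_tangent_clip hσ γ).comp
        measurable_prodMk_right).aestronglyMeasurable (kappa C ^ 2)
        (Filter.Eventually.of_forall fun w =>
          abs_tangent_le hσ hγ (norm_clip_le w) (norm_clip_le p.2) (norm_clip_le p.1))
    simp only [tangentDev]
    rw [integral_sub hi (integrable_const _),
      integral_tangent hd hσ (norm_clip_le _) (norm_clip_le _)]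
    simp
  pos := by have := two_le_kappa C; positivity

theorem kernelSq_networkGrad (hd : 0 < d) (hσ : IsSmoothActivation σ C) (hγ : γ ∈ Icc (0 : ℝ) 1)
    (hm : 0 < m) (ν : Measure (Inp d)) [IsProbabilityMeasure ν] {w : Fin m → Inp d}
    (hw : ∀ r, ‖w r‖ ≤ 1) :
    kernelSq ν (fun x x' => inner ℝ (networkGrad σ γ (symInit w) (clip x))
      (networkGrad σ γ (symInit w) (clip x')) - ntk σ γ (clip x) (clip x'))
      = fieldSq (ν.prod ν) (tangentDev σ γ) m w / m ^ 2 := by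
  have hm0 : (0 : ℝ) < m := by exact_mod_cast hm
  have := isProbabilityMeasure_sphereUniform hd
  have hh := isCenteredField_tangentDev (d := d) hd hσ hγ
  -- The pair is `(x', x)` because the outer integral in `kernelSq` runs over `x'`.
  have h1 : ∀ x x' : Inp d, inner ℝ (networkGrad σ γ (symInit w) (clip x))
      (networkGrad σ γ (symInit w) (clip x')) - ntk σ γ (clip x) (clip x')
      = 1 / m * ∑ r, tangentDev σ γ (w r) (x', x) := by
    intro x x'
    rw [inner_networkGrad_symInit hm]
    simp only [tangentDev, clip_of_norm_le (hw _), Finset.sum_sub_distrib, mul_sub]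
    simp
    field_simp
  have hmeas : Measurable fun p => (∑ r, tangentDev σ γ (w r) p) ^ 2 :=
    ((hh.measurable_sum m).comp measurable_prodMk_left).pow_const 2
  have hintegr : Integrable (fun p => (∑ r, tangentDev σ γ (w r) p) ^ 2) (ν.prod ν) := by
    refine Integrable.of_bound hmeas.aestronglyMeasurable ((m * (2 * kappa C ^ 2)) ^ 2)
      (Filter.Eventually.of_forall fun p => ?_)
    rw [Real.norm_eq_abs, abs_pow]
    refine pow_le_pow_left₀ (abs_nonneg _) ?_ 2
    calc _ ≤ ∑ r, |tangentDev σ γ (w r) p| := Finset.abs_sum_le_sum_abs _ _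
      _ ≤ ∑ _r : Fin m, 2 * kappa C ^ 2 := Finset.sum_le_sum fun r _ => hh.bound _ _
      _ = _ := by simp
  rw [kernelSq, fieldSq, integral_prod _ hintegr]
  simp only [h1, mul_pow, integral_const_mul]
  ring

end Kernel

/-! ### The constants -/

section Constants

variable {η θ κ lam : ℝ}

theorem le_inv_etaBound_sub (hκ : 0 ≤ κ) (hθ : 1 / 2 < θ) (hθ1 : θ < 1) :
    208 * (1 + κ) ^ 4 / (1 - θ) ≤ 208 * (1 + κ) ^ 4 / ((1 - (2 : ℝ) ^ (θ - 1)) * (2 * θ - 1))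
      * (Real.log (8 / (1 - θ)) + 1 / (1 - θ)) := by
  have h1 : 0 < 1 - θ := by linarith
  have h2 : (2 : ℝ) ^ (θ - 1) < 1 :=
    Real.rpow_lt_one_of_one_lt_of_neg (by norm_num) (by linarith)
  have h3 : (0 : ℝ) < (2 : ℝ) ^ (θ - 1) := by positivity
  have h4 : 0 < (1 - (2 : ℝ) ^ (θ - 1)) * (2 * θ - 1) :=
    mul_pos (by linarith) (by linarith)
  have h5 : (1 - (2 : ℝ) ^ (θ - 1)) * (2 * θ - 1) ≤ 1 :=
    mul_le_one₀ (by linarith) (by linarith) (by linarith)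
  have h6 : 0 ≤ Real.log (8 / (1 - θ)) :=
    Real.log_nonneg (by rw [le_div_iff₀ h1]; linarith)
  calc 208 * (1 + κ) ^ 4 / (1 - θ) = 208 * (1 + κ) ^ 4 / 1 * (0 + 1 / (1 - θ)) := by ring
    _ ≤ _ := by gcongr

/-- The step size bound is `1/(lam + K)` with `K` independent of `lam`; beyond this only the size of
`K` matters. -/
theorem exists_stepConstant (hκ : 0 ≤ κ) (hθ : 1 / 2 < θ) (hθ1 : θ < 1) :
    ∃ K : ℝ, 208 * (1 + κ) ^ 4 / (1 - θ) ≤ K ∧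
      ∀ lam η : ℝ, 0 < lam → η < etaBound κ lam θ → η * (lam + K) < 1 := by
  refine ⟨_, le_inv_etaBound_sub hκ hθ hθ1, fun lam η hlam h => ?_⟩
  have h1 : 0 < 1 - θ := by linarith
  have hK := le_inv_etaBound_sub hκ hθ hθ1
  have hpos : 0 < 208 * (1 + κ) ^ 4 / (1 - θ) := by positivity
  rw [etaBound] at h
  rwa [← lt_inv_mul_iff₀' (by linarith), mul_one]

theorem le_of_widthBound_le {T M : ℕ} (h : widthBound T lam θ ≤ M) :
    (T : ℝ) ^ (6 - 5 * θ) ≤ M ∧ (T : ℝ) ^ (2 * θ) ≤ M ∧ (T : ℝ) ^ θ / lam ^ 2 ≤ M := by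
  have h1 := Nat.ceil_le.1 h
  exact ⟨(le_max_left _ _).trans ((le_max_left _ _).trans h1),
    (le_max_right _ _).trans ((le_max_left _ _).trans h1), (le_max_right _ _).trans h1⟩

/-- This is where `T^{6-5θ}` enters: the linearization error of order `T^{2(1-θ)} / √M` must be at
most `T^{-θ/2}`. -/
theorem rpow_sq_le_sqrt_width {T M : ℕ} (hT : 0 < T) (hθ1 : θ < 1)
    (hM : (T : ℝ) ^ (6 - 5 * θ) ≤ M) :
    ((T : ℝ) ^ (1 - θ)) ^ 2 ≤ (T : ℝ) ^ (-(θ / 2)) * Real.sqrt M := by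
  have hT1 : (1 : ℝ) ≤ T := by exact_mod_cast hT
  have hT0 : (0 : ℝ) < T := by linarith
  have h1 : (T : ℝ) ^ (3 - 5 / 2 * θ) ≤ Real.sqrt M := by
    refine Real.le_sqrt_of_sq_le ?_
    rw [← Real.rpow_natCast, ← Real.rpow_mul hT0.le]
    convert hM using 2
    push_cast; ring
  calc ((T : ℝ) ^ (1 - θ)) ^ 2 = (T : ℝ) ^ (2 * (1 - θ)) := by
        rw [← Real.rpow_natCast, ← Real.rpow_mul hT0.le]; push_cast; ring_nf
    _ ≤ (T : ℝ) ^ (-(θ / 2) + (3 - 5 / 2 * θ)) :=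
        Real.rpow_le_rpow_of_exponent_le hT1 (by linarith)
    _ = (T : ℝ) ^ (-(θ / 2)) * (T : ℝ) ^ (3 - 5 / 2 * θ) := Real.rpow_add hT0 _ _
    _ ≤ _ := by gcongr

end Constants

/-! ### The network against its linearization -/

section Linearization

variable {d m : ℕ} {σ : ℝ → ℝ} {C γ lam η θ : ℝ}

/-- One induction for both bounds: the first keeps the parameters in the ball where linearization is
accurate, which the second needs at every step. Both hold for every sequence of samples in range. -/
theorem sgd_near_linSgd (hσ : IsSmoothActivation σ C) (hγ : γ ∈ Icc (0 : ℝ) 1) (hm : 0 < m)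
    {w : Fin m → Inp d} (hw : ∀ r, ‖w r‖ ≤ 1) (hlam : 0 ≤ lam) (hη : 0 < η) (hθ : 0 < θ)
    (hstep : η * (lam + (kappa C + 1) ^ 2) ≤ 1) {R L : ℝ} {N : ℕ}
    (hL : L = 8 * C / Real.sqrt (m + m : ℕ))
    (hR : 4 * ∑ i ∈ Finset.range N, stepSize η θ i ≤ R) (hLR : L * R ≤ 1 / 2)
    (hLR2 : L ^ 2 * R ≤ 1) (t : ℕ) (ht : t ≤ N) (z : Fin t → Inp d × ℝ)
    (hz : ∀ i, ‖(z i).1‖ ≤ 1 ∧ |(z i).2| ≤ 1) :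
    ‖(sgd σ γ lam η θ (symInit w) t z).vec - (symInit w).vec‖ ^ 2
        ≤ 4 * ∑ i ∈ Finset.range t, stepSize η θ i ∧
      ‖(sgd σ γ lam η θ (symInit w) t z).vec - (symInit w).vec
        - linSgd (fun x => networkGrad σ γ (symInit w) (clip x)) lam (stepSize η θ) t z‖
        ≤ (∑ i ∈ Finset.range t, stepSize η θ i) * (L * (2 * kappa C + 2) * (R + 1)) := by
  have hC := hσ.pos
  have hL0 : 0 ≤ L := by rw [hL]; positivity
  induction t with
  | zero => simp [sgd, linSgd]
  | succ t ih =>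
    obtain ⟨ih1, ih2⟩ := ih (by omega) (Fin.init z) fun i => hz i.castSucc
    obtain ⟨hx, hy⟩ := hz (Fin.last t)
    set Θ₀ := symInit w
    set Θ := sgd σ γ lam η θ Θ₀ t (Fin.init z)
    set V := linSgd (fun x => networkGrad σ γ Θ₀ (clip x)) lam (stepSize η θ) t (Fin.init z)
    set s := stepSize η θ t
    have hs : 0 < s := stepSize_pos hη θ t
    have hsη : s ≤ η := stepSize_le hη hθ t
    have hWR : ‖Θ.vec - Θ₀.vec‖ ^ 2 ≤ R := by
      refine ih1.trans (le_trans ?_ hR)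
      gcongr
      · exact fun _ _ _ => (stepSize_pos hη θ _).le
      · omega
    have hstep' : s * (kappa C + 1) ^ 2 ≤ 1 - s * lam := by
      have : s * (lam + (kappa C + 1) ^ 2) ≤ η * (lam + (kappa C + 1) ^ 2) := by gcongr
      linarith
    have hL2 : L * ‖Θ.vec - Θ₀.vec‖ ^ 2 ≤ 1 / 2 := le_trans (by gcongr) hLR
    have hL1 : L * ‖Θ.vec - Θ₀.vec‖ ≤ 1 := by
      refine le_of_sq_le_sq ?_ zero_le_one
      rw [mul_pow, one_pow]
      exact le_trans (by gcongr) hLR2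
    have hΦ : ‖networkGrad σ γ Θ₀ (z (Fin.last t)).1‖ ≤ kappa C := by
      have := (isFeature_networkGrad hσ hγ hm hw).bound (z (Fin.last t)).1
      rwa [clip_of_norm_le hx] at this
    have hD := norm_networkGrad_sub_le hσ hγ (abs_symInit_a w) Θ hx
    have hv := abs_network_sub_linear_le hσ hγ (abs_symInit_a w) Θ hx
    rw [network_symInit, sub_zero] at hv
    rw [← hL] at hD hv
    have e1 : (sgd σ γ lam η θ Θ₀ (t + 1) z).vec - Θ₀.vec
        = (1 - s * lam) • (Θ.vec - Θ₀.vec)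
          - (s * (network σ γ Θ (z (Fin.last t)).1 - (z (Fin.last t)).2))
            • networkGrad σ γ Θ (z (Fin.last t)).1 := vec_sgdStep σ γ lam s Θ₀ Θ _
    have e2 : linSgd (fun x => networkGrad σ γ Θ₀ (clip x)) lam (stepSize η θ) (t + 1) z
        = (1 - s * lam) • V
          - (s * (inner ℝ V (networkGrad σ γ Θ₀ (z (Fin.last t)).1) - (z (Fin.last t)).2))
            • networkGrad σ γ Θ₀ (z (Fin.last t)).1 := by
      rw [linSgd, linStep]
      simp only [clip_of_norm_le hx]
      rfl
    rw [Finset.sum_range_succ, e1, e2]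
    refine ⟨?_, ?_⟩
    · have := norm_nearlyLinear_step_sq_le hΦ hD hv hy hL2 hL1 hs.le hlam hstep'
      linarith
    · have := norm_nearlyLinear_step_sub_le (V := V) hΦ hD hv hy hL1 hL0 hs.le hlam hstep' hWR
      linarith

/-- The width is large against the length of the path of the parameters. -/
theorem width_scale (hσ : IsSmoothActivation σ C) (hη : 0 < η) (hlam : 0 ≤ lam)
    (hθ : 0 < θ) (hθ1 : θ < 1) {K : ℝ} (hK : 208 * (1 + kappa C) ^ 4 / (1 - θ) ≤ K)
    (hηK : η * (lam + K) < 1) {T M : ℕ} (hT : 0 < T) (hM0 : 0 < M)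
    (hM : (T : ℝ) ^ (6 - 5 * θ) ≤ M) {S L t : ℝ} (hL : L = 8 * C / Real.sqrt M)
    (ht : t = (T : ℝ) ^ (1 - θ)) (hS : S = η * (t / (1 - θ))) :
    1 ≤ t ∧ S ≤ t ∧ L * (4 * S) ≤ 1 / 2 ∧ L ^ 2 * (4 * S) ≤ 1 ∧
      L * t ^ 2 ≤ 8 * C * (T : ℝ) ^ (-(θ / 2)) ∧ η * (lam + (kappa C + 1) ^ 2) ≤ 1 := by
  have hC := hσ.pos
  have hκ := two_le_kappa C
  have hκ2 := kappa_sq C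
  have hCκ := le_kappa C
  have hθ' : 0 < 1 - θ := by linarith
  have hT1 : (1 : ℝ) ≤ T := by exact_mod_cast hT
  have hsq := rpow_sq_le_sqrt_width hT hθ1 hM
  rw [← ht] at hsq
  set κ := kappa C
  set q := Real.sqrt (M : ℝ) with hq
  have ht1 : 1 ≤ t := ht ▸ Real.one_le_rpow hT1 hθ'.le
  have hp0 : 0 < (T : ℝ) ^ (-(θ / 2)) := by positivity
  have hp1 : (T : ℝ) ^ (-(θ / 2)) ≤ 1 :=
    Real.rpow_le_one_of_one_le_of_nonpos hT1 (by linarith)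
  have hq1 : 1 ≤ q := by
    rw [hq, Real.one_le_sqrt]
    exact_mod_cast hM0
  have htq : t ≤ q := by nlinarith
  set A := η / (1 - θ) with hA
  have hSA : S = A * t := by rw [hS, hA]; ring
  have hA0 : 0 < A := by positivity
  -- The step size bound leaves room for the activation constants: `32 A (1 + κ)⁴` and `128 A (1 +
  -- κ)⁴` appear below.
  have hA1 : 208 * (1 + κ) ^ 4 * A ≤ 1 := by
    have e1 : 208 * (1 + κ) ^ 4 * A = η * (208 * (1 + κ) ^ 4 / (1 - θ)) := by rw [hA]; ring
    rw [e1]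
    have e2 : η * (208 * (1 + κ) ^ 4 / (1 - θ)) ≤ η * (lam + K) := by gcongr; linarith
    linarith
  have hpow : (1 + κ) ^ 2 ≤ (1 + κ) ^ 4 := pow_le_pow_right₀ (by linarith) (by norm_num)
  have hκ42 : κ ^ 2 ≤ (1 + κ) ^ 4 := le_trans (by gcongr; linarith) hpow
  have hκ4 : κ ≤ (1 + κ) ^ 4 := le_trans (by nlinarith) hκ42
  have hAle : A ≤ 1 := by
    calc A = 1 * A := (one_mul A).symm
      _ ≤ 208 * (1 + κ) ^ 4 * A := by gcongr; linarith
      _ ≤ 1 := hA1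
  have hL0 : 0 ≤ L := by rw [hL]; positivity
  have hLt : L * t ≤ 8 * C := by
    rw [hL, div_mul_eq_mul_div, div_le_iff₀ (by linarith)]; gcongr
  have hL8 : L ≤ 8 * C := hL ▸ div_le_self (by positivity) hq1
  rw [hSA]
  refine ⟨ht1, by nlinarith, ?_, ?_, ?_, ?_⟩
  · calc L * (4 * (A * t)) = 4 * A * (L * t) := by ring
      _ ≤ 4 * A * (8 * C) := by gcongr
      _ ≤ 4 * A * (8 * (1 + κ) ^ 4) := by gcongr; linarith
      _ ≤ 1 / 2 := by linarith
  · calc L ^ 2 * (4 * (A * t)) = 4 * A * (L * (L * t)) := by ring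
      _ ≤ 4 * A * (8 * C * (8 * C)) := by gcongr
      _ = 256 * A * C ^ 2 := by ring
      _ ≤ 256 * A * ((1 + κ) ^ 4 / 2) := by gcongr; linarith
      _ ≤ 1 := by linarith
  · rw [hL, div_mul_eq_mul_div, div_le_iff₀ (by linarith)]
    calc 8 * C * t ^ 2 ≤ 8 * C * ((T : ℝ) ^ (-(θ / 2)) * q) := by gcongr
      _ = _ := by ring
  · have e1 : (κ + 1) ^ 2 ≤ K := by
      refine le_trans ?_ hK
      rw [le_div_iff₀ hθ']
      calc (κ + 1) ^ 2 * (1 - θ) ≤ (κ + 1) ^ 2 * 1 := by gcongr; linarith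
        _ = (1 + κ) ^ 2 := by ring
        _ ≤ 208 * (1 + κ) ^ 4 := by linarith [sq_nonneg (1 + κ)]
    have e2 : η * (lam + (κ + 1) ^ 2) ≤ η * (lam + K) := by gcongr
    linarith

/-- A constant for the distance of the trained network to the trained linear model. -/
noncomputable def linearizationConst (C : ℝ) : ℝ :=
  8 * C * (4 + 5 * kappa C * (2 * kappa C + 2))

theorem abs_network_sgd_sub_le (hσ : IsSmoothActivation σ C) (hγ : γ ∈ Icc (0 : ℝ) 1)
    (hm : 0 < m) {w : Fin m → Inp d} (hw : ∀ r, ‖w r‖ ≤ 1) (hlam : 0 ≤ lam) (hη : 0 < η)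
    (hθ : 0 < θ) (hθ1 : θ < 1) {K : ℝ} (hK : 208 * (1 + kappa C) ^ 4 / (1 - θ) ≤ K)
    (hηK : η * (lam + K) < 1) {T : ℕ} (hT : 0 < T) (hM : (T : ℝ) ^ (6 - 5 * θ) ≤ (m + m : ℕ))
    {z : Fin T → Inp d × ℝ} (hz : ∀ i, ‖(z i).1‖ ≤ 1 ∧ |(z i).2| ≤ 1) {x : Inp d}
    (hx : ‖x‖ ≤ 1) :
    |network σ γ (sgd σ γ lam η θ (symInit w) T z) x
      - inner ℝ (linSgd (fun x => networkGrad σ γ (symInit w) (clip x)) lam (stepSize η θ) T z)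
        (networkGrad σ γ (symInit w) (clip x))|
      ≤ linearizationConst C * (T : ℝ) ^ (-(θ / 2)) := by
  have hC := hσ.pos
  have hκ := two_le_kappa C
  obtain ⟨L, hL⟩ : ∃ L, L = 8 * C / Real.sqrt ((m + m : ℕ) : ℝ) := ⟨_, rfl⟩
  obtain ⟨t, ht⟩ : ∃ t, t = (T : ℝ) ^ (1 - θ) := ⟨_, rfl⟩
  obtain ⟨S, hS⟩ : ∃ S, S = η * (t / (1 - θ)) := ⟨_, rfl⟩
  obtain ⟨ht1, hSt, hLR, hLR2, hLt2, hstep⟩ :=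
    width_scale hσ hη hlam hθ hθ1 hK hηK hT (by omega) hM hL ht hS
  have hL0 : 0 ≤ L := by rw [hL]; positivity
  have hsum : ∑ i ∈ Finset.range T, stepSize η θ i ≤ S := by
    rw [hS, ht]; exact sum_stepSize_le hη hθ hθ1 T
  have hS0 : 0 ≤ S :=
    (Finset.sum_nonneg fun i _ => (stepSize_pos hη θ i).le).trans hsum
  obtain ⟨h1, h2⟩ := sgd_near_linSgd hσ hγ hm hw hlam hη hθ hstep hL
    (mul_le_mul_of_nonneg_left hsum (by norm_num)) hLR hLR2 T le_rfl z hz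
  have h3 := abs_network_sub_linear_le hσ hγ (abs_symInit_a w)
    (sgd σ γ lam η θ (symInit w) T z) hx
  rw [network_symInit, sub_zero, ← hL] at h3
  have hΦ := (isFeature_networkGrad hσ hγ hm hw).bound x
  rw [clip_of_norm_le hx] at hΦ ⊢
  generalize (sgd σ γ lam η θ (symInit w) T z).vec - (symInit w).vec = W at h1 h2 h3
  generalize linSgd (fun x => networkGrad σ γ (symInit w) (clip x)) lam (stepSize η θ) T z = V
    at h2 ⊢
  generalize networkGrad σ γ (symInit w) x = Φ at h3 hΦ ⊢
  generalize network σ γ (sgd σ γ lam η θ (symInit w) T z) x = g at h3 ⊢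
  have h4 : |inner ℝ W Φ - inner ℝ V Φ| ≤ ‖W - V‖ * kappa C := by
    rw [← inner_sub_left]
    exact (abs_real_inner_le_norm _ _).trans (by gcongr)
  have h5 : ‖W‖ ^ 2 ≤ 4 * t ^ 2 := by nlinarith
  have h6 : ‖W - V‖ ≤ t * (L * (2 * kappa C + 2) * (5 * t)) := by
    refine h2.trans ?_
    gcongr
    · linarith
    · linarith
  calc _ ≤ |g - inner ℝ W Φ| + |inner ℝ W Φ - inner ℝ V Φ| := abs_sub_le _ _ _
    _ ≤ L * (4 * t ^ 2) + (t * (L * (2 * kappa C + 2) * (5 * t))) * kappa C :=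
        add_le_add (h3.trans (by gcongr)) (h4.trans (by gcongr))
    _ = L * t ^ 2 * (4 + 5 * kappa C * (2 * kappa C + 2)) := by ring
    _ ≤ 8 * C * (T : ℝ) ^ (-(θ / 2)) * (4 + 5 * kappa C * (2 * kappa C + 2)) := by gcongr
    _ = _ := by rw [linearizationConst]; ring

end Linearization

/-! ### The regression problem -/

section Regression

variable {d : ℕ} {σ : ℝ → ℝ} {C γ : ℝ} {ρ : Measure (Inp d × ℝ)} [IsProbabilityMeasure ρ]

theorem isRegression_of_ae_eq {H : Type*} [NormedAddCommGroup H] [InnerProductSpace ℝ H]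
    [FiniteDimensional ℝ H] (hρ : IsBoundedData ρ) {Φ : Inp d → H} {κ : ℝ} (hΦ : IsFeature Φ κ)
    {G : Lp ℝ 2 ρ.fst} (hG : G =ᵐ[ρ.fst] regressionFn ρ) : IsRegression ρ Φ κ hΦ G where
  output := hρ.output.mono fun z hz => abs_le.2 hz
  mean := fun v => by
    have hκ := hΦ.pos
    have hmeas : StronglyMeasurable fun x => inner ℝ v (Φ x) :=
      stronglyMeasurable_const.inner hΦ.meas
    have hintegr : Integrable (fun z : Inp d × ℝ => z.2 * inner ℝ v (Φ z.1)) ρ := by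
      refine Integrable.of_bound (measurable_snd.stronglyMeasurable.mul
        (hmeas.comp_measurable measurable_fst)).aestronglyMeasurable (κ * ‖v‖) ?_
      filter_upwards [hρ.output] with z hz
      rw [norm_mul]
      calc _ ≤ 1 * (κ * ‖v‖) := by
            gcongr
            · exact abs_le.2 hz
            · exact hΦ.abs_inner_le v z.1
        _ = _ := one_mul _
    -- Disintegration: for fixed `x` the conditional mean of `y` is the regression function.
    rw [l2_inner_eq_of_ae G (featureOp_ae hΦ v), ← Measure.integral_condKernel hintegr]
    refine integral_congr_ae (hG.mono fun x hx => ?_)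
    simp only [hx, regressionFn, integral_mul_const]

/-- The clipped kernel is bounded everywhere and agrees with the tangent kernel on the support of
the inputs, so the eigensystem is unchanged. -/
theorem isDiagonalized_of_isEigensystem (hd : 0 < d) (hσ : IsSmoothActivation σ C)
    (hγ : γ ∈ Icc (0 : ℝ) 1) (hρ : IsBoundedData ρ) {μ : ℕ → ℝ} {φ : ℕ → Lp ℝ 2 ρ.fst}
    (h : IsEigensystem (ntk σ γ) ρ.fst μ φ) :
    IsDiagonalized (kernelOp ρ.fst (isBddKernel_ntk (d := d) hd hσ hγ)) μ φ := by
  have hop : ∀ f : Lp ℝ 2 ρ.fst, kernelOp ρ.fst (isBddKernel_ntk (d := d) hd hσ hγ) f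
      =ᵐ[ρ.fst] integralOp (ntk σ γ) ρ.fst f := by
    intro f
    filter_upwards [kernelOp_ae (isBddKernel_ntk (d := d) hd hσ hγ) f, hρ.input] with x' h1 hx'
    rw [h1, integralOp]
    refine integral_congr_ae ?_
    filter_upwards [hρ.input] with x hx
    rw [clip_of_norm_le hx, clip_of_norm_le hx']
  refine ⟨h.orthonormal, fun i => ?_, fun f hf => ?_⟩
  · refine Lp.ext ?_
    filter_upwards [hop (φ i), h.eigen i, Lp.coeFn_smul (μ i) (φ i)] with x h1 h2 h3
    rw [h1, h2, h3, Pi.smul_apply, smul_eq_mul]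
  · refine Lp.ext ?_
    filter_upwards [hop f, h.complete f hf, Lp.coeFn_zero ℝ 2 ρ.fst] with x h1 h2 h3
    rw [h1, h2, h3]

end Regression

/-! ### The excess risk of the network -/

section ExcessRisk

variable {d : ℕ}

theorem sqDist_le_of_near {H : Type*} [NormedAddCommGroup H] [InnerProductSpace ℝ H]
    [FiniteDimensional ℝ H] {ν : Measure (Inp d)} [IsProbabilityMeasure ν] {Φ : Inp d → H} {κ : ℝ}
    (hΦ : IsFeature Φ κ) {f g : Inp d → ℝ} {G : Lp ℝ 2 ν} (hG : G =ᵐ[ν] g) {V : H} {E : ℝ}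
    (hE : ∀ᵐ x ∂ν, |f x - inner ℝ V (Φ x)| ≤ E) :
    sqDist ν f g ≤ ENNReal.ofReal (2 * E ^ 2)
      + 2 * ENNReal.ofReal (‖featureOp ν hΦ V - G‖ ^ 2) := by
  set F := featureOp ν hΦ V - G with hF
  have h1 : ENNReal.ofReal (‖F‖ ^ 2) = ∫⁻ x, ENNReal.ofReal (F x ^ 2) ∂ν := by
    rw [l2_norm_sq_eq, ofReal_integral_eq_lintegral_ofReal (Lp.memLp F).integrable_sq
      (Filter.Eventually.of_forall fun x => sq_nonneg _)]
  rw [h1, ← lintegral_const_mul' _ _ (by norm_num)]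
  calc sqDist ν f g ≤ ∫⁻ x, (ENNReal.ofReal (2 * E ^ 2) + 2 * ENNReal.ofReal (F x ^ 2)) ∂ν := by
        refine lintegral_mono_ae ?_
        filter_upwards [hE, hG, featureOp_ae hΦ V, Lp.coeFn_sub (featureOp ν hΦ V) G]
          with x h2 h3 h4 h5
        have h6 : F x = inner ℝ V (Φ x) - g x := by rw [hF, h5, Pi.sub_apply, h4, h3]
        rw [h6, show (2 : ℝ≥0∞) = ENNReal.ofReal 2 by simp, ← ENNReal.ofReal_mul (by norm_num),
          ← ENNReal.ofReal_add (by positivity) (by positivity)]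
        refine ENNReal.ofReal_le_ofReal ?_
        have h7 : (f x - inner ℝ V (Φ x)) ^ 2 ≤ E ^ 2 := by
          rw [← sq_abs]; exact pow_le_pow_left₀ (abs_nonneg _) h2 2
        nlinarith [sq_nonneg ((f x - inner ℝ V (Φ x)) - (inner ℝ V (Φ x) - g x))]
    _ = _ := by
        rw [lintegral_add_left measurable_const, lintegral_const, measure_univ, mul_one]

variable {σ : ℝ → ℝ} {C γ η θ lam : ℝ} {ρ : Measure (Inp d × ℝ)} [IsProbabilityMeasure ρ]

theorem expectedExcessRisk_le_linear (hσ : IsSmoothActivation σ C) (hγ : γ ∈ Icc (0 : ℝ) 1)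
    (hρ : IsBoundedData ρ) {m : ℕ} (hm : 0 < m) {w : Fin m → Inp d} (hw : ∀ r, ‖w r‖ ≤ 1)
    (hlam : 0 ≤ lam) (hη : 0 < η) (hθ : 0 < θ) (hθ1 : θ < 1) {K : ℝ}
    (hK : 208 * (1 + kappa C) ^ 4 / (1 - θ) ≤ K) (hηK : η * (lam + K) < 1) {T : ℕ} (hT : 0 < T)
    (hM : (T : ℝ) ^ (6 - 5 * θ) ≤ (m + m : ℕ)) {G : Lp ℝ 2 ρ.fst}
    (hG : G =ᵐ[ρ.fst] regressionFn ρ) :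
    expectedExcessRisk σ γ lam η θ ρ (symInit w) T
      ≤ ENNReal.ofReal (2 * linearizationConst C ^ 2 * (T : ℝ) ^ (-θ))
        + 2 * ∫⁻ z, ENNReal.ofReal (‖featureOp ρ.fst (isFeature_networkGrad hσ hγ hm hw)
          (linSgd (fun x => networkGrad σ γ (symInit w) (clip x)) lam (stepSize η θ) T z) - G‖ ^ 2)
            ∂(Measure.pi fun _ : Fin T => ρ) := by
  have hz1 : ∀ᵐ z ∂ρ, ‖z.1‖ ≤ 1 ∧ |z.2| ≤ 1 := by
    have h1 : ∀ᵐ z ∂ρ, ‖z.1‖ ≤ 1 := by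
      have h2 := hρ.input
      rw [Measure.fst, ae_map_iff measurable_fst.aemeasurable
        (measurableSet_le measurable_norm measurable_const)] at h2
      exact h2
    filter_upwards [h1, hρ.output] with z h2 h3
    exact ⟨h2, abs_le.2 h3⟩
  have hz : ∀ᵐ z ∂(Measure.pi fun _ : Fin T => ρ), ∀ i, ‖(z i).1‖ ≤ 1 ∧ |(z i).2| ≤ 1 :=
    Filter.eventually_all.2 fun i =>
      (Measure.tendsto_eval_ae_ae (i := i) (μ := fun _ : Fin T => ρ)).eventually hz1
  have hsq : 2 * (linearizationConst C * (T : ℝ) ^ (-(θ / 2))) ^ 2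
      = 2 * linearizationConst C ^ 2 * (T : ℝ) ^ (-θ) := by
    rw [mul_pow, ← Real.rpow_natCast ((T : ℝ) ^ (-(θ / 2))), ← Real.rpow_mul (by positivity)]
    push_cast
    ring_nf
  rw [expectedExcessRisk, ← lintegral_const_mul' _ _ (by norm_num)]
  calc _ ≤ ∫⁻ z, (ENNReal.ofReal (2 * linearizationConst C ^ 2 * (T : ℝ) ^ (-θ))
        + 2 * ENNReal.ofReal (‖featureOp ρ.fst (isFeature_networkGrad hσ hγ hm hw)
          (linSgd (fun x => networkGrad σ γ (symInit w) (clip x)) lam (stepSize η θ) T z)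
            - G‖ ^ 2)) ∂(Measure.pi fun _ : Fin T => ρ) := by
        refine lintegral_mono_ae (hz.mono fun z hz => ?_)
        rw [← hsq]
        exact sqDist_le_of_near _ hG (hρ.input.mono fun x hx =>
          abs_network_sgd_sub_le hσ hγ hm hw hlam hη hθ hθ1 hK hηK hT hM hz hx)
    _ = _ := by
        rw [lintegral_add_left measurable_const, lintegral_const, measure_univ, mul_one]

/-- With high probability the random features of the network are close to the tangent kernel. -/
theorem measure_kernelSq_networkGrad_le (hd : 0 < d) (hσ : IsSmoothActivation σ C)
    (hγ : γ ∈ Icc (0 : ℝ) 1) {m : ℕ} (hm : 0 < m) (ν : Measure (Inp d)) [IsProbabilityMeasure ν]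
    {δ : ℝ} (hδ : 0 < δ) :
    ENNReal.ofReal (1 - δ) ≤ initLaw d m {w | (∀ r, ‖w r‖ ≤ 1) ∧
      kernelSq ν (fun x x' => inner ℝ (networkGrad σ γ (symInit w) (clip x))
        (networkGrad σ γ (symInit w) (clip x')) - ntk σ γ (clip x) (clip x'))
        ≤ 32 * kappa C ^ 4 * Real.log (2 / δ) / (m + m : ℕ)} := by
  have := isProbabilityMeasure_sphereUniform hd
  have hm0 : (0 : ℝ) < m := by exact_mod_cast hm
  have hw : ∀ᵐ w ∂(initLaw d m), ∀ r, ‖w r‖ ≤ 1 :=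
    Filter.eventually_all.2 fun r =>
      (Measure.tendsto_eval_ae_ae (i := r) (μ := fun _ : Fin m => sphereUniform d)).eventually
        ae_norm_sphereUniform
  refine ((isCenteredField_tangentDev hd hσ hγ).measure_fieldSq_le (ν := ν.prod ν) hm hδ).trans
    (measure_mono_ae (hw.mono fun w hw h => ⟨hw, ?_⟩))
  -- With `B = 2 κ²` the bound is `16 κ⁴ log(2/δ) / m`, that is `32 κ⁴ log(2/δ)` over the full width
  -- `m + m`.
  rw [kernelSq_networkGrad hd hσ hγ hm ν hw, div_le_div_iff₀ (by positivity) (by positivity)]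
  have h1 : fieldSq (ν.prod ν) (tangentDev σ γ) m w
      ≤ 4 * m * (2 * kappa C ^ 2) ^ 2 * Real.log (2 / δ) := h
  calc _ ≤ 4 * m * (2 * kappa C ^ 2) ^ 2 * Real.log (2 / δ) * ((m + m : ℕ) : ℝ) := by gcongr
    _ = _ := by push_cast; ring

variable {μ : ℕ → ℝ} {φ : ℕ → Lp ℝ 2 ρ.fst} {r β b c : ℝ}

/-- The free term `D` lets both regimes of `θ` be treated at once. -/
theorem exists_excessRisk_bound (hd : 0 < d) (hσ : IsSmoothActivation σ C)
    (hγ : γ ∈ Icc (0 : ℝ) 1) (hρ : IsBoundedData ρ) (hμφ : IsEigensystem (ntk σ γ) ρ.fst μ φ)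
    (hr : 1 / 2 < r) (hr1 : r ≤ 1) (hsource : InPowerRange μ φ r (regressionFn ρ)) (hβ : 1 < β)
    (hb : 0 < b)
    (hdecay : ∀ i : ℕ, b * ((i : ℝ) + 1) ^ (-β) ≤ μ i ∧ μ i ≤ c * ((i : ℝ) + 1) ^ (-β))
    (hθ : 1 / 2 < θ) (hθ1 : θ < 1) (hη : 0 < η) :
    ∃ C₁ : ℝ, 0 < C₁ ∧ ∀ (lam : ℝ) (T : ℕ), 0 < lam → 0 < T → η < etaBound (kappa C) lam θ →
      ∀ m : ℕ, widthBound T lam θ ≤ m + m → ∀ δ : ℝ, 0 < δ → δ < 1 → ∀ D : ℝ, 0 ≤ D →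
      (θ ≤ (2 - 1 / β) * (1 - θ) ∨ Real.exp (-(η * lam * (T : ℝ) ^ (1 - θ))) ≤ D) →
      ENNReal.ofReal (1 - δ) ≤ initLaw d m
        {w | expectedExcessRisk σ γ lam η θ ρ (symInit w) T ≤
          ENNReal.ofReal (C₁ * ((T : ℝ) ^ (-(2 * r * (1 - θ))) + D + (T : ℝ) ^ (-θ)
            + lam ^ (2 * r)) * Real.log (2 / δ))} := by
  obtain ⟨G, h, hG, hsum⟩ := hsource
  have hS : IsSource ρ.fst (isBddKernel_ntk (d := d) hd hσ hγ) μ φ r β c G h :=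
    { diag := isDiagonalized_of_isEigensystem hd hσ hγ hρ hμφ
      pos := fun i => lt_of_lt_of_le (by positivity) (hdecay i).1
      decay := fun i => (hdecay i).2
      one_lt := hβ
      half_lt := hr
      le_one := hr1
      source := hsum }
  have hκ := two_le_kappa C
  obtain ⟨K, hK, hηK⟩ := exists_stepConstant (κ := kappa C) (by linarith) hθ hθ1
  have hθ' : 0 < 1 - θ := by linarith
  have hK2 : 2 * kappa C ^ 2 ≤ K := by
    refine le_trans ?_ hK
    rw [le_div_iff₀ hθ']
    have e1 : kappa C ^ 2 ≤ (1 + kappa C) ^ 2 := by gcongr; linarith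
    have e2 : (1 + kappa C) ^ 2 ≤ (1 + kappa C) ^ 4 :=
      pow_le_pow_right₀ (by linarith) (by norm_num)
    calc 2 * kappa C ^ 2 * (1 - θ) ≤ 2 * kappa C ^ 2 * 1 := by gcongr; linarith
      _ ≤ 208 * (1 + kappa C) ^ 4 := by linarith [sq_nonneg (kappa C)]
  have hK0 : 0 < K := lt_of_lt_of_le (by positivity) hK2
  -- `c₀` bounds `1/(1 - η lam)` uniformly in `lam`, because `η (lam + K) < 1` means `1 - η lam > η
  -- K`.
  obtain ⟨C₂, hC₂, hrisk⟩ := hS.exists_risk_bound hη hθ hθ1 (c₀ := 1 / (η * K)) (by positivity)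
    (Kd := 32 * kappa C ^ 4) (by positivity) (kappa C)
  refine ⟨4 * linearizationConst C ^ 2 + 2 * C₂, by positivity, ?_⟩
  intro lam T hlam hT hη' m hm δ hδ hδ1 D hD hcase
  have hηK' := hηK lam η hlam hη'
  obtain ⟨hM1, hM2, hM3⟩ := le_of_widthBound_le hm
  have hT1 : (1 : ℝ) ≤ T := by exact_mod_cast hT
  have hT0 : (0 : ℝ) < T := by linarith
  have hM0 : (0 : ℝ) < (m + m : ℕ) := lt_of_lt_of_le (by positivity) hM1
  have hm0 : 0 < m := by
    have : 0 < m + m := by exact_mod_cast hM0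
    omega
  -- From `2 ℓ ≥ 1` the terms without a logarithm can be multiplied by `2 ℓ`.
  have hℓ : 1 / 2 ≤ Real.log (2 / δ) := by
    have h2 : Real.log 2 ≤ Real.log (2 / δ) :=
      Real.log_le_log (by norm_num) (by rw [le_div_iff₀ hδ]; linarith)
    linarith [Real.log_two_gt_d9]
  set ℓ := Real.log (2 / δ)
  refine (measure_kernelSq_networkGrad_le hd hσ hγ hm0 ρ.fst hδ).trans
    (measure_mono fun w hw => ?_)
  obtain ⟨hw1, hdev⟩ := hw
  have hmodel : IsFeatureModel ρ (fun x x' : Inp d => ntk σ γ (clip x) (clip x')) η θ (kappa C)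
      (1 / (η * K)) (32 * kappa C ^ 4) (fun x => networkGrad σ γ (symInit w) (clip x))
      (isFeature_networkGrad hσ hγ hm0 hw1) G lam T ℓ := by
    refine ⟨isRegression_of_ae_eq hρ _ hG, hlam, hT, hℓ, ?_, ?_, hdev.trans ?_, hdev.trans ?_⟩
    · rw [div_mul_eq_mul_div, one_mul, le_div_iff₀ (by positivity)]
      linarith
    · have : η * (2 * kappa C ^ 2) ≤ η * K := by gcongr
      linarith
    -- The width condition `T^{2θ} ≤ M`, weakened to `T^θ ≤ M`, controls the deviation itself; `T^θ
    -- / lam² ≤ M` gives the version with the factor `lam²`.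
    · rw [div_eq_mul_inv]
      gcongr
      rw [Real.rpow_neg hT0.le]
      gcongr
      exact le_trans (Real.rpow_le_rpow_of_exponent_le hT1 (by linarith)) hM2
    · rw [div_eq_mul_inv, mul_assoc (32 * kappa C ^ 4 * ℓ)]
      gcongr
      rw [Real.rpow_neg hT0.le, ← div_eq_inv_mul, inv_le_comm₀ hM0 (by positivity), inv_div]
      exact hM3
  have hlin := hrisk _ _ (isFeature_networkGrad hσ hγ hm0 hw1) lam T ℓ D hmodel hD hcase
  refine (expectedExcessRisk_le_linear hσ hγ hρ hm0 hw1 hlam.le hη (by linarith) hθ1 hK hηK' hT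
    hM1 hG).trans ((add_le_add le_rfl (mul_le_mul_right hlin 2)).trans ?_)
  rw [show (2 : ℝ≥0∞) = ENNReal.ofReal 2 by simp, ← ENNReal.ofReal_mul (by norm_num),
    ← ENNReal.ofReal_add (by positivity) (by positivity)]
  refine ENNReal.ofReal_le_ofReal ?_
  have h1 : 0 ≤ (T : ℝ) ^ (-(2 * r * (1 - θ))) := by positivity
  have h2 : 0 ≤ (T : ℝ) ^ (-θ) := by positivity
  have h3 : 0 ≤ lam ^ (2 * r) := by positivity
  have h4 : (T : ℝ) ^ (-θ) ≤ 2 * (((T : ℝ) ^ (-(2 * r * (1 - θ))) + D + (T : ℝ) ^ (-θ)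
      + lam ^ (2 * r)) * ℓ) := by
    set X := (T : ℝ) ^ (-(2 * r * (1 - θ))) + D + (T : ℝ) ^ (-θ) + lam ^ (2 * r) with hX
    have hX0 : (T : ℝ) ^ (-θ) ≤ X := by linarith
    nlinarith
  calc _ ≤ 2 * linearizationConst C ^ 2 * (2 * (((T : ℝ) ^ (-(2 * r * (1 - θ))) + D
          + (T : ℝ) ^ (-θ) + lam ^ (2 * r)) * ℓ))
        + 2 * (C₂ * (((T : ℝ) ^ (-(2 * r * (1 - θ))) + D + (T : ℝ) ^ (-θ)
          + lam ^ (2 * r)) * ℓ)) := by gcongr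
    _ = _ := by ring

/-- The threshold is where the variance `T^{-(2-1/β)(1-θ)}` of the early steps meets `T^{-θ}`. -/
theorem le_of_lt_threshold (hβ : 1 < β) (hθ : θ < (2 * β - 1) / (3 * β - 1)) :
    θ ≤ (2 - 1 / β) * (1 - θ) := by
  rw [lt_div_iff₀ (by linarith)] at hθ
  have h : (2 - 1 / β) * (1 - θ) - θ = (2 * β - 1 - θ * (3 * β - 1)) / β := by
    field_simp
    ring
  have : 0 ≤ (2 * β - 1 - θ * (3 * β - 1)) / β := div_nonneg (by linarith) (by linarith)
  linarith

end ExcessRisk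

end NTKSGD

theorem theorem1
    {d : ℕ} (hd : 0 < d)
    (σ : ℝ → ℝ) (Cσ : ℝ) (hσ : NTKSGD.IsSmoothActivation σ Cσ)
    (γ : ℝ) (hγ : γ ∈ Set.Icc (0 : ℝ) 1)
    (ρ : MeasureTheory.Measure (NTKSGD.Inp d × ℝ)) [MeasureTheory.IsProbabilityMeasure ρ]
    (hρ : NTKSGD.IsBoundedData ρ)
    (μ : ℕ → ℝ) (φ : ℕ → MeasureTheory.Lp ℝ 2 ρ.fst)
    (hμφ : NTKSGD.IsEigensystem (NTKSGD.ntk σ γ) ρ.fst μ φ)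
    (r : ℝ) (hr : 1 / 2 < r) (hr1 : r ≤ 1)
    (hsource : NTKSGD.InPowerRange μ φ r (NTKSGD.regressionFn ρ))
    (β b c : ℝ) (hβ : 1 < β) (hb : 0 < b) (hc : 0 < c)
    (hdecay : ∀ i : ℕ, b * ((i : ℝ) + 1) ^ (-β) ≤ μ i ∧ μ i ≤ c * ((i : ℝ) + 1) ^ (-β))
    (θ : ℝ) (hθ : 1 / 2 < θ) (hθ1 : θ < 1) (η : ℝ) (hη : 0 < η) :
    ∃ C : ℝ, 0 < C ∧
      ∀ (lam : ℝ) (T : ℕ), 0 < lam → 0 < T →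
        η < NTKSGD.etaBound (NTKSGD.kappa Cσ) lam θ →
      ∀ m : ℕ, NTKSGD.widthBound T lam θ ≤ m + m →
      ∀ δ : ℝ, 0 < δ → δ < 1 →
        (θ < (2 * β - 1) / (3 * β - 1) →
          ENNReal.ofReal (1 - δ) ≤ NTKSGD.initLaw d m
            {w | NTKSGD.expectedExcessRisk σ γ lam η θ ρ (NTKSGD.symInit w) T ≤
              ENNReal.ofReal (C * ((T : ℝ) ^ (-(2 * r * (1 - θ)))
                + Real.exp (-(NTKSGD.Hfun η θ
                    * (T : ℝ) ^ (1 - (3 * β - 1) / (2 * β - 1) * θ)))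
                + (T : ℝ) ^ (-θ) + lam ^ (2 * r)) * Real.log (2 / δ))}) ∧
        ((2 * β - 1) / (3 * β - 1) ≤ θ →
          ENNReal.ofReal (1 - δ) ≤ NTKSGD.initLaw d m
            {w | NTKSGD.expectedExcessRisk σ γ lam η θ ρ (NTKSGD.symInit w) T ≤
              ENNReal.ofReal (C * ((T : ℝ) ^ (-(2 * r * (1 - θ)))
                + Real.exp (-(NTKSGD.Hfun η θ * lam * (T : ℝ) ^ (1 - θ)))
                + (T : ℝ) ^ (-θ) + lam ^ (2 * r)) * Real.log (2 / δ))}) := by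
  obtain ⟨C, hC, h⟩ := NTKSGD.exists_excessRisk_bound hd hσ hγ hρ hμφ hr hr1 hsource hβ hb hdecay
    hθ hθ1 hη
  refine ⟨C, hC, fun lam T hlam hT hηb m hm δ hδ hδ1 => ⟨fun hcase => ?_, fun _ => ?_⟩⟩
  -- Below the threshold the polynomial estimate suffices, and the exponential enters only as a
  -- nonnegative summand.
  · exact h lam T hlam hT hηb m hm δ hδ hδ1 _ (Real.exp_pos _).le
      (Or.inl (NTKSGD.le_of_lt_threshold hβ hcase))
  -- The contraction yields the rate `η`, at least as fast as the stated `H(θ)`.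
  · refine h lam T hlam hT hηb m hm δ hδ hδ1 _ (Real.exp_pos _).le (Or.inr ?_)
    have hH := NTKSGD.Hfun_le hη (by linarith) hθ1
    gcongr
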